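/- Let $1\le y<z$ be integers and $\alpha\in\mathbb R$. An instance of the $(\alpha,z,y)$-Johnson Coverage problem is a triple $(U,E,k)$ with a universe $U=[n]$, a collection $E\subseteq\binom{U}{z}$ and an integer $k\ge 1$; one has to distinguish between the case (completeness) that there are $S_1,\dots,S_k\in\binom{U}{y}$ such that every $T\in E$ contains some $S_i$, and the case (soundness) that for all $S_1,\dots,S_k\in\binom{U}{y}$ at most $\alpha|E|$ of the sets $T\in E$ contain some $S_i$. The dense problem, $(\alpha,z,y)$-Johnson Coverage$^*$, is the restriction to instances with $E\neq\emptyset$ and $|E|=\omega(k\cdot|U|^{z-y-1})$; it is called NP-hard if there is a function $g:\mathbb N\to\mathbb R$ with $g(m)\to\infty$ as $m\to\infty$ such that the gap problem restricted to the instances with $E\neq\emptyset$ and $|E|\ge g(|U|)\cdot k\cdot|U|^{z-y-1}$ is NP-hard. Here and below, NP-hardness of a gap problem means that every language in NP has a polynomial-time many-one reduction to it, which maps members of the language to completeness instances and non-members to soundness instances. For real numbers $\gamma,\rho,K$, let $\mathrm{Gap}(\gamma,\rho,K)$ be the following gap problem for continuous Euclidean $k$-means: given a set $\mathcal P\subset\{0,1\}^d$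 of $n\ge 2$ points, with $d\le K\log n$, and an integer $k\ge 1$, distinguish between - Completeness: there are $c_1,\dots,c_k\in\mathbb R^d$ and $\sigma:\mathcal P\to\{c_1,\dots,c_k\}$ with $\sum_{a\in\mathcal P}\|a-\sigma(a)\|_2^2\le\rho\, n\log n$; - Soundness: for all $c_1,\dots,c_k\in\mathbb R^d$ and all $\sigma:\mathcal P\to\{c_1,\dots,c_k\}$, $\sum_{a\in\mathcal P}\|a-\sigma(a)\|_2^2\ge\gamma\cdot\rho\, n\log n$. **Theorem.** (1) If $(\alpha,z,y)$-Johnson Coverage$^*$ is NP-hard, then for every constant $\varepsilon>0$ there are constants $\rho>0$ and $K$ such that $\mathrm{Gap}\left(1+\frac{1-\alpha}{z-y}-\varepsilon,\ \rho,\ K\right)$ is NP-hard. (2) Assume the dense Johnson Coverage Hypothesis JCH$^*$: for every $\varepsilon>0$ there is an integer $z\ge 2$ such that $(1-\frac1e+\varepsilon,z,z-1)$-Johnson Coverage$^*$ is NP-hard. Then for every constant $\varepsilon>0$ there are constants $\rho>0$ and $K$ such that $\mathrm{Gap}\left(1+\frac1e-\varepsilon,\ \rho,\ K\right)$ is NP-hard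 (where $1+\frac1e\approx 1.36$). -/

import Mathlib

/-! ### Polynomial time, `NP`, and `NP`-hardness of promise problems -/

/-- `f` is computable in polynomial time by a (multi-stack) Turing machine. -/
def PolyTimeComputable {A B : Type} (f : List A → List B) : Prop :=
  Nonempty (Turing.TM2ComputableInPolyTime (id : List A → List A) (id : List B → List B) f)

/-- The complexity class `NP`: `x ∈ L` iff there is a certificate `w`, of length polynomial in the
length of `x`, such that the polynomial-time verifier `V` accepts the pair `(x, w)`. -/
def InNP (L : Language Bool) : Prop :=
  ∃ (p : Polynomial ℕ) (V : List Bool × List Bool → Bool),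
    Nonempty (Turing.TM2ComputableInPolyTime
      (Computability.encodingProd (Computability.encodingList Bool)
        (Computability.encodingList Bool)).encode
      Computability.encodeBool V) ∧
    ∀ x : List Bool, x ∈ L ↔ ∃ w : List Bool, w.length ≤ p.eval x.length ∧ V (x, w) = true

/-- A promise (gap) problem over the alphabet `A`: the task is to distinguish the strings in `yes`
from the strings in `no`. -/
structure PromiseProblem (A : Type) where
  yes : Set (List A)
  no : Set (List A)

/-- `NP`-hardness of a promise problem, under polynomial-time many-one reductions. -/
def PromiseProblem.NPHard {A : Type} (Q : PromiseProblem A) : Prop :=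
  ∀ L : Language Bool, InNP L → ∃ f : List Bool → List A, PolyTimeComputable f ∧
    (∀ x, x ∈ L → f x ∈ Q.yes) ∧ (∀ x, x ∉ L → f x ∈ Q.no)

/-! ### Encoding of instances

An instance of either problem below is a number `k` together with a finite set of Boolean vectors
of a common length (the incidence vectors of the hyperedges, respectively the points). -/

/-- `k` in binary, followed by the vectors of the list, each preceded by a comma. -/
def encodeInstance (k : ℕ) (L : List (List Bool)) : List Computability.Γ' :=
  (Computability.encodeNat k).map Computability.Γ'.bit ++
    L.flatMap (fun v => Computability.Γ'.comma :: v.map Computability.Γ'.bit)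

/-- The string `s` encodes the number `k` and the set `X ⊆ {0,1}^m`, whose elements are listed
without repetition in some order. -/
def Encodes (s : List Computability.Γ') (k : ℕ) {m : ℕ} (X : Finset (Fin m → Bool)) : Prop :=
  ∃ l : List (Fin m → Bool), l.Nodup ∧ l.toFinset = X ∧
    s = encodeInstance k (l.map (fun v => List.ofFn v))

/-! ### Johnson Coverage -/

/-- An instance `(U, E, k)` with universe `U = Fin n` and a collection `E` of `z`-element
subsets of `U`. -/
structure JohnsonInstance (z : ℕ) where
  n : ℕ
  E : Finset (Finset (Fin n))
  k : ℕ
  uniform : ∀ T ∈ E, T.card = z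

namespace JohnsonInstance

variable {z : ℕ} (I : JohnsonInstance z)

/-- The sets of `E` that contain `S`. -/
def cov (S : Finset (Fin I.n)) : Finset (Finset (Fin I.n)) :=
  I.E.filter (fun T => S ⊆ T)

/-- The sets of `E` that contain at least one of `S₁, …, S_k`. -/
def coverage (S : Fin I.k → Finset (Fin I.n)) : Finset (Finset (Fin I.n)) :=
  Finset.univ.biUnion (fun i => I.cov (S i))

/-- Some `k` sets of size `y` cover all of `E`. -/
def Complete (y : ℕ) : Prop :=
  ∃ S : Fin I.k → Finset (Fin I.n), (∀ i, (S i).card = y) ∧ I.coverage S = I.E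

/-- Any `k` sets of size `y` cover at most an `α` fraction of `E`. -/
def Sound (α : ℝ) (y : ℕ) : Prop :=
  ∀ S : Fin I.k → Finset (Fin I.n), (∀ i, (S i).card = y) →
    ((I.coverage S).card : ℝ) ≤ α * (I.E.card : ℝ)

/-- The (nondegenerate) instance satisfies `|E| ≥ g(|U|) · k · |U|^(z - y - 1)`. -/
def Dense (y : ℕ) (g : ℕ → ℝ) : Prop :=
  I.E.Nonempty ∧ 1 ≤ I.k ∧
    g I.n * (I.k : ℝ) * (I.n : ℝ) ^ (z - y - 1) ≤ (I.E.card : ℝ)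

/-- `E` is written down through the incidence vectors of its members. -/
def EncodedBy (s : List Computability.Γ') : Prop :=
  Encodes s I.k (I.E.image (fun T => fun i => decide (i ∈ T)))

end JohnsonInstance

/-- The `(α, z, y)`-Johnson Coverage problem on the instances with
`|E| ≥ g(|U|) · k · |U|^(z - y - 1)`. -/
def denseJohnsonCoverage (α : ℝ) (z y : ℕ) (g : ℕ → ℝ) : PromiseProblem Computability.Γ' where
  yes := {s | ∃ I : JohnsonInstance z, I.EncodedBy s ∧ I.Dense y g ∧ I.Complete y}
  no := {s | ∃ I : JohnsonInstance z, I.EncodedBy s ∧ I.Dense y g ∧ I.Sound α y}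

/-- The dense `(α, z, y)`-Johnson Coverage problem is `NP`-hard: the `(α, z, y)`-Johnson Coverage
problem is `NP`-hard on a class of instances with `|E| = ω(k · |U|^(z - y - 1))`. -/
def DenseJohnsonCoverageNPHard (α : ℝ) (z y : ℕ) : Prop :=
  ∃ g : ℕ → ℝ, Filter.Tendsto g Filter.atTop Filter.atTop ∧ (denseJohnsonCoverage α z y g).NPHard

/-- The dense Johnson Coverage Hypothesis. -/
def DenseJohnsonCoverageHypothesis : Prop :=
  ∀ ε : ℝ, 0 < ε → ∃ z : ℕ, 2 ≤ z ∧
    DenseJohnsonCoverageNPHard (1 - 1 / Real.exp 1 + ε) z (z - 1)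

/-! ### Continuous Euclidean `k`-means -/

/-- A vector of `{0,1}^d` as a point of Euclidean space `ℝ^d`. -/
noncomputable def boolPoint {d : ℕ} (a : Fin d → Bool) : EuclideanSpace ℝ (Fin d) :=
  WithLp.toLp 2 (fun i => if a i then (1 : ℝ) else 0)

/-- The `k`-means cost of the point set `P` for centers `c₁, …, c_k ∈ ℝ^d` and the assignment `σ`
of points to centers. -/
noncomputable def kMeansCost {d k : ℕ} (P : Finset (Fin d → Bool))
    (c : Fin k → EuclideanSpace ℝ (Fin d)) (σ : P → Fin k) : ℝ :=
  ∑ a : P, ‖boolPoint (a : Fin d → Bool) - c (σ a)‖ ^ 2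

/-- The gap version of continuous Euclidean `k`-means, with gap `γ` and threshold `ρ n log n`, on
sets `P ⊆ {0,1}^d` of `n ≥ 2` points with `d ≤ K log n`. -/
noncomputable def kMeansGap (γ ρ K : ℝ) : PromiseProblem Computability.Γ' where
  yes := {s | ∃ (d k : ℕ) (P : Finset (Fin d → Bool)), Encodes s k P ∧
    1 ≤ k ∧ 2 ≤ P.card ∧ (d : ℝ) ≤ K * Real.log P.card ∧
    ∃ (c : Fin k → EuclideanSpace ℝ (Fin d)) (σ : P → Fin k),
      kMeansCost P c σ ≤ ρ * P.card * Real.log P.card}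
  no := {s | ∃ (d k : ℕ) (P : Finset (Fin d → Bool)), Encodes s k P ∧
    1 ≤ k ∧ 2 ≤ P.card ∧ (d : ℝ) ≤ K * Real.log P.card ∧
    ∀ (c : Fin k → EuclideanSpace ℝ (Fin d)) (σ : P → Fin k),
      γ * (ρ * P.card * Real.log P.card) ≤ kMeansCost P c σ}

/-! Every element `u` of the universe gets a code word `φ u ⊆ [D]` of size `n ≈ log₂ |E|`, any two
of which share at most `n / b` positions; a hyperedge `T` becomes the 0/1 vector supported on the
union of its words. As the words are almost disjoint, the squared distance between the points of `T`
and `T'` is at least `2n(z - |T ∩ T'| - 2z²/b)` (`IsCode.le_dist_sq`), while the point of a `y`-set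
`S` has squared distance at most `(z - y)n` from that of every `T ⊇ S` (`IsCode.dist_sq_le`). A full
cover thus costs at most `(z - y)n|E|`.

For soundness, the cost of a cluster `C` is at least the sum of its pairwise squared distances
divided by `2|C|`, so what is needed is an upper bound on the sum of all `|T ∩ T'|`
(`exists_sum_card_inter_le`). This sum is `∑ deg(u)²`. Elements of degree below `|C|/h` contribute
little, and at most `hz` heavy ones remain. A set `T` with fewer than `y` heavy elements meets each
other set in at most `y - 1` of them. If it has exactly `y`, one more is gained only with those `T'`
that contain all `y`, and there are at most `a_C` of these, the largest number of members of `C`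
above a common `y`-set. Sets with more heavy elements number at most `2^(hz) |U|^(z-y-1)`. So `C`
costs at least about `n((z - y + 1)|C| - a_C)`, with an error whose sum over the `k` clusters is
negligible by density. The maximizing `y`-sets form a candidate solution, whence `∑ a_C ≤ α|E|`, and
the cost is at least about `(z - y + 1 - α)n|E|`. The ratio of the two costs is `1 + (1 - α)/(z -
y)`.

The code consists of words of length `n` over an alphabet of `Q = (4z)^b` letters, written in
one-hot form and chosen greedily. A weighted count (`mul_le_length_greedyCode`) gives at least
`z|E|` words, enough for all elements that occur. The dimension `nQ` is `O(log |E|)`, and the `Q^n`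
candidates are polynomially many.

Polynomial time is proved through a small language of stack programs, compiled to a Turing machine
that runs after the assumed reduction. Density supplies the required constant only for large
universes. On a small universe a long input has `k ≥ |E|`, so it is a completeness instance; the
finitely many short inputs are answered from a table. For `α ≥ 1` the gap is below 1 and one fixed
instance serves both sides. The second claim is the case `y = z - 1`. -/

/-! ### A structured programming language over registers that hold stacks -/

/-- Structured programs over registers `R`, each of which holds a stack over the alphabet `A`. -/
inductive StackProg (R A : Type) : Type
  | skip : StackProg R A
  | push (Y X : R) (g : Option A → A) : StackProg R A
  | pop (X : R) : StackProg R A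
  | seq (P Q : StackProg R A) : StackProg R A
  | case (X : R) (f : Option A → StackProg R A) : StackProg R A
  | loop (X : R) (p : Option A → Bool) (P : StackProg R A) : StackProg R A

namespace StackProg

variable {R A : Type}

/-! ### Operational semantics of stack programs. -/

section semantics

variable [DecidableEq R]

/-- `Run P s t s'`: started on the registers `s`, the program `P` ends with `s'` after exactly `t`
steps. -/
inductive Run : StackProg R A → (R → List A) → ℕ → (R → List A) → Prop
  | skip (s) : Run skip s 1 s
  | push (Y X g s) : Run (push Y X g) s 1 (Function.update s Y (g (s X).head? :: s Y))
  | pop (X s) : Run (pop X) s 1 (Function.update s X (s X).tail)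
  | seq {P Q s s₁ s₂ a b} : Run P s a s₁ → Run Q s₁ b s₂ → Run (seq P Q) s (a + b) s₂
  | case {X f s a s'} : Run (f (s X).head?) s a s' → Run (case X f) s (1 + a) s'
  | loop_done {X p P s} : p (s X).head? = false → Run (loop X p P) s 1 s
  | loop_step {X p P s s₁ s₂ a b} : p (s X).head? = true → Run P s a s₁ →
      Run (loop X p P) s₁ b s₂ → Run (loop X p P) s (1 + (a + b)) s₂

/-- `Exec P s s' T`: started on the registers `s`, the program `P` ends with `s'` after at most `T`
steps. -/
def Exec (P : StackProg R A) (s s' : R → List A) (T : ℕ) : Prop :=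
  ∃ t ≤ T, Run P s t s'

end semantics

/-- The program points of a program. -/
def Lab : StackProg R A → Type
  | skip => Unit
  | push _ _ _ => Unit
  | pop _ => Unit
  | seq P Q => Lab P ⊕ Lab Q
  | case _ f => Option (Σ o, Lab (f o))
  | loop _ _ P => Option (Lab P)

/-- The point at which a program starts. -/
def entry : (P : StackProg R A) → Lab P
  | skip => ()
  | push _ _ _ => ()
  | pop _ => ()
  | seq P _ => Sum.inl (entry P)
  | case _ _ => none
  | loop _ _ _ => none

/-- The program points become machine labels, which must be finite in number; finiteness of the
alphabet enters through `case`, which has one branch per possible top symbol. -/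
theorem finite_lab [Finite A] : (P : StackProg R A) → Finite (Lab P)
  | skip => inferInstanceAs (Finite Unit)
  | push _ _ _ => inferInstanceAs (Finite Unit)
  | pop _ => inferInstanceAs (Finite Unit)
  | seq P Q => by
      have := finite_lab P
      have := finite_lab Q
      exact inferInstanceAs (Finite (Lab P ⊕ Lab Q))
  | case _ f => by
      have := fun o => finite_lab (f o)
      exact inferInstanceAs (Finite (Option (Σ o, Lab (f o))))
  | loop _ _ P => by
      have := finite_lab P
      exact inferInstanceAs (Finite (Option (Lab P)))

open Turing TM2.Stmt

/-! ### Compilation into statements of a multi-stack machine. -/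

section compile

variable {K : Type} {Γ : K → Type} {σ : Type}

/-- The stack alphabets of a machine that has stacks of its own beside the registers. -/
abbrev alphabets (Γ : K → Type) (R A : Type) : K ⊕ R → Type :=
  Sum.elim Γ (fun _ => A)

/-- The stacks of a machine that has stacks of its own beside the registers. -/
def joinStacks (S : ∀ k, List (Γ k)) (s : R → List A) : ∀ k, List (alphabets Γ R A k)
  | Sum.inl k => S k
  | Sum.inr r => s r

theorem update_joinStacks_inr [DecidableEq K] [DecidableEq R] (S : ∀ k, List (Γ k))
    (s : R → List A) (r : R) (l : List A) :
    Function.update (β := fun k => List (alphabets Γ R A k)) (joinStacks S s) (Sum.inr r) l =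
      joinStacks S (Function.update s r l) := by
  funext k
  rcases k with k | k
  · exact Function.update_of_ne (β := fun k => List (alphabets Γ R A k)) (by simp) _ _
  · by_cases h : k = r
    · subst h
      exact (Function.update_self (β := fun k => List (alphabets Γ R A k)) _ _ _).trans
        (Function.update_self k l s).symm
    · exact (Function.update_of_ne (β := fun k => List (alphabets Γ R A k))
        (by simpa using h) _ _).trans (show s k = Function.update s r l k from
          (Function.update_of_ne h l s).symm)

theorem update_joinStacks_inl [DecidableEq K] [DecidableEq R] (S : ∀ k, List (Γ k))
    (s : R → List A) (r : K) (l : List (Γ r)) :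
    Function.update (β := fun k => List (alphabets Γ R A k)) (joinStacks S s) (Sum.inl r) l =
      joinStacks (Function.update S r l) s := by
  funext k
  rcases k with k | k
  · by_cases h : k = r
    · subst h
      exact (Function.update_self (β := fun k => List (alphabets Γ R A k)) _ _ _).trans
        (Function.update_self k l S).symm
    · exact (Function.update_of_ne (β := fun k => List (alphabets Γ R A k))
        (by simpa using h) _ _).trans (show S k = Function.update S r l k from
          (Function.update_of_ne h l S).symm)
  · exact Function.update_of_ne (β := fun k => List (alphabets Γ R A k)) (by simp) _ _

/-- The statements of the machine that executes a program, given the embedding `e` of its points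
into the labels of the machine and the label `x` at which to continue. -/
def code {L : Type} : (P : StackProg R A) → (e : Lab P → L) → (x : L) → Lab P →
    TM2.Stmt (alphabets Γ R A) L (σ × Option A)
  | skip, _, x, _ => goto fun _ => x
  | push Y X g, _, x, _ =>
      -- The second component of the machine state holds the symbol read last; `g` and the tests see
      -- the register only through it.
      peek (Sum.inr X) (fun v o => (v.1, o))
        (TM2.Stmt.push (Sum.inr Y) (fun v => g v.2) (goto fun _ => x))
  | pop X, _, x, _ => TM2.Stmt.pop (Sum.inr X) (fun v _ => v) (goto fun _ => x)
  | seq P Q, e, _, Sum.inl l => code P (fun l => e (Sum.inl l)) (e (Sum.inr (entry Q))) l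
  | seq _ Q, e, x, Sum.inr l => code Q (fun l => e (Sum.inr l)) x l
  | case X f, e, _, none =>
      peek (Sum.inr X) (fun v o => (v.1, o)) (goto fun v => e (some ⟨v.2, entry (f v.2)⟩))
  | case _ f, e, x, some ⟨o, l⟩ => code (f o) (fun l => e (some ⟨o, l⟩)) x l
  | loop X p P, e, x, none =>
      peek (Sum.inr X) (fun v o => (v.1, o))
        (goto fun v => if p v.2 then e (some (entry P)) else x)
  | loop _ _ P, e, _, some l => code P (fun l => e (some l)) (e none) l

/-- `f` leads from `c` to `c'` in exactly `n` steps. -/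
def StepsTo {C : Type} (f : C → Option C) (n : ℕ) (c c' : C) : Prop :=
  (flip bind f)^[n] (some c) = some c'

theorem StepsTo.trans {C : Type} {f : C → Option C} {m n : ℕ} {a b c : C}
    (h₁ : StepsTo f m a b) (h₂ : StepsTo f n b c) : StepsTo f (m + n) a c := by
  unfold StepsTo at *
  rw [Nat.add_comm, Function.iterate_add_apply, h₁, h₂]

theorem StepsTo.single {C : Type} {f : C → Option C} {a b : C} (h : f a = some b) :
    StepsTo f 1 a b := h

theorem StepsTo.refl {C : Type} (f : C → Option C) (a : C) : StepsTo f 0 a a := rfl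

/-- Every primitive and every test compiles to one statement ending in a `goto`, that is, to one
machine step, so the two step counts agree exactly. The continuation `x` varies in the induction: it
is the entry of the second program in a sequence and the loop head in a loop body. Only the scratch
symbol is not tracked. -/
theorem stepsTo_of_run [DecidableEq K] [DecidableEq R] {P : StackProg R A} {s s' : R → List A}
    {t : ℕ} (h : Run P s t s') {L : Type}
    (M : L → TM2.Stmt (alphabets Γ R A) L (σ × Option A)) (e : Lab P → L) (x : L)
    (hM : ∀ l, M (e l) = code P e x l) (S : ∀ k, List (Γ k)) (v : σ) (o : Option A) :
    ∃ o', StepsTo (TM2.step M) t ⟨some (e (entry P)), (v, o), joinStacks S s⟩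
      ⟨some x, (v, o'), joinStacks S s'⟩ := by
  induction h generalizing x o with
  | skip s => exact ⟨o, StepsTo.single (by rw [TM2.step, hM]; rfl)⟩
  | push Y X g s =>
    refine ⟨(s X).head?, StepsTo.single ?_⟩
    rw [TM2.step, hM, ← update_joinStacks_inr]
    rfl
  | pop X s =>
    refine ⟨o, StepsTo.single ?_⟩
    rw [TM2.step, hM, ← update_joinStacks_inr]
    rfl
  | seq _ _ ih₁ ih₂ =>
    obtain ⟨o₁, h₁⟩ := ih₁ (fun l => e (Sum.inl l)) _ (fun l => hM (Sum.inl l)) o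
    obtain ⟨o₂, h₂⟩ := ih₂ (fun l => e (Sum.inr l)) _ (fun l => hM (Sum.inr l)) o₁
    exact ⟨o₂, h₁.trans h₂⟩
  | @case X f s a s' _ ih =>
    obtain ⟨o₁, h₁⟩ := ih (fun l => e (some ⟨_, l⟩)) _ (fun l => hM (some ⟨_, l⟩)) (s X).head?
    refine ⟨o₁, StepsTo.trans (StepsTo.single ?_) h₁⟩
    rw [TM2.step, hM]
    rfl
  | @loop_done X p P s hp =>
    refine ⟨(s X).head?, StepsTo.single ?_⟩
    rw [TM2.step, hM]
    change some (TM2.Cfg.mk (some (if p (s X).head? = true then _ else _)) _ _) = _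
    rw [hp]
    rfl
  | @loop_step X p P s s₁ s₂ a b hp _ _ ih₁ ih₂ =>
    obtain ⟨o₁, h₁⟩ := ih₁ (fun l => e (some l)) _ (fun l => hM (some l)) (s X).head?
    obtain ⟨o₂, h₂⟩ := ih₂ e _ hM o₁
    refine ⟨o₂, StepsTo.trans (StepsTo.single ?_) (h₁.trans h₂)⟩
    rw [TM2.step, hM]
    change some (TM2.Cfg.mk (some (if p (s X).head? = true then _ else _)) _ _) = _
    rw [hp]
    rfl

end compile

end StackProg

/-! ### A program executed after a machine -/

namespace StackProg

open Turing TM2.Stmt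

variable {R A : Type}

/-- The number of symbols that a statement can push. -/
def pushCount {K : Type} {Γ : K → Type} {Λ σ : Type} : TM2.Stmt Γ Λ σ → ℕ
  | TM2.Stmt.push _ _ q => pushCount q + 1
  | peek _ _ q => pushCount q
  | TM2.Stmt.pop _ _ q => pushCount q
  | load _ q => pushCount q
  | branch _ q₁ q₂ => pushCount q₁ + pushCount q₂
  | goto _ => 0
  | halt => 0

theorem length_stepAux_le {K : Type} [DecidableEq K] {Γ : K → Type} {Λ σ : Type}
    (q : TM2.Stmt Γ Λ σ) (v : σ) (S : ∀ k, List (Γ k)) (k : K) :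
    ((TM2.stepAux q v S).stk k).length ≤ (S k).length + pushCount q := by
  induction q generalizing v S with
  | push k' f q ih =>
    refine (ih _ _).trans ?_
    by_cases h : k = k'
    · subst h; simp [pushCount]; omega
    · simp [pushCount, h]
  | peek k' f q ih => exact ih _ _
  | pop k' f q ih =>
    refine (ih _ _).trans ?_
    by_cases h : k = k'
    · subst h; simp [pushCount]
    · simp [pushCount, h]
  | load f q ih => exact ih _ _
  | branch f q₁ q₂ ih₁ ih₂ =>
    simp only [TM2.stepAux, pushCount]
    cases f v
    · exact (ih₂ _ _).trans (by omega)
    · exact (ih₁ _ _).trans (by omega)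
  | goto f => exact Nat.le_add_right _ _
  | halt => exact Nat.le_add_right _ _

theorem StepsTo.head {C : Type} {f : C → Option C} {n : ℕ} {a c : C}
    (h : StepsTo f (n + 1) a c) : ∃ b, f a = some b ∧ StepsTo f n b c := by
  unfold StepsTo at h
  rw [Function.iterate_succ_apply] at h
  change (flip bind f)^[n] (f a) = some c at h
  cases hb : f a with
  | none =>
    rw [hb] at h
    have : (flip bind f)^[n] none = (none : Option C) := Function.iterate_fixed rfl n
    rw [this] at h
    exact absurd h (by simp)
  | some b => exact ⟨b, rfl, by rw [hb] at h; exact h⟩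

/-- This makes the output of a polynomial-time machine polynomially long, as needed to bound the
running time of a program that is executed on that output. -/
theorem exists_length_stk_le (tm : FinTM2) : ∃ D : ℕ, ∀ (n : ℕ) (c c' : tm.Cfg) (k : tm.K),
    StepsTo tm.step n c c' → (c'.stk k).length ≤ (c.stk k).length + n * D := by
  have := tm.ΛFin
  refine ⟨∑ l, pushCount (tm.m l), fun n => ?_⟩
  induction n with
  | zero =>
    intro c c' k h
    have : c = c' := Option.some.inj h
    simp [this]
  | succ n ih =>
    intro c c' k h
    obtain ⟨b, hb, h⟩ := h.head
    refine (ih b c' k h).trans ?_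
    obtain ⟨l, v, S⟩ := c
    cases l with
    | none => exact absurd hb (by simp)
    | some l =>
      have hb' : TM2.stepAux (tm.m l) v S = b := Option.some.inj hb
      have h₁ := length_stepAux_le (tm.m l) v S k
      rw [hb'] at h₁
      have h₂ : pushCount (tm.m l) ≤ ∑ l, pushCount (tm.m l) :=
        Finset.single_le_sum (f := fun l => pushCount (tm.m l)) (fun _ _ => Nat.zero_le _)
          (Finset.mem_univ l)
      rw [Nat.succ_mul]
      change _ ≤ (S k).length + _
      omega

/-! ### The machine that runs a program on the output of another machine. -/

section after

variable (tm : FinTM2) (P : StackProg R A) (X Y : R)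

/-- The labels of the machine that executes a program after a given machine: those of the machine,
the program points, and one each for the transfer of the output and for halting. -/
abbrev AfterLab : Type := tm.Λ ⊕ (Lab P ⊕ Bool)

/-- The statements of the given machine as statements of the combined machine. -/
def afterStmt : TM2.Stmt tm.Γ tm.Λ tm.σ →
    TM2.Stmt (alphabets tm.Γ R A) (AfterLab tm P) (tm.σ × Option A)
  | TM2.Stmt.push k f q => TM2.Stmt.push (Sum.inl k) (fun v => f v.1) (afterStmt q)
  | peek k f q => peek (Sum.inl k) (fun v o => (f v.1 o, v.2)) (afterStmt q)
  | TM2.Stmt.pop k f q => TM2.Stmt.pop (Sum.inl k) (fun v o => (f v.1 o, v.2)) (afterStmt q)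
  | load f q => load (fun v => (f v.1, v.2)) (afterStmt q)
  | branch f q₁ q₂ => branch (fun v => f v.1) (afterStmt q₁) (afterStmt q₂)
  | goto f => goto fun v => Sum.inl (f v.1)
  | halt => goto fun _ => Sum.inr (Sum.inr true)

/-- The statements of the combined machine. -/
def afterCode [Inhabited A] (out : tm.Γ tm.k₁ ≃ A) :
    AfterLab tm P → TM2.Stmt (alphabets tm.Γ R A) (AfterLab tm P) (tm.σ × Option A)
  | Sum.inl l => afterStmt tm P (tm.m l)
  | Sum.inr (Sum.inl l) => code P (fun l => Sum.inr (Sum.inl l)) (Sum.inr (Sum.inr false)) l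
  -- Popping from the output stack and pushing onto `X` reverses the word, so the program starts
  -- with the reversed output.
  | Sum.inr (Sum.inr true) =>
      TM2.Stmt.pop (Sum.inl tm.k₁) (fun v o => (v.1, o.map out))
        (branch (fun v => v.2.isSome)
          (TM2.Stmt.push (Sum.inr X) (fun v => v.2.getD default)
            (goto fun _ => Sum.inr (Sum.inr true)))
          (goto fun _ => Sum.inr (Sum.inl (entry P))))
  -- The prescribed final configuration carries the initial state, so the scratch symbol is reset
  -- before halting.
  | Sum.inr (Sum.inr false) => load (fun v => (v.1, none)) halt

variable [DecidableEq R]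

/-- The label at which the combined machine continues. -/
def afterNext (l : Option tm.Λ) : AfterLab tm P :=
  l.elim (Sum.inr (Sum.inr true)) Sum.inl

theorem stepAux_afterStmt (q : TM2.Stmt tm.Γ tm.Λ tm.σ) (v : tm.σ) (o : Option A)
    (S : ∀ k, List (tm.Γ k)) (s : R → List A) :
    TM2.stepAux (afterStmt tm P q) (v, o) (joinStacks S s) =
      ⟨some (afterNext tm P (TM2.stepAux q v S).l), ((TM2.stepAux q v S).var, o),
        joinStacks (TM2.stepAux q v S).stk s⟩ := by
  induction q generalizing v S with
  | push k f q ih =>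
    exact (congrArg (TM2.stepAux (afterStmt tm P q) (v, o))
      (update_joinStacks_inl S s k (f v :: S k))).trans (ih _ _)
  | peek k f q ih => exact ih _ _
  | pop k f q ih =>
    exact (congrArg (TM2.stepAux (afterStmt tm P q) (f v (S k).head?, o))
      (update_joinStacks_inl S s k (S k).tail)).trans (ih _ _)
  | load f q ih => exact ih _ _
  | branch f q₁ q₂ ih₁ ih₂ =>
    rw [afterStmt, TM2.stepAux, TM2.stepAux]
    cases f v
    · exact ih₂ _ _
    · exact ih₁ _ _
  | goto f => rfl
  | halt => rfl

variable [Inhabited A] (out : tm.Γ tm.k₁ ≃ A)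

theorem stepsTo_after {n : ℕ} {c c' : tm.Cfg} (h : StepsTo tm.step n c c') (o : Option A)
    (s : R → List A) :
    StepsTo (TM2.step (afterCode tm P X out)) n
      ⟨some (afterNext tm P c.l), (c.var, o), joinStacks c.stk s⟩
      ⟨some (afterNext tm P c'.l), (c'.var, o), joinStacks c'.stk s⟩ := by
  induction n generalizing c with
  | zero =>
    have : c = c' := Option.some.inj h
    subst this
    exact StepsTo.refl _ _
  | succ n ih =>
    obtain ⟨b, hb, h⟩ := h.head
    obtain ⟨l, v, S⟩ := c
    cases l with
    | none => exact absurd hb (by simp)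
    | some l =>
      have hb' : TM2.stepAux (tm.m l) v S = b := Option.some.inj hb
      rw [Nat.add_comm]
      refine StepsTo.trans (StepsTo.single ?_) (ih h)
      subst hb'
      rw [← stepAux_afterStmt]
      rfl

theorem stepsTo_transfer (w : List (tm.Γ tm.k₁)) (S : ∀ k, List (tm.Γ k)) (v : tm.σ)
    (o : Option A) (s : R → List A) (hS : S tm.k₁ = w) :
    ∃ o', StepsTo (TM2.step (afterCode tm P X out)) (w.length + 1)
      ⟨some (Sum.inr (Sum.inr true)), (v, o), joinStacks S s⟩
      ⟨some (Sum.inr (Sum.inl (entry P))), (v, o'),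
        joinStacks (Function.update S tm.k₁ [])
          (Function.update s X ((w.map out).reverse ++ s X))⟩ := by
  induction w generalizing S o s with
  | nil =>
    refine ⟨none, StepsTo.single ?_⟩
    have h₁ := update_joinStacks_inl S s tm.k₁ (S tm.k₁).tail
    rw [TM2.step]
    refine (congrArg (fun st => some (TM2.stepAux _ (v, Option.map out (S tm.k₁).head?) st))
      h₁).trans ?_
    rw [hS]
    simp
  | cons a w ih =>
    obtain ⟨o', ho'⟩ := ih (Function.update S tm.k₁ w) (some (out a))
      (Function.update s X (out a :: s X)) (by simp)
    refine ⟨o', ?_⟩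
    rw [List.length_cons, Nat.add_comm]
    refine StepsTo.trans (StepsTo.single (b := ⟨some (Sum.inr (Sum.inr true)),
      (v, some (out a)), joinStacks (Function.update S tm.k₁ w)
        (Function.update s X (out a :: s X))⟩) ?_) ?_
    · have h₁ := update_joinStacks_inl S s tm.k₁ (S tm.k₁).tail
      rw [TM2.step]
      refine (congrArg (fun st => some (TM2.stepAux _ (v, Option.map out (S tm.k₁).head?) st))
        h₁).trans ?_
      rw [hS, ← update_joinStacks_inr]
      rfl
    · simpa using ho'

/-- The combined machine. -/
noncomputable def after [Fintype R] [Fintype A] : FinTM2 :=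
  haveI := tm.kFin
  haveI := tm.ΛFin
  haveI := tm.σFin
  haveI := finite_lab P
  haveI := tm.Γk₀Fin
  { K := tm.K ⊕ R
    k₀ := Sum.inl tm.k₀
    k₁ := Sum.inr Y
    Γ := alphabets tm.Γ R A
    Λ := AfterLab tm P
    main := Sum.inl tm.main
    ΛFin := Fintype.ofFinite _
    σ := tm.σ × Option A
    initialState := (tm.initialState, none)
    Γk₀Fin := inferInstanceAs (Fintype (tm.Γ tm.k₀))
    m := afterCode tm P X out }

theorem initList_after_eq [Fintype R] [Fintype A] (w : List (tm.Γ tm.k₀)) :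
    initList (after tm P X Y out) w =
      ⟨some (Sum.inl tm.main), (tm.initialState, none),
        joinStacks (initList tm w).stk (fun _ => [])⟩ := by
  unfold initList
  congr 1
  funext k
  rcases k with k | k
  · by_cases h : k = tm.k₀
    · subst h
      simp [after, joinStacks]
      rfl
    · simp [after, joinStacks, h]
  · simp [after, joinStacks]

theorem haltList_after_eq [Fintype R] [Fintype A] (w : List A) :
    haltList (after tm P X Y out) w =
      ⟨none, (tm.initialState, none),
        joinStacks (fun _ => []) (Function.update (fun _ => []) Y w)⟩ := by
  unfold haltList
  congr 1
  funext k
  rcases k with k | k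
  · simp [after, joinStacks]
  · by_cases h : k = Y
    · subst h
      simp [after, joinStacks]
      rfl
    · simp [after, joinStacks, h]

end after

theorem polynomial_eval_mono (p : Polynomial ℕ) {m n : ℕ} (h : m ≤ n) : p.eval m ≤ p.eval n := by
  rw [Polynomial.eval_eq_sum, Polynomial.eval_eq_sum]
  exact Finset.sum_le_sum fun i _ => Nat.mul_le_mul_left _ (Nat.pow_le_pow_left h i)

/-- If `f` is computable in polynomial time and a program computes `h x` from `f x` within time
polynomial in the length of `f x`, then `h` is computable in polynomial time. -/
theorem polyTimeComputable_of_exec [DecidableEq R] [Fintype R] [Inhabited A] [Fintype A] {B : Type}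
    {f h : List B → List A} (hf : PolyTimeComputable f) (P : StackProg R A) (X Y : R)
    (p : Polynomial ℕ)
    (H : ∀ x, Exec P (Function.update (fun _ => []) X (f x).reverse)
      (Function.update (fun _ => []) Y (h x)) (p.eval (f x).length)) :
    PolyTimeComputable h := by
  obtain ⟨⟨⟨tm, inA, outA⟩, time, outputs⟩⟩ := hf
  change ∀ a : List B, TM2OutputsInTime tm (List.map inA.symm (id a))
    (some (List.map outA.symm (id (f a)))) (time.eval (id a).length) at outputs
  obtain ⟨D, hD⟩ := exists_length_stk_le tm
  -- The input length plus `D` symbols per step bounds the length of `f x`.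
  set len : Polynomial ℕ := Polynomial.X + time * Polynomial.C D with hlen
  refine ⟨⟨⟨after tm P X Y outA, inA, Equiv.refl A⟩,
    time + (len + 1) + p.comp len + 1, fun x => Classical.choice ?_⟩⟩
  obtain ⟨⟨n, hn⟩, hle⟩ := outputs x
  simp only [id] at hn hle
  set w := List.map outA.symm (f x) with hw
  have h₁ : StepsTo tm.step n (initList tm (List.map inA.symm x)) (haltList tm w) := hn
  have hstk : (haltList tm w).stk tm.k₁ = w := by
    simp [haltList]
  have hlength : (f x).length ≤ len.eval x.length := by
    have := hD n _ _ tm.k₁ h₁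
    rw [hstk, hw, List.length_map] at this
    refine this.trans ?_
    rw [hlen, Polynomial.eval_add, Polynomial.eval_mul, Polynomial.eval_X, Polynomial.eval_C]
    refine Nat.add_le_add ?_ (Nat.mul_le_mul_right _ hle)
    -- The output stack starts empty unless it is also the input stack.
    by_cases hk : tm.k₁ = tm.k₀
    · have : ∀ k, ((initList tm (List.map inA.symm x)).stk k).length ≤ x.length := by
        intro k
        by_cases hk : k = tm.k₀
        · subst hk; simp [initList]
        · simp [initList, hk]
      exact this _
    · simp [initList, hk]
  have h₂ := stepsTo_after tm P X outA h₁ none (fun _ => [])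
  obtain ⟨o₁, h₃⟩ := stepsTo_transfer tm P X outA w (haltList tm w).stk tm.initialState none
    (fun _ => []) hstk
  have hempty : Function.update (haltList tm w).stk tm.k₁ [] = fun _ => [] := by
    funext k
    by_cases hk : k = tm.k₁
    · subst hk; simp
    · simp [haltList, hk]
  have hmap : (w.map outA).reverse ++ [] = (f x).reverse := by
    simp [hw, Function.comp_def]
  rw [hempty, hmap] at h₃
  obtain ⟨t, ht, hrun⟩ := H x
  obtain ⟨o₂, h₄⟩ := stepsTo_of_run hrun (afterCode tm P X outA) (fun l => Sum.inr (Sum.inl l))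
    (Sum.inr (Sum.inr false)) (fun _ => rfl) (fun _ => []) tm.initialState o₁
  have h₅ : StepsTo (TM2.step (afterCode tm P X outA)) 1
      ⟨some (Sum.inr (Sum.inr false)), (tm.initialState, o₂),
        joinStacks (fun _ => []) (Function.update (fun _ => []) Y (h x))⟩
      ⟨none, (tm.initialState, none),
        joinStacks (fun _ => []) (Function.update (fun _ => []) Y (h x))⟩ :=
    StepsTo.single rfl
  have h₆ := (((h₂.trans h₃).trans h₄).trans h₅)
  refine ⟨⟨⟨n + (w.length + 1) + t + 1, ?_⟩, ?_⟩⟩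
  · have e₁ := initList_after_eq tm P X Y outA (List.map inA.symm x)
    have e₂ := haltList_after_eq tm P X Y outA (h x)
    have e₃ : (List.map (Equiv.refl A).invFun (id (h x))) = h x := by simp
    refine (congrArg (fun c => (flip bind (TM2.step (afterCode tm P X outA)))^[
      n + (w.length + 1) + t + 1] (some c)) e₁).trans 
      (Eq.trans h₆ ((congrArg some e₂.symm).trans ?_))
    exact congrArg (fun l => some (haltList (after tm P X Y outA) l)) e₃.symm
  · have hw' : w.length = (f x).length := by simp [hw]
    have hp := polynomial_eval_mono p hlength
    simp only [Polynomial.eval_add, Polynomial.eval_one, Polynomial.eval_comp, id]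
    omega

end StackProg

/-! ### Rules for the execution of programs -/

namespace StackProg

section rules

variable {R A : Type} [DecidableEq R]

theorem Exec.congr {P : StackProg R A} {s s₁ s₂ : R → List A} {T₁ T₂ : ℕ} (h : Exec P s s₁ T₁)
    (hs : s₁ = s₂) (hT : T₁ ≤ T₂) : Exec P s s₂ T₂ := by
  obtain ⟨t, ht, hr⟩ := h
  exact ⟨t, ht.trans hT, hs ▸ hr⟩

theorem Exec.mono {P : StackProg R A} {s s₁ : R → List A} {T₁ T₂ : ℕ} (h : Exec P s s₁ T₁)
    (hT : T₁ ≤ T₂) : Exec P s s₁ T₂ :=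
  h.congr rfl hT

theorem Exec.start {P : StackProg R A} {s₀ s s₁ : R → List A} {T : ℕ} (h : Exec P s s₁ T)
    (hs : s₀ = s) : Exec P s₀ s₁ T :=
  hs ▸ h

theorem Exec.seq {P Q : StackProg R A} {s s₁ s₂ : R → List A} {T₁ T₂ : ℕ} (h₁ : Exec P s s₁ T₁)
    (h₂ : Exec Q s₁ s₂ T₂) : Exec (seq P Q) s s₂ (T₁ + T₂) := by
  obtain ⟨t₁, ht₁, hr₁⟩ := h₁
  obtain ⟨t₂, ht₂, hr₂⟩ := h₂
  exact ⟨t₁ + t₂, Nat.add_le_add ht₁ ht₂, hr₁.seq hr₂⟩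

theorem Exec.skip (s : R → List A) : Exec skip s s 1 :=
  ⟨1, le_rfl, Run.skip s⟩

theorem Exec.push (Y X : R) (g : Option A → A) (s : R → List A) :
    Exec (push Y X g) s (Function.update s Y (g (s X).head? :: s Y)) 1 :=
  ⟨1, le_rfl, Run.push Y X g s⟩

theorem Exec.pop (X : R) (s : R → List A) :
    Exec (pop X) s (Function.update s X (s X).tail) 1 :=
  ⟨1, le_rfl, Run.pop X s⟩

theorem Exec.case {X : R} {f : Option A → StackProg R A} {s s' : R → List A} {T : ℕ}
    (h : Exec (f (s X).head?) s s' T) : Exec (case X f) s s' (1 + T) := by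
  obtain ⟨t, ht, hr⟩ := h
  exact ⟨1 + t, Nat.add_le_add_left ht 1, hr.case⟩

theorem Exec.loop_done {X : R} {p : Option A → Bool} {P : StackProg R A} {s : R → List A}
    (h : p (s X).head? = false) : Exec (loop X p P) s s 1 :=
  ⟨1, le_rfl, Run.loop_done h⟩

theorem Exec.loop_step {X : R} {p : Option A → Bool} {P : StackProg R A} {s s₁ s₂ : R → List A}
    {T₁ T₂ : ℕ} (h : p (s X).head? = true) (h₁ : Exec P s s₁ T₁)
    (h₂ : Exec (loop X p P) s₁ s₂ T₂) : Exec (loop X p P) s s₂ (1 + (T₁ + T₂)) := by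
  obtain ⟨t₁, ht₁, hr₁⟩ := h₁
  obtain ⟨t₂, ht₂, hr₂⟩ := h₂
  exact ⟨1 + (t₁ + t₂), by omega, hr₁.loop_step h hr₂⟩

/-- Moves the top symbol of `X` to `Y`. -/
def moveTop [Inhabited A] (X Y : R) : StackProg R A :=
  seq (push Y X fun o => o.getD default) (pop X)

theorem Exec.moveTop [Inhabited A] {X Y : R} (hXY : X ≠ Y) {s : R → List A} {a : A} {l : List A}
    (h : s X = a :: l) :
    Exec (moveTop X Y) s (Function.update (Function.update s Y (a :: s Y)) X l) 2 :=
  ((Exec.push Y X _ s).seq (Exec.pop X _)).congr (by simp [h, hXY]) le_rfl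

/-- Moves the longest prefix of `X` whose symbols satisfy `p` to `Y`. -/
def moveWhile [Inhabited A] (p : A → Bool) (X Y : R) : StackProg R A :=
  loop X (fun o => o.any p) (StackProg.moveTop X Y)

theorem Exec.moveWhile [Inhabited A] {p : A → Bool} {X Y : R} (hXY : X ≠ Y) {s : R → List A}
    {w l : List A} (h : s X = w ++ l) (hw : ∀ a ∈ w, p a = true) (hl : l.head?.any p = false) :
    Exec (moveWhile p X Y) s (Function.update (Function.update s Y (w.reverse ++ s Y)) X l)
      (3 * w.length + 1) := by
  induction w generalizing s with
  | nil =>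
    refine (Exec.loop_done (by simpa [h] using hl)).congr ?_ (by simp)
    rw [List.nil_append] at h
    simp [← h]
  | cons a w ih =>
    refine (Exec.loop_step (by simpa [h] using hw a (by simp)) (Exec.moveTop hXY h)
      (ih (by simp) fun b hb => hw b (by simp [hb]))).congr ?_ ?_
    · funext r
      by_cases hX : r = X <;> by_cases hY : r = Y <;> simp_all [hXY.symm]
    · simp only [List.length_cons]; omega

/-- Moves the content of `X` to `Y`, in reverse order. -/
def moveAll [Inhabited A] (X Y : R) : StackProg R A :=
  moveWhile (fun _ => true) X Y

theorem Exec.moveAll [Inhabited A] {X Y : R} (hXY : X ≠ Y) {s : R → List A} {w : List A}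
    (h : s X = w) :
    Exec (moveAll X Y) s (Function.update (Function.update s Y (w.reverse ++ s Y)) X [])
      (3 * w.length + 1) :=
  Exec.moveWhile hXY (by simpa using h) (by simp) (by simp)

/-- Empties `X`. -/
def clear (X : R) : StackProg R A :=
  loop X Option.isSome (StackProg.pop X)

theorem Exec.clear {X : R} {s : R → List A} {w : List A} (h : s X = w) :
    Exec (clear X) s (Function.update s X []) (2 * w.length + 1) := by
  induction w generalizing s with
  | nil => exact (Exec.loop_done (by simp [h])).congr (by simp [← h]) (by simp)
  | cons a w ih =>
    refine (Exec.loop_step (by simp [h]) (Exec.pop X s) (ih (by simp [h]))).congr (by simp) ?_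
    simp only [List.length_cons]; omega

/-- Empties the registers of a list. -/
def clearList : List R → StackProg R A
  | [] => skip
  | X :: l => seq (clear X) (clearList l)

theorem Exec.clearList {l : List R} {s : R → List A} {B : ℕ} (h : ∀ X ∈ l, (s X).length ≤ B) :
    Exec (clearList l) s (fun r => if r ∈ l then [] else s r) (l.length * (2 * B + 1) + 1) := by
  induction l generalizing s with
  | nil => exact (Exec.skip s).congr (by simp) (by simp)
  | cons X l ih =>
    refine ((Exec.clear rfl).seq (ih fun Y hY => ?_)).congr ?_ ?_
    · by_cases hX : Y = X
      · subst hX; simp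
      · simpa [hX] using h Y (by simp [hY])
    · funext r
      by_cases hX : r = X
      · subst hX; simp
      · simp [hX]
    · have := h X (by simp)
      rw [List.length_cons, Nat.add_mul]
      omega

/-- Pushes the symbols of a list onto `Y`, one after the other. -/
def pushList (Y : R) : List A → StackProg R A
  | [] => skip
  | a :: l => seq (push Y Y fun _ => a) (pushList Y l)

theorem Exec.pushList {Y : R} (l : List A) (s : R → List A) :
    Exec (pushList Y l) s (Function.update s Y (l.reverse ++ s Y)) (l.length + 1) := by
  induction l generalizing s with
  | nil => exact (Exec.skip s).congr (by simp) (by simp)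
  | cons a l ih =>
    refine ((Exec.push Y Y _ s).seq (ih _)).congr (by simp) ?_
    simp only [List.length_cons]; omega

/-- Reads the content of `X`, moving it to `Y`. If it has fewer than `n` symbols, continues with
the program that is given for it; otherwise restores `X` and continues with `P`. -/
def readShort [Inhabited A] (X Y : R) (table : List A → StackProg R A) (P : StackProg R A) :
    ℕ → List A → StackProg R A
  | 0, _ => seq (moveAll Y X) P
  | n + 1, w => case X fun o => o.elim (table w) fun a =>
      seq (StackProg.moveTop X Y) (readShort X Y table P n (w ++ [a]))

/-- The symbols read are remembered in the control, through the argument `w`; this is a finite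
program because the reading is unrolled `n` times. The answer may therefore depend on the whole
content. -/
theorem Exec.readShort_of_lt [Inhabited A] {X Y : R} (hXY : X ≠ Y) {table : List A → StackProg R A}
    {P : StackProg R A} {n T : ℕ} {w l : List A} {s s' : R → List A} (hX : s X = l)
    (hl : l.length < n)
    (h : Exec (table (w ++ l))
      (Function.update (Function.update s Y (l.reverse ++ s Y)) X []) s' T) :
    Exec (readShort X Y table P n w) s s' (3 * n + T) := by
  induction l generalizing n w s with
  | nil =>
    obtain ⟨m, rfl⟩ := Nat.exists_eq_succ_of_ne_zero (Nat.ne_of_gt hl)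
    refine (Exec.case (s' := s') (T := T) ?_).mono (by omega)
    rw [hX]
    refine Exec.start (by simpa using h) ?_
    funext r
    by_cases hr : r = X
    · subst hr; simp [hX]
    · by_cases hr' : r = Y
      · subst hr'; simp [hr]
      · simp [hr]
  | cons a l ih =>
    obtain ⟨m, rfl⟩ := Nat.exists_eq_succ_of_ne_zero (Nat.ne_of_gt (Nat.zero_lt_of_lt hl))
    refine (Exec.case (s' := s') (T := 2 + (3 * m + T)) ?_).mono (by omega)
    rw [hX]
    refine (Exec.moveTop hXY hX).seq (ih (by simp) (by simpa using hl) ?_)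
    rw [List.append_assoc]
    refine h.start ?_
    funext r
    by_cases hr : r = X
    · subst hr; simp
    · by_cases hr' : r = Y
      · subst hr'; simp [hr]
      · simp [hr, hr']

/-- After `n` symbols the reading stops, and everything in `Y`, including what was there before, is
returned to `X`. -/
theorem Exec.readShort_of_le [Inhabited A] {X Y : R} (hXY : X ≠ Y) {table : List A → StackProg R A}
    {P : StackProg R A} {n T : ℕ} {w l l' : List A} {s s' : R → List A} (hX : s X = l)
    (hY : s Y = l') (hl : n ≤ l.length)
    (h : Exec P (Function.update (Function.update s Y []) X (l'.reverse ++ l)) s' T) :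
    Exec (readShort X Y table P n w) s s' (6 * n + 3 * l'.length + 1 + T) := by
  induction n generalizing l l' w s with
  | zero =>
    refine ((Exec.moveAll hXY.symm hY).seq (T₂ := T) ?_).mono (by omega)
    rwa [hX, Function.update_comm hXY]
  | succ n ih =>
    obtain - | ⟨a, l⟩ := l
    · simp at hl
    refine (Exec.case (s' := s') (T := 2 + (6 * n + 3 * (l'.length + 1) + 1 + T)) ?_).mono
      (by omega)
    rw [hX]
    refine (Exec.moveTop hXY hX).seq (ih (l := l) (l' := a :: l') (by simp)
      (by simp [hXY.symm, hY]) (by simpa using hl) ?_)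
    refine h.start ?_
    funext r
    by_cases hr : r = X
    · subst hr; simp
    · by_cases hr' : r = Y
      · subst hr'; simp [hr]
      · simp [hr, hr']

end rules

end StackProg

/-! ### The code words and the output of the reduction, as functions on lists -/

namespace KMeansReduction

open Computability StackProg

/-- Each word of the list, preceded by a comma. -/
def encodeWords (l : List (List Bool)) : List Γ' :=
  l.flatMap fun v => Γ'.comma :: v.map Γ'.bit

/-- The bitwise disjunction of two words, the second of which is padded with zeros. -/
def orWord : List Bool → List Bool → List Bool
  | [], u => u
  | a :: w, u => (a || u.headD false) :: orWord w u.tail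

/-- The number of positions at which both words have a one. -/
def meet : List Bool → List Bool → ℕ
  | a :: v, b :: w => (a && b).toNat + meet v w
  | _, _ => 0

/-- The concatenations of `n` blocks. -/
def wordsOf (blocks : List (List Bool)) : ℕ → List (List Bool)
  | 0 => [[]]
  | n + 1 => blocks.flatMap fun c => (wordsOf blocks n).map (c ++ ·)

/-- Adds a word to a code unless it meets one of its words too often. -/
def addWord (b n : ℕ) (G : List (List Bool)) (w : List Bool) : List (List Bool) :=
  if G.any (fun g => decide (n ≤ b * meet g w)) then G else w :: G

/-- The greedy code. -/
def greedyCode (b : ℕ) (blocks : List (List Bool)) (n : ℕ) : List (List Bool) :=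
  (wordsOf blocks n).foldl (addWord b n) []

/-- Distributes the words of a code to the elements that are in use. -/
def assignWords : List Bool → List (List Bool) → List (List Bool)
  | [], _ => []
  | true :: u, G => G.headD [] :: assignWords u G.tail
  | false :: u, G => [] :: assignWords u G

/-- The bitwise disjunction of `u` and of the words of `C` selected by `v`. -/
def selectOr : List Bool → List (List Bool) → List Bool → List Bool
  | b :: v, c :: C, u => selectOr v C (if b then orWord c u else u)
  | _, _, u => u

/-- The elements that are contained in some member of the list. -/
def usedBits (rows : List (List Bool)) : List Bool :=
  rows.foldl (fun u v => orWord v u) []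

/-- The words assigned to the elements. -/
def wordList (b : ℕ) (blocks rows : List (List Bool)) : List (List Bool) :=
  assignWords (usedBits rows) (greedyCode b blocks (Nat.size rows.length))

/-- The points produced by the reduction. -/
def outRows (b : ℕ) (blocks rows : List (List Bool)) : List (List Bool) :=
  rows.map fun v => selectOr v (wordList b blocks rows) []

/-! ### The program -/

/-- The registers of the program. -/
inductive Reg
  | inp | aux | used | tmp | cnt | len | len' | words | words' | code | code' | cur | cur' | bad
  | out | fin
  deriving DecidableEq

instance : Fintype Reg where
  elems := {Reg.inp, Reg.aux, Reg.used, Reg.tmp, Reg.cnt, Reg.len, Reg.len', Reg.words,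
    Reg.words', Reg.code, Reg.code', Reg.cur, Reg.cur', Reg.bad, Reg.out, Reg.fin}
  complete r := by cases r <;> decide

/-- Whether a symbol is a bit. -/
def isBit : Γ' → Bool
  | Γ'.bit _ => true
  | _ => false

/-- The programs over these registers. -/
abbrev RegProg : Type := StackProg Reg Γ'

local infixr:60 ";;" => StackProg.seq

open StackProg (moveTop moveWhile moveAll clear clearList pushList)

/-- Moves the word on top of `X` to `Y`, and replaces the word in `U` by its disjunction with it. -/
def orWordProg (X Y U : Reg) : RegProg :=
  loop X (fun o => o.any isBit)
    ((case X fun o => match o with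
        | some (Γ'.bit true) => push Reg.tmp U fun _ => Γ'.bit true
        | _ => push Reg.tmp U fun o => o.getD (Γ'.bit false)) ;;
      pop U ;; moveTop X Y) ;;
  moveAll Reg.tmp U

/-- The bits computed so far wait reversed in `tmp`. Moving them back on top of what is left of `U`
keeps the tail of a longer word, as `orWord [] u = u` demands. -/
theorem exec_orWordProg {X Y U : Reg} (hXY : X ≠ Y) (hXU : X ≠ U) (hYU : Y ≠ U)
    (hX : X ≠ Reg.tmp) (hY : Y ≠ Reg.tmp) (hU : U ≠ Reg.tmp) {s : Reg → List Γ'}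
    {w u : List Bool} {r : List Γ'} (h₁ : s X = w.map Γ'.bit ++ r) (h₂ : s U = u.map Γ'.bit)
    (h₃ : s Reg.tmp = []) (hr : r.head?.any isBit = false) :
    Exec (orWordProg X Y U) s
      (Function.update (Function.update (Function.update s Y ((w.map Γ'.bit).reverse ++ s Y))
        U ((orWord w u).map Γ'.bit)) X r) (9 * w.length + 2) := by
  -- The word `t` is the part of the disjunction already written to `tmp`.
  suffices H : ∀ (w u : List Bool) (s : Reg → List Γ') (t : List Bool),
      s X = w.map Γ'.bit ++ r → s U = u.map Γ'.bit → s Reg.tmp = (t.map Γ'.bit).reverse →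
      Exec (orWordProg X Y U) s
        (Function.update (Function.update (Function.update (Function.update s
          Y ((w.map Γ'.bit).reverse ++ s Y)) U ((t ++ orWord w u).map Γ'.bit)) X r) Reg.tmp [])
        (9 * w.length + 3 * t.length + 2) by
    refine (H w u s [] h₁ h₂ (by simpa using h₃)).congr ?_ (by simp)
    funext k
    by_cases hk : k = Reg.tmp
    · subst hk; simp [hX.symm, hY.symm, hU.symm, h₃]
    · simp [hk]
  clear h₁ h₂ h₃ w u s
  intro w
  induction w with
  | nil =>
    intro u s t h₁ h₂ h₃
    refine ((Exec.loop_done (by simpa [h₁] using hr)).seq (Exec.moveAll hU.symm h₃)).congr ?_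
      (by simp; omega)
    have : s X = r := by simpa using h₁
    funext k
    by_cases hk : k = Reg.tmp
    · subst hk; simp
    · by_cases hk' : k = U
      · subst hk'; simp [hk, hXU.symm, h₂, orWord]
      · by_cases hk'' : k = X
        · subst hk''; simp [hk, hk', this]
        · by_cases hk''' : k = Y
          · subst hk'''; simp [hk, hk', hk'']
          · simp [hk, hk', hk'']
  | cons a w ih =>
    intro u s t h₁ h₂ h₃
    have e₁ : Exec (case X fun o => match o with
        | some (Γ'.bit true) => push Reg.tmp U fun _ => Γ'.bit true
        | _ => push Reg.tmp U fun o => o.getD (Γ'.bit false)) s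
        (Function.update s Reg.tmp (Γ'.bit (a || u.headD false) :: s Reg.tmp)) 2 := by
      refine Exec.case (T := 1) ?_
      rw [h₁]
      cases a
      · refine (Exec.push _ _ _ _).congr ?_ le_rfl
        cases u <;> simp [h₂]
      · exact (Exec.push _ _ _ _).congr (by simp) le_rfl
    have e₂ := Exec.pop U (Function.update s Reg.tmp (Γ'.bit (a || u.headD false) :: s Reg.tmp))
    have e₃ := Exec.moveTop hXY (s := Function.update (Function.update s Reg.tmp
      (Γ'.bit (a || u.headD false) :: s Reg.tmp)) U (u.tail.map Γ'.bit)) (a := Γ'.bit a)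
      (l := w.map Γ'.bit ++ r) (by simp [hXU, hX, h₁])
    have e₂' := e₂.congr (s₂ := Function.update (Function.update s Reg.tmp
      (Γ'.bit (a || u.headD false) :: s Reg.tmp)) U (u.tail.map Γ'.bit))
      (by simp [hU, h₂, List.map_tail]) le_rfl
    have e₄ := e₁.seq (e₂'.seq e₃)
    obtain ⟨t₁, ht₁, hrun⟩ := ih u.tail (Function.update (Function.update (Function.update
      (Function.update s Reg.tmp
      (Γ'.bit (a || u.headD false) :: s Reg.tmp)) U (u.tail.map Γ'.bit)) Y
      (Γ'.bit a :: s Y)) X (w.map Γ'.bit ++ r)) (t ++ [a || u.headD false])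
      (by simp) (by simp [hXU.symm, hYU.symm]) (by simp [hX.symm, hY.symm, hU.symm, h₃])
    -- The induction hypothesis covers the loop and the final transfer together; its run is split so
    -- that one more iteration can be put in front of the loop.
    cases hrun with
    | @seq _ _ _ s₁ _ m n hr₁ hr₂ =>
    have e₅ : Exec (loop X (fun o => o.any isBit) _) _ _ m := ⟨m, le_rfl, hr₁⟩
    have e₆ : Exec (moveAll Reg.tmp U) _ _ n := ⟨n, le_rfl, hr₂⟩
    refine ((Exec.loop_step (by simp [h₁, isBit]) (e₄.congr ?_ le_rfl) e₅).seq e₆).congr ?_ ?_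
    · simp [hYU, hY]
    · funext k
      by_cases hk : k = Reg.tmp
      · subst hk; simp
      · by_cases hk' : k = X
        · subst hk'; simp [hk]
        · by_cases hk'' : k = U
          · subst hk''; simp [hk, hk', orWord]
          · by_cases hk''' : k = Y
            · subst hk'''; simp [hk, hk', hk'']
            · simp [hk, hk', hk'', hk''']
    · simp only [List.length_append, List.length_cons, List.length_nil] at ht₁ ⊢
      omega

theorem encodeWords_cons (v : List Bool) (l : List (List Bool)) :
    encodeWords (v :: l) = Γ'.comma :: (v.map Γ'.bit ++ encodeWords l) := by
  simp [encodeWords]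

@[simp] theorem encodeWords_nil : encodeWords [] = [] := rfl

@[simp] theorem encodeWords_append (l l' : List (List Bool)) :
    encodeWords (l ++ l') = encodeWords l ++ encodeWords l' := by
  simp [encodeWords]

theorem head_encodeWords (l : List (List Bool)) : (encodeWords l).head?.any isBit = false := by
  cases l <;> simp [encodeWords_cons, isBit]

theorem isBit_of_mem {w : List Bool} : ∀ a ∈ w.map Γ'.bit, isBit a = true := by
  intro a ha
  obtain ⟨b, -, rfl⟩ := List.mem_map.1 ha
  rfl

/-! ### Reading the input: the used elements and the number of rows. -/

/-- Computes the disjunction of the rows and counts them. -/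
def readRows : RegProg :=
  loop Reg.inp Option.isSome
    (moveTop Reg.inp Reg.aux;; orWordProg Reg.inp Reg.aux Reg.used;;
      push Reg.cnt Reg.cnt fun _ => Γ'.bit true);;
  moveAll Reg.aux Reg.inp

theorem exec_readRows {s : Reg → List Γ'} {rows : List (List Bool)}
    (h₁ : s Reg.inp = encodeWords rows) (h₂ : s Reg.aux = []) (h₃ : s Reg.used = [])
    (h₄ : s Reg.tmp = []) (h₅ : s Reg.cnt = []) :
    Exec readRows s (Function.update (Function.update s Reg.used ((usedBits rows).map Γ'.bit))
      Reg.cnt (List.replicate rows.length (Γ'.bit true)))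
      (15 * (encodeWords rows).length + 2) := by
  have H : ∀ (rows : List (List Bool)) (u : List Bool) (s : Reg → List Γ'),
      s Reg.inp = encodeWords rows → s Reg.used = u.map Γ'.bit → s Reg.tmp = [] →
      Exec (loop Reg.inp Option.isSome
        (moveTop Reg.inp Reg.aux;; orWordProg Reg.inp Reg.aux Reg.used;;
          push Reg.cnt Reg.cnt fun _ => Γ'.bit true)) s
        (Function.update (Function.update (Function.update (Function.update s Reg.inp [])
          Reg.aux ((encodeWords rows).reverse ++ s Reg.aux))
          Reg.used ((rows.foldl (fun u v => orWord v u) u).map Γ'.bit))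
          Reg.cnt (List.replicate rows.length (Γ'.bit true) ++ s Reg.cnt))
        (12 * (encodeWords rows).length + 1) := by
    intro rows
    induction rows with
    | nil =>
      intro u s h₁ h₂ h₃
      refine (Exec.loop_done (by simp [h₁])).congr ?_ (by simp)
      funext k
      cases k <;> simp [h₁, h₂]
    | cons v rows ih =>
      intro u s h₁ h₂ h₃
      rw [encodeWords_cons] at h₁
      have e₁ := Exec.moveTop (X := Reg.inp) (Y := Reg.aux) (by decide) h₁
      have e₂ := exec_orWordProg (X := Reg.inp) (Y := Reg.aux) (U := Reg.used)
        (by decide) (by decide) (by decide) (by decide) (by decide) (by decide)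
        (s := Function.update (Function.update s Reg.aux (Γ'.comma :: s Reg.aux))
          Reg.inp (v.map Γ'.bit ++ encodeWords rows)) (w := v) (u := u)
        (r := encodeWords rows) (by simp) (by simp [h₂]) (by simp [h₃]) (head_encodeWords rows)
      refine (Exec.loop_step (by simp [h₁]) (e₁.seq (e₂.seq (Exec.push _ _ _ _)))
        (ih (orWord v u) _ (by simp) (by simp) (by simp [h₃]))).congr ?_ ?_
      · funext k
        cases k <;> simp [encodeWords_cons, List.replicate_succ']
      · simp only [encodeWords_cons, List.length_cons, List.length_append, List.length_map]
        omega
  refine ((H rows [] s h₁ (by simpa using h₃) h₄).seq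
    (Exec.moveAll (X := Reg.aux) (Y := Reg.inp) (by decide) rfl)).congr ?_ ?_
  · funext k
    cases k <;> simp [h₁, h₂, h₅, usedBits]
  · simp [h₂]
    omega

/-- Halves the number of symbols in the register `cnt`. -/
def halve : RegProg :=
  loop Reg.cnt Option.isSome
    -- Of two marks one is discarded and one kept; an unpaired last mark is discarded, which rounds
    -- down.
    (pop Reg.cnt;; case Reg.cnt fun o => o.elim skip fun _ => moveTop Reg.cnt Reg.tmp);;
  moveAll Reg.tmp Reg.cnt

theorem exec_halve {s : Reg → List Γ'} {n : ℕ}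
    (h₁ : s Reg.cnt = List.replicate n (Γ'.bit true)) (h₂ : s Reg.tmp = []) :
    Exec halve s (Function.update s Reg.cnt (List.replicate (n / 2) (Γ'.bit true)))
      (8 * n + 2) := by
  have H : ∀ (n : ℕ) (s : Reg → List Γ'), s Reg.cnt = List.replicate n (Γ'.bit true) →
      Exec (loop Reg.cnt Option.isSome
        (pop Reg.cnt;; case Reg.cnt fun o => o.elim skip fun _ => moveTop Reg.cnt Reg.tmp)) s
        (Function.update (Function.update s Reg.cnt [])
          Reg.tmp (List.replicate (n / 2) (Γ'.bit true) ++ s Reg.tmp)) (5 * n + 1) := by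
    intro n
    induction n using Nat.strong_induction_on with
    | _ n ih =>
    intro s h
    match n, h, ih with
    | 0, h, _ =>
      refine (Exec.loop_done (by simp [h])).congr ?_ (by simp)
      funext k
      cases k <;> simp [h]
    | 1, h, ih =>
      have e₂ : Exec (case Reg.cnt fun o => o.elim skip fun _ => moveTop Reg.cnt Reg.tmp)
          (Function.update s Reg.cnt (s Reg.cnt).tail)
          (Function.update s Reg.cnt (s Reg.cnt).tail) (1 + 1) := by
        refine Exec.case ?_
        simp only [h, Function.update_self, List.replicate_succ, List.replicate_zero,
          List.tail_cons, List.head?_nil]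
        exact Exec.skip _
      refine (Exec.loop_step (by simp [h]) ((Exec.pop _ _).seq e₂)
        (ih 0 (by omega) _ (by simp [h]))).congr ?_ (by simp)
      funext k
      cases k <;> simp
    | n + 2, h, ih =>
      have e₂ : Exec (case Reg.cnt fun o => o.elim skip fun _ => moveTop Reg.cnt Reg.tmp)
          (Function.update s Reg.cnt (s Reg.cnt).tail)
          (Function.update (Function.update s Reg.tmp (Γ'.bit true :: s Reg.tmp))
            Reg.cnt (List.replicate n (Γ'.bit true))) (1 + 2) := by
        refine Exec.case ?_
        simp only [h, Function.update_self, List.replicate_succ,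
          List.tail_cons, List.head?_cons]
        refine (Exec.moveTop (by decide) (a := Γ'.bit true)
          (l := List.replicate n (Γ'.bit true)) (by simp)).congr ?_ le_rfl
        funext k
        cases k <;> simp
      refine (Exec.loop_step (by simp [h, List.replicate_succ]) ((Exec.pop _ _).seq e₂)
        (ih n (by omega) _ (by simp))).congr ?_ (by omega)
      have hn : (n + 2) / 2 = n / 2 + 1 := by omega
      funext k
      cases k <;> simp [hn, List.replicate_succ']
  refine ((H n s h₁).seq (Exec.moveAll (X := Reg.tmp) (Y := Reg.cnt) (by decide) rfl)).congr ?_ ?_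
  · funext k
    cases k <;> simp [h₂]
  · simp [h₂]
    omega

/-! ### Enumeration of the candidate words. -/

/-- Pushes the words of the register `words`, each preceded by the block `c`, onto the register
`code`, in reverse order. -/
def prependBlock (c : List Bool) : RegProg :=
  loop Reg.words Option.isSome
    ((case Reg.words fun o => match o with
      | some Γ'.comma => pushList Reg.code (Γ'.comma :: c.map Γ'.bit)
      | o => push Reg.code Reg.code fun _ => o.getD default);;
    moveTop Reg.words Reg.words');;
  moveAll Reg.words' Reg.words

/-- The symbols written by `prependBlock`. -/
def expand (c : List Bool) (l : List Γ') : List Γ' :=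
  l.flatMap fun a => match a with
    | Γ'.comma => Γ'.comma :: c.map Γ'.bit
    | a => [a]

/-- Each word starts right after its comma, so inserting the block behind every comma prepends it to
every word. -/
theorem expand_encodeWords (c : List Bool) (W : List (List Bool)) :
    expand c (encodeWords W) = encodeWords (W.map (c ++ ·)) := by
  have h : ∀ v : List Bool, expand c (v.map Γ'.bit) = v.map Γ'.bit := by
    intro v
    induction v with
    | nil => rfl
    | cons a v ih =>
      change Γ'.bit a :: expand c (v.map Γ'.bit) = _
      rw [ih]
      rfl
  induction W with
  | nil => rfl
  | cons v W ih =>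
    have h' : ∀ l l', expand c (l ++ l') = expand c l ++ expand c l' := by simp [expand]
    rw [List.map_cons, encodeWords_cons, encodeWords_cons, ← ih, List.map_append,
      ← List.singleton_append, h', h', h]
    simp [expand]

theorem exec_prependBlock (c : List Bool) {s : Reg → List Γ'} {W : List (List Bool)}
    (h₁ : s Reg.words = encodeWords W) (h₂ : s Reg.words' = []) :
    Exec (prependBlock c) s
      (Function.update s Reg.code ((encodeWords (W.map (c ++ ·))).reverse ++ s Reg.code))
      ((c.length + 9) * (encodeWords W).length + 2) := by
  have H : ∀ (l : List Γ') (s : Reg → List Γ'), s Reg.words = l →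
      Exec (loop Reg.words Option.isSome
        ((case Reg.words fun o => match o with
          | some Γ'.comma => pushList Reg.code (Γ'.comma :: c.map Γ'.bit)
          | o => push Reg.code Reg.code fun _ => o.getD default);;
        moveTop Reg.words Reg.words')) s
        (Function.update (Function.update (Function.update s Reg.words []) Reg.words'
          (l.reverse ++ s Reg.words')) Reg.code ((expand c l).reverse ++ s Reg.code))
        ((c.length + 6) * l.length + 1) := by
    intro l
    induction l with
    | nil =>
      intro s h
      refine (Exec.loop_done (by simp [h])).congr ?_ (by simp)
      funext k
      cases k <;> simp [h, expand]
    | cons a l ih =>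
      intro s h
      have e₁ : Exec (case Reg.words fun o => match o with
          | some Γ'.comma => pushList Reg.code (Γ'.comma :: c.map Γ'.bit)
          | o => push Reg.code Reg.code fun _ => o.getD default) s
          (Function.update s Reg.code ((expand c [a]).reverse ++ s Reg.code))
          (1 + (c.length + 2)) := by
        refine Exec.case ?_
        rw [h]
        cases a with
        | comma => exact (Exec.pushList _ _).congr (by simp [expand]) (by simp)
        | _ => exact (Exec.push _ _ _ _).congr (by simp [expand]) (by omega)
      refine (Exec.loop_step (by simp [h]) (e₁.seq (Exec.moveTop (by decide)
        (a := a) (l := l) (by simp [h]))) (ih _ (by simp))).congr ?_ ?_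
      · funext k
        cases k <;> simp [expand]
      · rw [List.length_cons, Nat.mul_succ]
        omega
  refine ((H _ s h₁).seq (Exec.moveAll (X := Reg.words') (Y := Reg.words)
    (by decide) rfl)).congr ?_ ?_
  · funext k
    cases k <;> simp [h₁, h₂, expand_encodeWords]
  · simp only [h₂, ne_eq, reduceCtorEq, not_false_eq_true, Function.update_of_ne,
      Function.update_self, List.append_nil, List.length_reverse]
    simp only [Nat.add_mul]
    omega

/-- Runs `prependBlock` for each block of a list. -/
def prependBlocks : List (List Bool) → RegProg
  | [] => skip
  | c :: l => prependBlock c;; prependBlocks l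

theorem exec_prependBlocks (l : List (List Bool)) {s : Reg → List Γ'} {W : List (List Bool)}
    {B : ℕ} (hB : ∀ c ∈ l, c.length ≤ B)
    (h₁ : s Reg.words = encodeWords W) (h₂ : s Reg.words' = []) :
    Exec (prependBlocks l) s (Function.update s Reg.code
      ((encodeWords (l.flatMap fun c => W.map (c ++ ·))).reverse ++ s Reg.code))
      (l.length * ((B + 9) * (encodeWords W).length + 2) + 1) := by
  induction l generalizing s with
  | nil => exact (Exec.skip s).congr (by simp) (by simp)
  | cons c l ih =>
    refine ((exec_prependBlock c h₁ h₂).seq (ih (fun c hc => hB c (by simp [hc]))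
      (by simp [h₁]) (by simp [h₂]))).congr ?_ ?_
    · funext k
      cases k <;> simp
    · rw [List.length_cons, Nat.add_mul l.length]
      have : (c.length + 9) * (encodeWords W).length ≤ (B + 9) * (encodeWords W).length :=
        Nat.mul_le_mul_right _ (Nat.add_le_add_right (hB c (by simp)) 9)
      omega

/-- Replaces the words in the register `words` by their concatenations with the blocks. -/
def extendWords (blocks : List (List Bool)) : RegProg :=
  prependBlocks blocks;; clear Reg.words;; moveAll Reg.code Reg.words

theorem exec_extendWords (blocks : List (List Bool)) {s : Reg → List Γ'} {n B L : ℕ}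
    (hB : ∀ c ∈ blocks, c.length ≤ B) (h₁ : s Reg.words = encodeWords (wordsOf blocks n))
    (h₂ : s Reg.words' = []) (h₃ : s Reg.code = [])
    (hL : (encodeWords (wordsOf blocks n)).length ≤ L)
    (hL' : (encodeWords (wordsOf blocks (n + 1))).length ≤ L) :
    Exec (extendWords blocks) s
      (Function.update s Reg.words (encodeWords (wordsOf blocks (n + 1))))
      (blocks.length * ((B + 9) * L + 2) + 5 * L + 3) := by
  refine ((exec_prependBlocks blocks hB h₁ h₂).seq ((Exec.clear rfl).seq
    (Exec.moveAll (X := Reg.code) (Y := Reg.words) (by decide) rfl))).congr ?_ ?_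
  · funext k
    cases k <;> simp [h₃, wordsOf]
  · have h : blocks.length * ((B + 9) * (encodeWords (wordsOf blocks n)).length + 2) ≤
        blocks.length * ((B + 9) * L + 2) :=
      Nat.mul_le_mul_left _ (Nat.add_le_add_right (Nat.mul_le_mul_left _ hL) 2)
    rw [wordsOf] at hL'
    simp only [h₃, h₁, ne_eq, reduceCtorEq, not_false_eq_true, Function.update_of_ne,
      Function.update_self, List.append_nil, List.length_reverse]
    omega

/-- Computes the binary length of the number of rows, in unary, and the candidates for the code. -/
def makeWords (blocks : List (List Bool)) : RegProg :=
  push Reg.words Reg.words (fun _ => Γ'.comma);;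
  loop Reg.cnt Option.isSome
    (push Reg.len Reg.len (fun _ => Γ'.bit true);; halve;; extendWords blocks)

/-- A halving removes one binary digit, so the loop runs `Nat.size m` times. Each round leaves a
mark in `len` and lengthens the candidates by one block, which yields the logarithm in unary without
arithmetic. -/
theorem exec_makeWords (blocks : List (List Bool)) {s : Reg → List Γ'} {m B L : ℕ}
    (hB : ∀ c ∈ blocks, c.length ≤ B) (h₁ : s Reg.cnt = List.replicate m (Γ'.bit true))
    (h₂ : s Reg.len = []) (h₃ : s Reg.tmp = []) (h₄ : s Reg.words = []) (h₅ : s Reg.words' = [])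
    (h₆ : s Reg.code = [])
    (hL : ∀ n ≤ Nat.size m, (encodeWords (wordsOf blocks n)).length ≤ L) :
    Exec (makeWords blocks) s
      (Function.update (Function.update (Function.update s Reg.cnt [])
        Reg.len (List.replicate (Nat.size m) (Γ'.bit true)))
        Reg.words (encodeWords (wordsOf blocks (Nat.size m))))
      (Nat.size m * (blocks.length * ((B + 9) * L + 2) + 5 * L + 8 * m + 7) + 2) := by
  have H : ∀ (m' n : ℕ) (s : Reg → List Γ'), m' ≤ m → n + Nat.size m' = Nat.size m →
      s Reg.cnt = List.replicate m' (Γ'.bit true) → s Reg.tmp = [] →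
      s Reg.words = encodeWords (wordsOf blocks n) → s Reg.words' = [] → s Reg.code = [] →
      Exec (loop Reg.cnt Option.isSome
        (push Reg.len Reg.len (fun _ => Γ'.bit true);; halve;; extendWords blocks)) s
        (Function.update (Function.update (Function.update s Reg.cnt [])
          Reg.len (List.replicate (Nat.size m') (Γ'.bit true) ++ s Reg.len))
          Reg.words (encodeWords (wordsOf blocks (Nat.size m))))
        (Nat.size m' * (blocks.length * ((B + 9) * L + 2) + 5 * L + 8 * m + 7) + 1) := by
    intro m'
    induction m' using Nat.strong_induction_on with
    | _ m' ih =>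
    intro n s hm hn h₁ h₂ h₃ h₄ h₅
    rcases Nat.eq_zero_or_pos m' with rfl | hpos
    · refine (Exec.loop_done (by simp [h₁])).congr ?_ (by simp)
      simp at hn
      funext k
      cases k <;> simp [h₁, h₃, hn]
    · have hsize : Nat.size m' = Nat.size (m' / 2) + 1 := by
        conv_lhs => rw [← Nat.bit_bodd_div2 m']
        rw [Nat.size_bit (by rw [Nat.bit_bodd_div2]; omega), Nat.div2_val]
      have e₁ := exec_halve (s := Function.update s Reg.len (Γ'.bit true :: s Reg.len)) (n := m')
        (by simp [h₁]) (by simp [h₂])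
      have e₂ := exec_extendWords blocks (s := Function.update (Function.update s Reg.len
        (Γ'.bit true :: s Reg.len)) Reg.cnt (List.replicate (m' / 2) (Γ'.bit true))) (n := n) hB
        (by simp [h₃]) (by simp [h₄]) (by simp [h₅]) (hL n (by omega)) (hL (n + 1) (by omega))
      refine (Exec.loop_step (by simp [h₁, Nat.pos_iff_ne_zero.1 hpos])
        ((Exec.push _ _ _ _).seq (e₁.seq e₂)) (ih (m' / 2) (by omega) (n + 1) _ (by omega)
          (by omega) (by simp) (by simp [h₂]) (by simp) (by simp [h₄]) (by simp [h₅]))).congr ?_ ?_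
      · funext k
        cases k <;> simp [hsize, List.replicate_succ']
      · rw [hsize, Nat.add_mul (Nat.size (m' / 2))]
        omega
  refine ((Exec.push _ _ _ _).seq (H m 0 _ le_rfl (by simp) (by simp [h₁]) (by simp [h₃])
    (by simp [h₄, wordsOf, encodeWords]) (by simp [h₅]) (by simp [h₆]))).congr ?_ ?_
  · funext k
    cases k <;> simp [h₂]
  · omega

/-! ### Greedy selection of the code. -/

/-- Moves a symbol from `len` to `len'`, unless there is none. -/
def useMark : RegProg :=
  case Reg.len fun o => o.elim skip fun _ => moveTop Reg.len Reg.len'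

/-- Moves `b` symbols from `len` to `len'`, or all that there are. -/
def useMarks : ℕ → RegProg
  | 0 => skip
  | b + 1 => useMark;; useMarks b

/-- Here `i` is the number of marks requested before; truncated subtraction and `min` keep the
invariant valid once `len` has run empty. -/
theorem exec_useMarks (b : ℕ) {s : Reg → List Γ'} {n i : ℕ}
    (h₁ : s Reg.len = List.replicate (n - i) (Γ'.bit true))
    (h₂ : s Reg.len' = List.replicate (min n i) (Γ'.bit true)) :
    Exec (useMarks b) s
      (Function.update (Function.update s Reg.len (List.replicate (n - (i + b)) (Γ'.bit true)))
        Reg.len' (List.replicate (min n (i + b)) (Γ'.bit true))) (3 * b + 1) := by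
  induction b generalizing s i with
  | zero =>
    refine (Exec.skip s).congr ?_ le_rfl
    funext k
    cases k <;> simp [h₁, h₂]
  | succ b ih =>
    have e₁ : Exec useMark s
        (Function.update (Function.update s Reg.len
          (List.replicate (n - (i + 1)) (Γ'.bit true)))
        Reg.len' (List.replicate (min n (i + 1)) (Γ'.bit true))) (1 + 2) := by
      refine Exec.case ?_
      by_cases h : n ≤ i
      · rw [h₁, Nat.sub_eq_zero_of_le h]
        refine (Exec.skip s).congr ?_ (by omega)
        have h' : n ≤ i + 1 := by omega
        rw [min_eq_left h] at h₂
        rw [Nat.sub_eq_zero_of_le h] at h₁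
        funext k
        cases k <;> simp [h₁, h₂, min_eq_left h', Nat.sub_eq_zero_of_le h']
      · have h' : n - i = (n - (i + 1)) + 1 := by omega
        rw [h', List.replicate_succ] at h₁
        rw [h₁]
        refine (Exec.moveTop (by decide) h₁).congr ?_ le_rfl
        rw [min_eq_right (by omega)] at h₂
        rw [min_eq_right (by omega)]
        funext k
        cases k <;> simp [h₂, List.replicate_succ]
    refine (e₁.seq (ih (i := i + 1) (by simp) (by simp))).congr ?_ (by omega)
    rw [Nat.add_right_comm i 1 b, Nat.add_assoc i b 1]
    funext k
    cases k <;> simp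

/-- Moves the word on top of `code` to `code'` and the word in `cur` to `cur'`; for each position
at which both have a one, moves `b` symbols from `len` to `len'`. -/
def compareWord (b : ℕ) : RegProg :=
  loop Reg.code (fun o => o.any isBit)
    ((case Reg.code fun o => match o with
        | some (Γ'.bit true) => case Reg.cur fun o => match o with
            | some (Γ'.bit true) => useMarks b
            | _ => skip
        | _ => skip);;
      moveTop Reg.code Reg.code';; moveTop Reg.cur Reg.cur')

/-- With `i = 0` at the start, `len` ends up empty exactly when `n ≤ b * meet g w`, so a conflict is
detected by testing for emptiness. -/
theorem exec_compareWord (b : ℕ) {s : Reg → List Γ'} {n i : ℕ} {g w : List Bool} {r : List Γ'}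
    (hgw : g.length = w.length)
    (h₁ : s Reg.len = List.replicate (n - i) (Γ'.bit true))
    (h₂ : s Reg.len' = List.replicate (min n i) (Γ'.bit true))
    (h₃ : s Reg.code = g.map Γ'.bit ++ r) (h₄ : s Reg.cur = w.map Γ'.bit)
    (hr : r.head?.any isBit = false) :
    Exec (compareWord b) s
      (Function.update (Function.update (Function.update (Function.update (Function.update
        (Function.update s Reg.len (List.replicate (n - (i + b * meet g w)) (Γ'.bit true)))
        Reg.len' (List.replicate (min n (i + b * meet g w)) (Γ'.bit true)))
        Reg.code r) Reg.code' ((g.map Γ'.bit).reverse ++ s Reg.code'))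
        Reg.cur []) Reg.cur' ((w.map Γ'.bit).reverse ++ s Reg.cur'))
      ((3 * b + 8) * g.length + 1) := by
  induction g generalizing s i w with
  | nil =>
    obtain rfl : w = [] := List.length_eq_zero_iff.1 hgw.symm
    simp only [List.map_nil, List.nil_append] at h₃ h₄
    refine (Exec.loop_done (by simpa [h₃] using hr)).congr ?_ (by simp)
    funext k
    cases k <;> simp [h₁, h₂, h₃, h₄, meet]
  | cons x g ih =>
    obtain - | ⟨y, w⟩ := w
    · simp at hgw
    have e₁ : Exec (case Reg.code fun o => match o with
        | some (Γ'.bit true) => case Reg.cur fun o => match o with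
            | some (Γ'.bit true) => useMarks b
            | _ => skip
        | _ => skip) s
        (Function.update (Function.update s Reg.len
          (List.replicate (n - (i + b * (x && y).toNat)) (Γ'.bit true)))
        Reg.len' (List.replicate (min n (i + b * (x && y).toNat)) (Γ'.bit true)))
        (1 + (1 + (3 * b + 1))) := by
      refine Exec.case ?_
      rw [h₃]
      cases x
      · refine (Exec.skip s).congr ?_ (by omega)
        funext k
        cases k <;> simp [h₁, h₂]
      · refine Exec.case ?_
        rw [h₄]
        cases y
        · refine (Exec.skip s).congr ?_ (by omega)
          funext k
          cases k <;> simp [h₁, h₂]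
        · simpa using exec_useMarks b h₁ h₂
    have e₂ := Exec.moveTop (X := Reg.code) (Y := Reg.code') (by decide)
      (s := Function.update (Function.update s Reg.len
          (List.replicate (n - (i + b * (x && y).toNat)) (Γ'.bit true)))
        Reg.len' (List.replicate (min n (i + b * (x && y).toNat)) (Γ'.bit true)))
      (a := Γ'.bit x) (l := g.map Γ'.bit ++ r) (by simp [h₃])
    refine (Exec.loop_step (by simp [h₃, isBit]) (e₁.seq (e₂.seq
      (Exec.moveTop (X := Reg.cur) (Y := Reg.cur') (by decide)
        (a := Γ'.bit y) (l := w.map Γ'.bit) (by simp [h₄]))))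
      (ih (w := w) (i := i + b * (x && y).toNat) (by simpa using hgw) (by simp) (by simp) (by simp)
        (by simp))).congr ?_ ?_
    · have h : i + b * (x && y).toNat + b * meet g w = i + b * meet (x :: g) (y :: w) := by
        rw [meet]; ring
      rw [h]
      funext k
      cases k <;> simp
    · rw [List.length_cons, Nat.mul_succ]
      omega

/-- Whether the words `g` and `w` meet too often. -/
def conflict (b n : ℕ) (w g : List Bool) : Bool :=
  decide (n ≤ b * meet g w)

theorem length_encodeWords {G : List (List Bool)} {n : ℕ} (hG : ∀ g ∈ G, g.length = n) :
    (encodeWords G).length = G.length * (n + 1) := by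
  induction G with
  | nil => simp
  | cons g G ih =>
    rw [encodeWords_cons, List.length_cons, List.length_append, ih fun g hg => hG g (by simp [hg]),
      List.length_map, hG g (by simp), List.length_cons]
    ring

/-- Compares the word in `cur` with all words in `code`. -/
def compareAll (b : ℕ) : RegProg :=
  loop Reg.code Option.isSome
    (moveTop Reg.code Reg.code';; compareWord b;; moveAll Reg.cur' Reg.cur;;
      (case Reg.len fun o => o.elim (push Reg.bad Reg.bad fun _ => Γ'.bit true) fun _ => skip);;
      moveAll Reg.len' Reg.len);;
  moveAll Reg.code' Reg.code

theorem exec_compareAll (b : ℕ) {s : Reg → List Γ'} {n L : ℕ} {G : List (List Bool)}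
    {w : List Bool} (hG : ∀ g ∈ G, g.length = w.length) (hL : w.length ≤ L)
    (h₁ : s Reg.len = List.replicate n (Γ'.bit true)) (h₂ : s Reg.len' = [])
    (h₃ : s Reg.code = encodeWords G) (h₄ : s Reg.code' = [])
    (h₅ : s Reg.cur = w.map Γ'.bit) (h₆ : s Reg.cur' = []) (h₇ : s Reg.bad = []) :
    Exec (compareAll b) s
      (Function.update s Reg.bad (List.replicate (G.countP (conflict b n w)) (Γ'.bit true)))
      (G.length * ((3 * b + 14) * L + 3 * n + 12) + 2) := by
  have H : ∀ (G : List (List Bool)) (s : Reg → List Γ'), (∀ g ∈ G, g.length = w.length) →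
      s Reg.len = List.replicate n (Γ'.bit true) → s Reg.len' = [] →
      s Reg.code = encodeWords G → s Reg.cur = w.map Γ'.bit → s Reg.cur' = [] →
      Exec (loop Reg.code Option.isSome
        (moveTop Reg.code Reg.code';; compareWord b;; moveAll Reg.cur' Reg.cur;;
          (case Reg.len fun o => o.elim (push Reg.bad Reg.bad fun _ => Γ'.bit true)
            fun _ => skip);; moveAll Reg.len' Reg.len)) s
        (Function.update (Function.update (Function.update s Reg.bad
          (List.replicate (G.countP (conflict b n w)) (Γ'.bit true) ++ s Reg.bad))
          Reg.code []) Reg.code' ((encodeWords G).reverse ++ s Reg.code'))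
        (G.length * ((3 * b + 11) * L + 3 * n + 8) + 1) := by
    intro G
    induction G with
    | nil =>
      intro s _ h₁ h₂ h₃ h₄ h₅
      refine (Exec.loop_done (by simp [h₃])).congr ?_ (by simp)
      funext k
      cases k <;> simp [h₃]
    | cons g G ih =>
      intro s hG h₁ h₂ h₃ h₄ h₅
      rw [encodeWords_cons] at h₃
      have hg : g.length = w.length := hG g (by simp)
      have e₁ := Exec.moveTop (X := Reg.code) (Y := Reg.code') (by decide) h₃
      have e₂ := exec_compareWord b (n := n) (i := 0) (g := g) (w := w) (r := encodeWords G)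
        (s := Function.update (Function.update s Reg.code' (Γ'.comma :: s Reg.code'))
          Reg.code (g.map Γ'.bit ++ encodeWords G)) hg
        (by simp [h₁]) (by simp [h₂]) (by simp) (by simp [h₄]) (head_encodeWords G)
      have e₃ := Exec.moveAll (X := Reg.cur') (Y := Reg.cur) (by decide)
        (w := (w.map Γ'.bit).reverse)
        (s := Function.update (Function.update (Function.update (Function.update (Function.update
        (Function.update (Function.update (Function.update s Reg.code' (Γ'.comma :: s Reg.code'))
          Reg.code (g.map Γ'.bit ++ encodeWords G))
          Reg.len (List.replicate (n - (0 + b * meet g w)) (Γ'.bit true)))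
        Reg.len' (List.replicate (min n (0 + b * meet g w)) (Γ'.bit true)))
        Reg.code (encodeWords G)) Reg.code' ((g.map Γ'.bit).reverse ++ Γ'.comma :: s Reg.code'))
        Reg.cur []) Reg.cur' ((w.map Γ'.bit).reverse ++ s Reg.cur')) (by simp [h₅])
      have e₄ : Exec (case Reg.len fun o => o.elim (push Reg.bad Reg.bad fun _ => Γ'.bit true)
            fun _ => skip)
          (Function.update (Function.update (Function.update (Function.update s
            Reg.len (List.replicate (n - b * meet g w) (Γ'.bit true)))
            Reg.len' (List.replicate (min n (b * meet g w)) (Γ'.bit true)))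
            Reg.code (encodeWords G)) Reg.code'
              ((g.map Γ'.bit).reverse ++ Γ'.comma :: s Reg.code'))
          (Function.update (Function.update (Function.update (Function.update (Function.update s
            Reg.len (List.replicate (n - b * meet g w) (Γ'.bit true)))
            Reg.len' (List.replicate (min n (b * meet g w)) (Γ'.bit true)))
            Reg.code (encodeWords G)) Reg.code'
              ((g.map Γ'.bit).reverse ++ Γ'.comma :: s Reg.code'))
            Reg.bad (List.replicate (conflict b n w g).toNat (Γ'.bit true) ++ s Reg.bad))
          (1 + 1) := by
        refine Exec.case ?_
        by_cases h : n ≤ b * meet g w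
        · have h' : conflict b n w g = true := decide_eq_true h
          rw [h']
          simp only [Nat.sub_eq_zero_of_le h]
          exact (Exec.push _ _ _ _).congr (by simp) le_rfl
        · have h' : conflict b n w g = false := decide_eq_false h
          have h'' : n - b * meet g w = n - b * meet g w - 1 + 1 := by omega
          rw [h', h'']
          refine (Exec.skip _).congr ?_ le_rfl
          funext k
          cases k <;> simp
      have e₅ := e₁.seq ((e₂.congr (by simp) le_rfl).seq ((e₃.congr (s₂ := Function.update
        (Function.update (Function.update (Function.update s
            Reg.len (List.replicate (n - b * meet g w) (Γ'.bit true)))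
            Reg.len' (List.replicate (min n (b * meet g w)) (Γ'.bit true)))
            Reg.code (encodeWords G)) Reg.code'
              ((g.map Γ'.bit).reverse ++ Γ'.comma :: s Reg.code')) (by
          funext k
          cases k <;> simp [h₄, h₅]) le_rfl).seq
        (e₄.seq (Exec.moveAll (X := Reg.len') (Y := Reg.len) (by decide)
          (w := List.replicate (min n (b * meet g w)) (Γ'.bit true)) (by simp)))))
      refine (Exec.loop_step (by simp [h₃]) e₅ (ih _ (fun g hg => hG g (by simp [hg]))
        (by simp; omega) (by simp) (by simp) (by simp [h₄]) (by simp [h₅]))).congr ?_ ?_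
      · funext k
        cases k <;> simp [h₁, h₂, encodeWords_cons, List.countP_cons]
        · omega
        rcases Bool.eq_false_or_eq_true (conflict b n w g) with h | h
        · rw [h, if_pos rfl, List.replicate_succ']
          simp
        · rw [h]
          simp
      · rw [List.length_cons, Nat.add_mul G.length]
        have h₁ : (3 * b + 8) * g.length ≤ (3 * b + 8) * L := Nat.mul_le_mul_left _ (hg ▸ hL)
        have h₂ : (3 * b + 11) * L = (3 * b + 8) * L + 3 * L := by ring
        simp only [List.length_reverse, List.length_map, List.length_replicate]
        omega
  have hlen := length_encodeWords hG
  refine ((H G s hG h₁ h₂ h₃ h₅ h₆).seq (Exec.moveAll (X := Reg.code') (Y := Reg.code)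
    (by decide) rfl)).congr ?_ ?_
  · funext k
    cases k <;> simp [h₃, h₄, h₇]
  · simp only [h₄, Function.update_self, List.append_nil, List.length_reverse, hlen]
    have h₁ : G.length * (w.length + 1) ≤ G.length * (L + 1) := Nat.mul_le_mul_left _ (by omega)
    have h₂ : G.length * ((3 * b + 14) * L + 3 * n + 12) =
      G.length * ((3 * b + 11) * L + 3 * n + 8) + 3 * (G.length * (L + 1)) + G.length := by ring
    omega

/-- Runs through the candidates and collects the greedy code. -/
def selectCode (b : ℕ) : RegProg :=
  loop Reg.words Option.isSome
    -- Each transfer reverses the word; the detour through `tmp` restores its order.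
    (pop Reg.words;; moveWhile isBit Reg.words Reg.tmp;; moveAll Reg.tmp Reg.cur;; compareAll b;;
      case Reg.bad fun o => o.elim
        (moveAll Reg.cur Reg.tmp;; moveAll Reg.tmp Reg.code;;
          push Reg.code Reg.code fun _ => Γ'.comma)
        fun _ => clear Reg.cur;; clear Reg.bad)

theorem addWord_eq (b n : ℕ) (G : List (List Bool)) (w : List Bool) :
    addWord b n G w = if G.countP (conflict b n w) = 0 then w :: G else G := by
  unfold addWord
  by_cases h : G.any (fun g => decide (n ≤ b * meet g w)) = true
  · rw [if_pos h, if_neg]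
    obtain ⟨g, hg, h'⟩ := List.any_eq_true.1 h
    rw [List.countP_eq_zero]
    exact fun H => H g hg h'
  · rw [if_neg h, if_pos]
    rw [List.countP_eq_zero]
    exact fun g hg h' => h (List.any_eq_true.2 ⟨g, hg, h'⟩)

theorem exec_selectCode (b : ℕ) {s : Reg → List Γ'} {n L M : ℕ} {W : List (List Bool)}
    (hW : ∀ w ∈ W, w.length = L) (hM : W.length ≤ M)
    (h₁ : s Reg.len = List.replicate n (Γ'.bit true)) (h₂ : s Reg.len' = [])
    (h₃ : s Reg.code = []) (h₄ : s Reg.code' = []) (h₅ : s Reg.cur = []) (h₆ : s Reg.cur' = [])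
    (h₇ : s Reg.bad = []) (h₈ : s Reg.words = encodeWords W) (h₉ : s Reg.tmp = []) :
    Exec (selectCode b) s
      (Function.update (Function.update s Reg.words [])
        Reg.code (encodeWords (W.foldl (addWord b n) [])))
      (W.length * (M * ((3 * b + 14) * L + 3 * n + 14) + 12 * L + 13) + 1) := by
  -- Remaining candidates and chosen words together never exceed `M`, which bounds the cost of every
  -- comparison round.
  have H : ∀ (W G : List (List Bool)) (s : Reg → List Γ'), (∀ w ∈ W, w.length = L) →
      (∀ w ∈ G, w.length = L) → W.length + G.length ≤ M →
      s Reg.len = List.replicate n (Γ'.bit true) → s Reg.len' = [] →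
      s Reg.code = encodeWords G → s Reg.code' = [] → s Reg.cur = [] → s Reg.cur' = [] →
      s Reg.bad = [] → s Reg.words = encodeWords W → s Reg.tmp = [] →
      Exec (selectCode b) s
        (Function.update (Function.update s Reg.words [])
          Reg.code (encodeWords (W.foldl (addWord b n) G)))
        (W.length * (M * ((3 * b + 14) * L + 3 * n + 14) + 12 * L + 13) + 1) := by
    intro W
    induction W with
    | nil =>
      intro G s _ _ _ h₁ h₂ h₃ h₄ h₅ h₆ h₇ h₈ h₉
      refine (Exec.loop_done (by simp [h₈])).congr ?_ (by simp)
      funext k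
      cases k <;> simp [h₃, h₈]
    | cons w W ih =>
      intro G s hW hG hM h₁ h₂ h₃ h₄ h₅ h₆ h₇ h₈ h₉
      rw [encodeWords_cons] at h₈
      have hw : w.length = L := hW w (by simp)
      have e₁ := (Exec.pop Reg.words s).congr (s₂ := Function.update s Reg.words
        (w.map Γ'.bit ++ encodeWords W)) (by simp [h₈]) le_rfl
      have e₂ := (Exec.moveWhile (p := isBit) (X := Reg.words) (Y := Reg.tmp) (by decide)
        (s := Function.update s Reg.words (w.map Γ'.bit ++ encodeWords W))
        (w := w.map Γ'.bit) (l := encodeWords W) (by simp) isBit_of_mem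
        (head_encodeWords W)).congr (s₂ := Function.update (Function.update s Reg.words
          (encodeWords W)) Reg.tmp (w.map Γ'.bit).reverse) (by
            funext k
            cases k <;> simp [h₉]) le_rfl
      have e₃ := (Exec.moveAll (X := Reg.tmp) (Y := Reg.cur) (by decide)
        (s := Function.update (Function.update s Reg.words
          (encodeWords W)) Reg.tmp (w.map Γ'.bit).reverse)
        (w := (w.map Γ'.bit).reverse) (by simp)).congr (s₂ := Function.update (Function.update s
          Reg.words (encodeWords W)) Reg.cur (w.map Γ'.bit)) (by
            funext k
            cases k <;> simp [h₉, h₅]) le_rfl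
      have e₄ := exec_compareAll b (s := Function.update (Function.update s
        Reg.words (encodeWords W)) Reg.cur (w.map Γ'.bit)) (n := n) (L := L) (G := G) (w := w)
        (fun g hg => (hG g hg).trans hw.symm) hw.le (by simp [h₁]) (by simp [h₂]) (by simp [h₃])
        (by simp [h₄]) (by simp) (by simp [h₆]) (by simp [h₇])
      have e₅ : Exec (case Reg.bad fun o => o.elim
          (moveAll Reg.cur Reg.tmp;; moveAll Reg.tmp Reg.code;;
            push Reg.code Reg.code fun _ => Γ'.comma)
          fun _ => clear Reg.cur;; clear Reg.bad)
          (Function.update (Function.update (Function.update s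
            Reg.words (encodeWords W)) Reg.cur (w.map Γ'.bit)) Reg.bad
            (List.replicate (G.countP (conflict b n w)) (Γ'.bit true)))
          (Function.update (Function.update s Reg.words (encodeWords W))
            Reg.code (encodeWords (addWord b n G w))) (6 * L + 2 * M + 4) := by
        by_cases h : G.countP (conflict b n w) = 0
        · refine (Exec.case (T := 6 * L + 3) ?_).mono (by omega)
          rw [h]
          refine ((Exec.moveAll (X := Reg.cur) (Y := Reg.tmp) (by decide)
            (w := w.map Γ'.bit) (by simp)).seq ((Exec.moveAll (X := Reg.tmp) (Y := Reg.code)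
            (by decide) (w := (w.map Γ'.bit).reverse) (by simp [h₉])).seq
            (Exec.push _ _ _ _))).congr ?_ ?_
          · rw [addWord_eq, if_pos h]
            funext k
            cases k <;> simp [h₃, h₅, h₇, h₉, encodeWords_cons]
          · simp [hw]
            omega
        · have h' : List.countP (conflict b n w) G ≤ G.length := List.countP_le_length
          refine (Exec.case (T := 2 * L + 2 * M + 2) ?_).mono (by omega)
          obtain ⟨j, hj⟩ := Nat.exists_eq_succ_of_ne_zero h
          rw [hj]
          refine ((Exec.clear (X := Reg.cur) (w := w.map Γ'.bit) (by simp)).seq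
            (Exec.clear (X := Reg.bad) (w := List.replicate (j + 1) (Γ'.bit true))
              (by simp))).congr ?_ ?_
          · rw [addWord_eq, if_neg h]
            funext k
            cases k <;> simp [h₃, h₅, h₇]
          · simp [hw]
            omega
      have hadd : ∀ g ∈ addWord b n G w, g.length = L := by
        rw [addWord_eq]
        split_ifs
        · intro g hg
          rcases List.mem_cons.1 hg with rfl | hg
          · exact hw
          · exact hG g hg
        · exact hG
      have hadd' : (addWord b n G w).length ≤ G.length + 1 := by
        rw [addWord_eq]
        split_ifs <;> simp
      rw [List.length_cons] at hM
      refine (Exec.loop_step (by simp [h₈]) (e₁.seq (e₂.seq (e₃.seq (e₄.seq e₅))))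
        (ih (addWord b n G w) _ (fun w hw => hW w (by simp [hw])) hadd (by omega) (by simp [h₁])
          (by simp [h₂]) (by simp) (by simp [h₄]) (by simp [h₅]) (by simp [h₆]) (by simp [h₇])
          (by simp) (by simp [h₉]))).congr ?_ ?_
      · funext k
        cases k <;> simp
      · have h₁ : G.length * ((3 * b + 14) * L + 3 * n + 12) ≤
          M * ((3 * b + 14) * L + 3 * n + 12) := Nat.mul_le_mul_right _ (by omega)
        have h₂ : M * ((3 * b + 14) * L + 3 * n + 14) =
          M * ((3 * b + 14) * L + 3 * n + 12) + 2 * M := by ring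
        rw [List.length_cons, Nat.add_mul W.length]
        simp only [List.length_map, List.length_reverse, hw]
        omega
  exact H W [] s hW (by simp) (by simpa using hM) h₁ h₂ (by simpa using h₃) h₄ h₅ h₆ h₇ h₈ h₉

/-! ### Assignment of code words to elements, and output of the points. -/

/-- Distributes the code words to the elements. -/
def assignCode : RegProg :=
  loop Reg.used Option.isSome
    (push Reg.words' Reg.words' (fun _ => Γ'.comma);;
      (case Reg.used fun o => match o with
        | some (Γ'.bit true) => pop Reg.code;; moveWhile isBit Reg.code Reg.words'
        | _ => skip);; pop Reg.used);;
  moveAll Reg.words' Reg.words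

/-- Only used elements consume a code word; the words left over stay in `code` until the final
clearing. -/
theorem exec_assignCode {s : Reg → List Γ'} {u : List Bool} {G : List (List Bool)} {L : ℕ}
    (hG : ∀ g ∈ G, g.length ≤ L) (h₁ : s Reg.used = u.map Γ'.bit)
    (h₂ : s Reg.code = encodeWords G) (h₃ : s Reg.words = []) (h₄ : s Reg.words' = []) :
    Exec assignCode s (Function.update (Function.update (Function.update s Reg.used [])
      Reg.code (encodeWords (G.drop (u.count true)))) Reg.words (encodeWords (assignWords u G)))
      (u.length * (6 * L + 9) + 2) := by
  have H : ∀ (u : List Bool) (G : List (List Bool)) (s : Reg → List Γ'),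
      (∀ g ∈ G, g.length ≤ L) → s Reg.used = u.map Γ'.bit → s Reg.code = encodeWords G →
      Exec (loop Reg.used Option.isSome
        (push Reg.words' Reg.words' (fun _ => Γ'.comma);;
          (case Reg.used fun o => match o with
            | some (Γ'.bit true) => pop Reg.code;; moveWhile isBit Reg.code Reg.words'
            | _ => skip);; pop Reg.used)) s
        (Function.update (Function.update (Function.update s Reg.used [])
          Reg.code (encodeWords (G.drop (u.count true)))) Reg.words'
          ((encodeWords (assignWords u G)).reverse ++ s Reg.words'))
        (u.length * (3 * L + 6) + 1) := by
    intro u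
    induction u with
    | nil =>
      intro G s _ h₁ h₂
      refine (Exec.loop_done (by simp [h₁])).congr ?_ (by simp)
      funext k
      cases k <;> simp [h₁, h₂, assignWords]
    | cons a u ih =>
      intro G s hG h₁ h₂
      have e₁ := Exec.push Reg.words' Reg.words' (fun _ => Γ'.comma) s
      have e₂ : Exec (case Reg.used fun o => match o with
            | some (Γ'.bit true) => pop Reg.code;; moveWhile isBit Reg.code Reg.words'
            | _ => skip)
          (Function.update s Reg.words' (Γ'.comma :: s Reg.words'))
          (Function.update (Function.update s Reg.words'
            (((if a then G.headD [] else []).map Γ'.bit).reverse ++ Γ'.comma :: s Reg.words'))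
            Reg.code (encodeWords (if a then G.tail else G))) (3 * L + 3) := by
        cases a
        · refine (Exec.case (T := 1) ?_).mono (by omega)
          simp only [ne_eq, reduceCtorEq, not_false_eq_true, Function.update_of_ne, h₁]
          refine (Exec.skip _).congr ?_ le_rfl
          funext k
          cases k <;> simp [h₂]
        · refine (Exec.case (T := 3 * L + 2) ?_).mono (by omega)
          simp only [ne_eq, reduceCtorEq, not_false_eq_true, Function.update_of_ne, h₁]
          cases G with
          | nil =>
            refine ((Exec.pop _ _).seq (Exec.moveWhile (by decide) (w := []) (l := [])
              (by simp [h₂]) (by simp) (by simp))).congr ?_ (by simp)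
            funext k
            cases k <;> simp
          | cons g G =>
            rw [encodeWords_cons] at h₂
            refine ((Exec.pop _ _).seq (Exec.moveWhile (by decide) (w := g.map Γ'.bit)
              (l := encodeWords G) (by simp [h₂]) isBit_of_mem (head_encodeWords G))).congr ?_ ?_
            · funext k
              cases k <;> simp
            · have := hG g (by simp)
              simp
              omega
      refine (Exec.loop_step (by simp [h₁]) (e₁.seq (e₂.seq (Exec.pop _ _)))
        (ih (if a then G.tail else G) _ ?_ (by simp [h₁]) (by simp))).congr ?_ ?_
      · intro g hg
        refine hG g ?_
        cases a
        · simpa using hg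
        · exact List.mem_of_mem_tail (by simpa using hg)
      · funext k
        cases k <;> cases a <;> simp [assignWords, encodeWords_cons, List.drop_tail]
      · rw [List.length_cons, Nat.add_mul u.length]
        omega
  have hlen : (encodeWords (assignWords u G)).length ≤ u.length * (L + 1) := by
    clear H h₁ h₂
    induction u generalizing G with
    | nil => simp [assignWords]
    | cons a u ih =>
      cases a
      · rw [assignWords, encodeWords_cons, List.length_cons, List.length_append, List.length_cons,
          Nat.add_mul]
        have := ih hG
        simp
        omega
      · rw [assignWords, encodeWords_cons, List.length_cons, List.length_append, List.length_cons,
          Nat.add_mul]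
        have := ih (G := G.tail) (fun g hg => hG g (List.mem_of_mem_tail hg))
        have h : (G.headD []).length ≤ L := by
          cases G with
          | nil => simp
          | cons g G => exact hG g (by simp)
        simp only [List.length_map]
        omega
  refine ((H u G s hG h₁ h₂).seq (Exec.moveAll (X := Reg.words') (Y := Reg.words)
    (by decide) rfl)).congr ?_ ?_
  · funext k
    cases k <;> simp [h₃, h₄]
  · simp only [h₄, Function.update_self, List.append_nil, List.length_reverse]
    have : u.length * (6 * L + 9) = u.length * (3 * L + 6) + 3 * (u.length * (L + 1)) := by ring
    omega

theorem length_orWord (w u : List Bool) (h : u.length ≤ w.length) :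
    (orWord w u).length = w.length := by
  induction w generalizing u with
  | nil => simpa [orWord] using h
  | cons a w ih =>
    rw [orWord, List.length_cons, List.length_cons, ih]
    rw [List.length_tail]
    simpa using h

theorem length_orWord_le {w u : List Bool} {L : ℕ} (hw : w.length ≤ L) (hu : u.length ≤ L) :
    (orWord w u).length ≤ L := by
  induction w generalizing u L with
  | nil => simpa [orWord] using hu
  | cons a w ih =>
    obtain - | L := L
    · simp at hw
    rw [orWord, List.length_cons]
    refine Nat.succ_le_succ (ih (by simpa using hw) ?_)
    rw [List.length_tail]
    omega

theorem length_selectOr_le {v : List Bool} {C : List (List Bool)} {u : List Bool} {L : ℕ}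
    (hC : ∀ c ∈ C, c.length ≤ L) (hu : u.length ≤ L) : (selectOr v C u).length ≤ L := by
  induction v generalizing C u with
  | nil => simpa [selectOr] using hu
  | cons b v ih =>
    cases C with
    | nil => simpa [selectOr] using hu
    | cons c C =>
      rw [selectOr]
      refine ih (fun c hc => hC c (by simp [hc])) ?_
      cases b
      · simpa using hu
      · exact length_orWord_le (hC c (by simp)) hu

/-- Computes in `cur` the disjunction of the words selected by the row on top of `inp`. -/
def selectRow : RegProg :=
  loop Reg.inp (fun o => o.any isBit)
    (moveTop Reg.words Reg.words';;
      (case Reg.inp fun o => match o with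
        | some (Γ'.bit true) => orWordProg Reg.words Reg.words' Reg.cur
        | _ => moveWhile isBit Reg.words Reg.words');; pop Reg.inp)

theorem exec_selectRow {s : Reg → List Γ'} {v u : List Bool} {C : List (List Bool)} {r : List Γ'}
    {L : ℕ} (hC : ∀ c ∈ C, c.length ≤ L) (hv : v.length = C.length)
    (h₁ : s Reg.inp = v.map Γ'.bit ++ r) (h₂ : s Reg.words = encodeWords C)
    (h₃ : s Reg.cur = u.map Γ'.bit) (h₄ : s Reg.tmp = []) (hr : r.head?.any isBit = false) :
    Exec selectRow s
      (Function.update (Function.update (Function.update (Function.update s Reg.inp r)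
        Reg.words []) Reg.words' ((encodeWords C).reverse ++ s Reg.words'))
        Reg.cur ((selectOr v C u).map Γ'.bit)) (v.length * (9 * L + 7) + 1) := by
  induction v generalizing s C u with
  | nil =>
    obtain rfl : C = [] := List.length_eq_zero_iff.1 hv.symm
    simp only [List.map_nil, List.nil_append] at h₁
    refine (Exec.loop_done (by simpa [h₁] using hr)).congr ?_ (by simp)
    funext k
    cases k <;> simp [h₁, h₂, h₃, selectOr]
  | cons b v ih =>
    obtain - | ⟨c, C⟩ := C
    · simp at hv
    rw [encodeWords_cons] at h₂
    have e₁ := Exec.moveTop (X := Reg.words) (Y := Reg.words') (by decide) h₂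
    have hc : c.length ≤ L := hC c (by simp)
    have e₂ : Exec (case Reg.inp fun o => match o with
        | some (Γ'.bit true) => orWordProg Reg.words Reg.words' Reg.cur
        | _ => moveWhile isBit Reg.words Reg.words')
        (Function.update (Function.update s Reg.words' (Γ'.comma :: s Reg.words'))
          Reg.words (c.map Γ'.bit ++ encodeWords C))
        (Function.update (Function.update (Function.update s Reg.words'
          ((c.map Γ'.bit).reverse ++ Γ'.comma :: s Reg.words')) Reg.words (encodeWords C))
          Reg.cur ((if b then orWord c u else u).map Γ'.bit)) (9 * L + 3) := by
      cases b
      · refine (Exec.case (T := 9 * L + 2) ?_).mono (by omega)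
        simp only [ne_eq, reduceCtorEq, not_false_eq_true, Function.update_of_ne, h₁]
        refine (Exec.moveWhile (p := isBit) (X := Reg.words) (Y := Reg.words') (by decide)
          (w := c.map Γ'.bit) (l := encodeWords C) (by simp) isBit_of_mem
          (head_encodeWords C)).congr ?_ ?_
        · funext k
          cases k <;> simp [h₃]
        · rw [List.length_map]
          omega
      · refine (Exec.case (T := 9 * L + 2) ?_).mono (by omega)
        simp only [ne_eq, reduceCtorEq, not_false_eq_true, Function.update_of_ne, h₁]
        refine (exec_orWordProg (X := Reg.words) (Y := Reg.words') (U := Reg.cur) (by decide)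
          (by decide) (by decide) (by decide) (by decide) (by decide) (w := c) (u := u)
          (r := encodeWords C) (by simp) (by simp [h₃]) (by simp [h₄])
          (head_encodeWords C)).congr ?_ (by omega)
        funext k
        cases k <;> simp
    refine (Exec.loop_step (by simp [h₁, isBit]) (e₁.seq (e₂.seq (Exec.pop _ _)))
      (ih (C := C) (u := if b then orWord c u else u) (fun c hc => hC c (by simp [hc]))
        (by simpa using hv) (by simp [h₁]) (by simp) (by simp) (by simp [h₄]))).congr ?_ ?_
    · funext k
      cases k <;> simp [encodeWords_cons, selectOr]
    · rw [List.length_cons, Nat.add_mul v.length]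
      omega

/-- Writes the points that correspond to the rows, in reverse order. -/
def writeRows : RegProg :=
  loop Reg.inp Option.isSome
    (pop Reg.inp;; push Reg.out Reg.out (fun _ => Γ'.comma);; selectRow;;
      moveAll Reg.words' Reg.words;; moveAll Reg.cur Reg.out)

theorem length_encodeWords_le {G : List (List Bool)} {n : ℕ} (hG : ∀ g ∈ G, g.length ≤ n) :
    (encodeWords G).length ≤ G.length * (n + 1) := by
  induction G with
  | nil => simp
  | cons g G ih =>
    rw [encodeWords_cons, List.length_cons, List.length_append, List.length_map, List.length_cons,
      Nat.add_mul]
    have h₁ := ih fun g hg => hG g (by simp [hg])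
    have h₂ := hG g (by simp)
    omega

/-- The list of assigned words is restored after each row, so every row reads it from the beginning.
-/
theorem exec_writeRows {s : Reg → List Γ'} {rows C : List (List Bool)} {L : ℕ}
    (hC : ∀ c ∈ C, c.length ≤ L) (hrows : ∀ v ∈ rows, v.length = C.length)
    (h₁ : s Reg.inp = encodeWords rows) (h₂ : s Reg.words = encodeWords C)
    (h₃ : s Reg.cur = []) (h₄ : s Reg.tmp = []) (h₅ : s Reg.words' = []) :
    Exec writeRows s
      (Function.update (Function.update s Reg.inp [])
        Reg.out ((encodeWords (rows.map fun v => selectOr v C [])).reverse ++ s Reg.out))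
      (rows.length * (C.length * (12 * L + 10) + 3 * L + 6) + 1) := by
  induction rows generalizing s with
  | nil =>
    refine (Exec.loop_done (by simp [h₁])).congr ?_ (by simp)
    funext k
    cases k <;> simp [h₁]
  | cons v rows ih =>
    rw [encodeWords_cons] at h₁
    have hv := hrows v (by simp)
    have e₁ := exec_selectRow (s := Function.update (Function.update s Reg.inp
      (v.map Γ'.bit ++ encodeWords rows)) Reg.out (Γ'.comma :: s Reg.out)) (v := v) (u := [])
      (r := encodeWords rows) hC hv (by simp) (by simp [h₂]) (by simp [h₃]) (by simp [h₄])
      (head_encodeWords rows)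
    have e₂ := e₁.congr (s₂ := Function.update (Function.update (Function.update (Function.update
      (Function.update s Reg.inp (encodeWords rows)) Reg.out (Γ'.comma :: s Reg.out))
        Reg.words []) Reg.words' ((encodeWords C).reverse))
        Reg.cur ((selectOr v C []).map Γ'.bit)) (by
          funext k
          cases k <;> simp [h₅]) le_rfl
    have e₃ := (Exec.moveAll (X := Reg.words') (Y := Reg.words) (by decide)
      (w := (encodeWords C).reverse) (s := Function.update (Function.update (Function.update
        (Function.update (Function.update s Reg.inp (encodeWords rows)) Reg.out
        (Γ'.comma :: s Reg.out)) Reg.words []) Reg.words' ((encodeWords C).reverse))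
        Reg.cur ((selectOr v C []).map Γ'.bit)) (by simp)).congr (s₂ := Function.update
        (Function.update (Function.update s Reg.inp (encodeWords rows)) Reg.out
        (Γ'.comma :: s Reg.out)) Reg.cur ((selectOr v C []).map Γ'.bit)) (by
          funext k
          cases k <;> simp [h₂, h₅]) le_rfl
    have e₄ := Exec.moveAll (X := Reg.cur) (Y := Reg.out) (by decide)
      (w := (selectOr v C []).map Γ'.bit) (s := Function.update
        (Function.update (Function.update s Reg.inp (encodeWords rows)) Reg.out
        (Γ'.comma :: s Reg.out)) Reg.cur ((selectOr v C []).map Γ'.bit)) (by simp)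
    refine (Exec.loop_step (by simp [h₁]) ((Exec.pop _ _).seq ((Exec.push _ _ _ _).seq
      ((e₂.start ?_).seq (e₃.seq e₄)))) (ih (fun v hv => hrows v (by simp [hv])) (by simp)
        (by simp [h₂]) (by simp) (by simp [h₄]) (by simp [h₅]))).congr ?_ ?_
    · funext k
      cases k <;> simp [h₁]
    · funext k
      cases k <;> simp [encodeWords_cons, h₃]
    · have l₁ := length_encodeWords_le hC
      have l₂ : (selectOr v C []).length ≤ L := length_selectOr_le hC (by simp)
      rw [List.length_cons, Nat.add_mul rows.length, hv]
      simp only [List.length_reverse, List.length_map]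
      have l₃ : C.length * (12 * L + 10) = C.length * (9 * L + 7) + 3 * (C.length * (L + 1)) := by
        ring
      omega

/-! ### The whole program and its running time. -/

/-- All registers except those for the output. -/
def workRegs : List Reg :=
  [Reg.inp, Reg.aux, Reg.used, Reg.tmp, Reg.cnt, Reg.len, Reg.len', Reg.words, Reg.words',
    Reg.code, Reg.code', Reg.cur, Reg.cur', Reg.bad]

/-- The main part of the reduction. -/
def reduceRows (b : ℕ) (blocks : List (List Bool)) : RegProg :=
  makeWords blocks;; selectCode b;; assignCode;; writeRows;; clearList workRegs;;
    moveAll Reg.out Reg.fin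

theorem length_wordsOf {blocks : List (List Bool)} {β : ℕ} (h : ∀ c ∈ blocks, c.length = β)
    (n : ℕ) : ∀ w ∈ wordsOf blocks n, w.length = n * β := by
  induction n with
  | zero => simp [wordsOf]
  | succ n ih =>
    intro w hw
    simp only [wordsOf, List.mem_flatMap, List.mem_map] at hw
    obtain ⟨c, hc, w, hw, rfl⟩ := hw
    rw [List.length_append, h c hc, ih w hw]
    ring

theorem length_wordsOf_eq (blocks : List (List Bool)) (n : ℕ) :
    (wordsOf blocks n).length = blocks.length ^ n := by
  induction n with
  | zero => simp [wordsOf]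
  | succ n ih => simp [wordsOf, ih, List.length_flatMap, pow_succ, mul_comm]

theorem mem_of_mem_foldl_addWord {b n : ℕ} {W G : List (List Bool)} {w : List Bool}
    (h : w ∈ W.foldl (addWord b n) G) : w ∈ W ∨ w ∈ G := by
  induction W generalizing G with
  | nil => exact Or.inr h
  | cons a W ih =>
    rcases ih h with h | h
    · exact Or.inl (List.mem_cons_of_mem _ h)
    · rw [addWord_eq] at h
      split_ifs at h
      · rcases List.mem_cons.1 h with rfl | h
        · exact Or.inl List.mem_cons_self
        · exact Or.inr h
      · exact Or.inr h

theorem length_foldl_addWord_le (b n : ℕ) (W G : List (List Bool)) :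
    (W.foldl (addWord b n) G).length ≤ W.length + G.length := by
  induction W generalizing G with
  | nil => simp
  | cons a W ih =>
    refine (ih _).trans ?_
    rw [addWord_eq]
    split_ifs
    · rw [List.length_cons, List.length_cons]
      omega
    · rw [List.length_cons]
      omega

theorem length_usedBits {rows : List (List Bool)} {N : ℕ} (h : ∀ v ∈ rows, v.length = N)
    (hne : rows ≠ []) : (usedBits rows).length = N := by
  have H : ∀ (rows : List (List Bool)) (u : List Bool), (∀ v ∈ rows, v.length = N) →
      u.length = N → (rows.foldl (fun u v => orWord v u) u).length = N := by
    intro rows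
    induction rows with
    | nil => exact fun u _ hu => hu
    | cons v rows ih =>
      intro u h hu
      refine ih _ (fun v hv => h v (by simp [hv])) ?_
      rw [length_orWord _ _ (by rw [hu, h v (by simp)]), h v (by simp)]
  cases rows with
  | nil => exact absurd rfl hne
  | cons v rows =>
    refine H rows _ (fun v hv => h v (by simp [hv])) ?_
    rw [length_orWord _ _ (by simp), h v (by simp)]

theorem length_assignWords (u : List Bool) (G : List (List Bool)) :
    (assignWords u G).length = u.length := by
  induction u generalizing G with
  | nil => rfl
  | cons a u ih => cases a <;> simp [assignWords, ih]

theorem length_le_of_mem_assignWords {u : List Bool} {G : List (List Bool)} {L : ℕ}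
    (hG : ∀ g ∈ G, g.length ≤ L) : ∀ c ∈ assignWords u G, c.length ≤ L := by
  induction u generalizing G with
  | nil => simp [assignWords]
  | cons a u ih =>
    intro c hc
    cases a
    · rcases List.mem_cons.1 hc with rfl | hc
      · simp
      · exact ih hG c hc
    · rcases List.mem_cons.1 hc with rfl | hc
      · cases G with
        | nil => simp
        | cons g G => exact hG g (by simp)
      · exact ih (fun g hg => hG g (List.mem_of_mem_tail hg)) c hc

/-- The registers after the input has been read. -/
def readState (rows : List (List Bool)) (o : List Γ') : Reg → List Γ' :=
  Function.update (Function.update (Function.update (Function.update (fun _ => [])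
    Reg.inp (encodeWords rows)) Reg.used ((usedBits rows).map Γ'.bit))
    Reg.cnt (List.replicate rows.length (Γ'.bit true))) Reg.out o

/-- A bound for the running time of `reduceRows`. -/
def reduceTime (b Q β M n : ℕ) : ℕ :=
  (n * (Q * ((β + 9) * (M * (n * β + 1)) + 2) + 5 * (M * (n * β + 1)) + 8 * n + 7) + 2) +
  ((M * (M * ((3 * b + 14) * (n * β) + 3 * n + 14) + 12 * (n * β) + 13) + 1) +
  ((n * (6 * (n * β) + 9) + 2) +
  ((n * (n * (12 * (n * β) + 10) + 3 * (n * β) + 6) + 1) +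
  ((14 * (2 * ((n + M) * (n * β + 1) + n) + 1) + 1) +
  (3 * (n * (n * β + 1) + n) + 1)))))

/-- The word `o` is the reversed prefix that encodes `k`. It lies below the rows in `out`, where all
output is reversed, so the last transfer puts it in front of the points. All other registers must
end empty, since a halting machine may keep only its output. -/
theorem exec_reduceRows {b β M n : ℕ} {blocks rows : List (List Bool)} {o : List Γ'} {N : ℕ}
    (hblocks : ∀ c ∈ blocks, c.length = β) (hpos : 0 < blocks.length) (hrows : rows ≠ [])
    (hN : ∀ v ∈ rows, v.length = N) (hn : rows.length ≤ n) (hn' : N ≤ n) (ho : o.length ≤ n)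
    (hM : blocks.length ^ Nat.size rows.length ≤ M) :
    Exec (reduceRows b blocks) (readState rows o)
      (Function.update (fun _ => []) Reg.fin (o.reverse ++ encodeWords (outRows b blocks rows)))
      (reduceTime b blocks.length β M n) := by
  set ℓ := Nat.size rows.length with hℓ
  have hℓn : ℓ ≤ n := (Nat.size_le.2 Nat.lt_two_pow_self).trans hn
  have hW : ∀ w ∈ wordsOf blocks ℓ, w.length = ℓ * β := length_wordsOf hblocks ℓ
  have hG : ∀ g ∈ greedyCode b blocks ℓ, g.length ≤ n * β := by
    intro g hg
    rcases mem_of_mem_foldl_addWord hg with h | h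
    · exact (hW g h).le.trans (Nat.mul_le_mul_right _ hℓn)
    · simp at h
  have hGlen : (greedyCode b blocks ℓ).length ≤ M := by
    refine (length_foldl_addWord_le _ _ _ _).trans ?_
    rw [length_wordsOf_eq]
    simpa using hM
  have hused : (usedBits rows).length = N := length_usedBits hN hrows
  have hC : ∀ c ∈ wordList b blocks rows, c.length ≤ n * β :=
    length_le_of_mem_assignWords hG
  have hClen : (wordList b blocks rows).length = N := by
    rw [wordList, length_assignWords, hused]
  have hwords : ∀ m ≤ ℓ, (encodeWords (wordsOf blocks m)).length ≤ M * (n * β + 1) := by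
    intro m hm
    rw [length_encodeWords (length_wordsOf hblocks m), length_wordsOf_eq]
    exact Nat.mul_le_mul ((Nat.pow_le_pow_right hpos hm).trans hM)
      (Nat.succ_le_succ (Nat.mul_le_mul_right _ (hm.trans hℓn)))
  have e₁ := (exec_makeWords blocks (s := readState rows o) (m := rows.length) (B := β)
    (L := M * (n * β + 1)) (fun c hc => (hblocks c hc).le) (by simp [readState])
    (by simp [readState]) (by simp [readState]) (by simp [readState]) (by simp [readState])
    (by simp [readState]) hwords).congr (s₂ := Function.update (Function.update (Function.update
      (Function.update (Function.update (fun _ => [])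
      Reg.inp (encodeWords rows)) Reg.used ((usedBits rows).map Γ'.bit)) Reg.out o)
      Reg.len (List.replicate ℓ (Γ'.bit true))) Reg.words (encodeWords (wordsOf blocks ℓ))) (by
        funext k
        cases k <;> simp [readState, hℓ]) (T₂ := _) le_rfl
  have e₂ := (exec_selectCode b (s := Function.update (Function.update (Function.update
      (Function.update (Function.update (fun _ => [])
      Reg.inp (encodeWords rows)) Reg.used ((usedBits rows).map Γ'.bit)) Reg.out o)
      Reg.len (List.replicate ℓ (Γ'.bit true))) Reg.words (encodeWords (wordsOf blocks ℓ)))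
      (n := ℓ) (L := ℓ * β) (M := M) hW (by rw [length_wordsOf_eq]; exact hM)
      (by simp) (by simp) (by simp) (by simp) (by simp) (by simp) (by simp) (by simp)
      (by simp)).congr (s₂ := Function.update (Function.update (Function.update
      (Function.update (Function.update (fun _ => [])
      Reg.inp (encodeWords rows)) Reg.used ((usedBits rows).map Γ'.bit)) Reg.out o)
      Reg.len (List.replicate ℓ (Γ'.bit true))) Reg.code
        (encodeWords (greedyCode b blocks ℓ))) (by
        funext k
        cases k <;> simp [greedyCode]) (T₂ := _) le_rfl
  have e₃ := (exec_assignCode (s := Function.update (Function.update (Function.update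
      (Function.update (Function.update (fun _ => [])
      Reg.inp (encodeWords rows)) Reg.used ((usedBits rows).map Γ'.bit)) Reg.out o)
      Reg.len (List.replicate ℓ (Γ'.bit true))) Reg.code
        (encodeWords (greedyCode b blocks ℓ))) (u := usedBits rows)
      (G := greedyCode b blocks ℓ) hG
      (by simp) (by simp) (by simp) (by simp)).congr (s₂ := Function.update (Function.update
      (Function.update (Function.update (Function.update (fun _ => [])
      Reg.inp (encodeWords rows)) Reg.out o) Reg.len (List.replicate ℓ (Γ'.bit true)))
      Reg.words (encodeWords (wordList b blocks rows))) Reg.code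
        (encodeWords ((greedyCode b blocks ℓ).drop ((usedBits rows).count true)))) (by
        funext k
        cases k <;> simp [wordList, hℓ]) (T₂ := _) le_rfl
  have e₄ := (exec_writeRows (s := Function.update (Function.update
      (Function.update (Function.update (Function.update (fun _ => [])
      Reg.inp (encodeWords rows)) Reg.out o) Reg.len (List.replicate ℓ (Γ'.bit true)))
      Reg.words (encodeWords (wordList b blocks rows))) Reg.code
        (encodeWords ((greedyCode b blocks ℓ).drop ((usedBits rows).count true))))
      (rows := rows) (C := wordList b blocks rows) hC (fun v hv => (hN v hv).trans hClen.symm)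
      (by simp) (by simp) (by simp) (by simp) (by simp)).congr (s₂ := Function.update
      (Function.update (Function.update (Function.update (fun _ => [])
      Reg.out ((encodeWords (outRows b blocks rows)).reverse ++ o))
      Reg.len (List.replicate ℓ (Γ'.bit true)))
      Reg.words (encodeWords (wordList b blocks rows))) Reg.code
        (encodeWords ((greedyCode b blocks ℓ).drop ((usedBits rows).count true)))) (by
        funext k
        cases k <;> simp [outRows]) (T₂ := _) le_rfl
  have e₅ := (Exec.clearList (l := workRegs) (s := Function.update
      (Function.update (Function.update (Function.update (fun _ => [])
      Reg.out ((encodeWords (outRows b blocks rows)).reverse ++ o))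
      Reg.len (List.replicate ℓ (Γ'.bit true)))
      Reg.words (encodeWords (wordList b blocks rows))) Reg.code
        (encodeWords ((greedyCode b blocks ℓ).drop ((usedBits rows).count true))))
      -- One crude bound for all registers: at most `n` assigned words, at most `M` leftover code
      -- words, and `n` further symbols.
      (B := (n + M) * (n * β + 1) + n) (by
        intro X _
        have l₁ : (encodeWords (wordList b blocks rows)).length ≤ n * (n * β + 1) :=
          (length_encodeWords_le hC).trans (Nat.mul_le_mul_right _ (by omega))
        have l₂ : (encodeWords ((greedyCode b blocks ℓ).drop
            ((usedBits rows).count true))).length ≤ M * (n * β + 1) := by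
          refine (length_encodeWords_le fun g hg => hG g (List.mem_of_mem_drop hg)).trans
            (Nat.mul_le_mul_right _ ?_)
          rw [List.length_drop]
          omega
        have l₃ : (encodeWords (outRows b blocks rows)).length ≤ n * (n * β + 1) := by
          refine (length_encodeWords_le (n := n * β) ?_).trans (Nat.mul_le_mul_right _ ?_)
          · intro g hg
            obtain ⟨v, -, rfl⟩ := List.mem_map.1 hg
            exact length_selectOr_le hC (by simp)
          · simpa [outRows] using hn
        rw [Nat.add_mul]
        cases X <;> simp <;> omega)).congr
      (s₂ := Function.update (fun _ => [])
      Reg.out ((encodeWords (outRows b blocks rows)).reverse ++ o)) (by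
        funext k
        cases k <;> simp [workRegs]) (T₂ := _) le_rfl
  have e₆ := (Exec.moveAll (X := Reg.out) (Y := Reg.fin) (by decide)
    (s := Function.update (fun _ => [])
      Reg.out ((encodeWords (outRows b blocks rows)).reverse ++ o))
    (w := (encodeWords (outRows b blocks rows)).reverse ++ o) (by simp)).congr
    (s₂ := Function.update (fun _ => []) Reg.fin (o.reverse ++ encodeWords (outRows b blocks rows)))
    (by
      funext k
      cases k <;> simp) (T₂ := _) le_rfl
  refine (e₁.seq (e₂.seq (e₃.seq (e₄.seq (e₅.seq e₆))))).mono ?_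
  have l₃ : (encodeWords (outRows b blocks rows)).length ≤ n * (n * β + 1) := by
    refine (length_encodeWords_le (n := n * β) ?_).trans (Nat.mul_le_mul_right _ ?_)
    · intro g hg
      obtain ⟨v, -, rfl⟩ := List.mem_map.1 hg
      exact length_selectOr_le hC (by simp)
    · simpa [outRows] using hn
  have l₄ : ((encodeWords (outRows b blocks rows)).reverse ++ o).length ≤
      n * (n * β + 1) + n := by
    rw [List.length_append, List.length_reverse]
    omega
  have l₅ : workRegs.length = 14 := rfl
  have l₆ : (wordsOf blocks ℓ).length ≤ M := by rw [length_wordsOf_eq]; exact hM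
  rw [reduceTime, l₅, hused, hClen]
  gcongr

/-- Clears all registers and outputs a fixed string. -/
def outputConst (w : List Γ') : RegProg :=
  clearList (Reg.out :: workRegs);; pushList Reg.fin w.reverse

theorem exec_outputConst {s : Reg → List Γ'} {B : ℕ} (w : List Γ') (h : ∀ X, (s X).length ≤ B)
    (h' : s Reg.fin = []) :
    Exec (outputConst w) s (Function.update (fun _ => []) Reg.fin w)
      (15 * (2 * B + 1) + 1 + (w.length + 1)) := by
  refine ((Exec.clearList (B := B) fun X _ => h X).seq (Exec.pushList _ _)).congr ?_ ?_
  · funext k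
    cases k <;> simp [workRegs, h']
  · simp [workRegs]

/-- The program of the reduction. Inputs with fewer than `B` symbols are answered from a table,
others on fewer than `N₀` elements by the string `y`. -/
def reductionProg (b : ℕ) (blocks : List (List Bool)) (table : List Γ' → List Γ') (y : List Γ')
    (B N₀ : ℕ) : RegProg :=
  moveAll Reg.aux Reg.inp;;
    readShort Reg.inp Reg.aux (fun w => outputConst (table w))
      -- The bits before the first comma encode `k` and are copied unchanged. Afterwards `used` has
      -- one symbol per element of the universe, so reading it tests the size of the universe
      -- against `N₀`.
      (moveWhile isBit Reg.inp Reg.out;; readRows;;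
        readShort Reg.used Reg.aux (fun _ => outputConst y) (reduceRows b blocks) N₀ []) B []

theorem exec_reductionProg_table {b : ℕ} {blocks : List (List Bool)} {table : List Γ' → List Γ'}
    {y : List Γ'} {B N₀ : ℕ} {w : List Γ'} (hw : w.length < B) :
    Exec (reductionProg b blocks table y B N₀) (Function.update (fun _ => []) Reg.aux w.reverse)
      (Function.update (fun _ => []) Reg.fin (table w))
      (3 * w.length + 1 + (3 * B + (15 * (2 * B + 1) + 1 + ((table w).length + 1)))) := by
  refine ((Exec.moveAll (by decide) (w := w.reverse) (by simp)).seq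
    (Exec.readShort_of_lt (l := w) (by decide) ?_ hw (exec_outputConst (B := B)
      (table w) ?_ ?_))).mono ?_
  · simp
  · intro X
    cases X <;> simp; omega
  · simp
  · simp

theorem exec_reductionProg_prefix {b : ℕ} {blocks : List (List Bool)}
    {table : List Γ' → List Γ'} {y : List Γ'} {B N₀ T : ℕ} {kb : List Bool}
    {rows : List (List Bool)} {s' : Reg → List Γ'}
    (hw : B ≤ (kb.map Γ'.bit ++ encodeWords rows).length)
    (h : Exec (readShort Reg.used Reg.aux (fun _ => outputConst y) (reduceRows b blocks) N₀ [])
      (readState rows (kb.map Γ'.bit).reverse) s' T) :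
    Exec (reductionProg b blocks table y B N₀)
      (Function.update (fun _ => []) Reg.aux (kb.map Γ'.bit ++ encodeWords rows).reverse) s'
      (3 * (kb.map Γ'.bit ++ encodeWords rows).length + 1 + (6 * B + 1 +
        (3 * kb.length + 1 + (15 * (encodeWords rows).length + 2 + T)))) := by
  set w := kb.map Γ'.bit ++ encodeWords rows with hw'
  have e₁ := (Exec.moveAll (X := Reg.aux) (Y := Reg.inp) (by decide) (w := w.reverse)
    (s := Function.update (fun _ => []) Reg.aux w.reverse) (by simp)).congr
    (s₂ := Function.update (fun _ => []) Reg.inp w) (by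
      funext k
      cases k <;> simp) (T₂ := 3 * w.length + 1) (by simp)
  have e₂ := (Exec.moveWhile (p := isBit) (X := Reg.inp) (Y := Reg.out) (by decide)
    (s := Function.update (fun _ => []) Reg.inp w) (w := kb.map Γ'.bit) (l := encodeWords rows)
    (by simp [hw']) isBit_of_mem (head_encodeWords rows)).congr
    (s₂ := Function.update (Function.update (fun _ => []) Reg.inp (encodeWords rows))
      Reg.out (kb.map Γ'.bit).reverse) (by
      funext k
      cases k <;> simp) (T₂ := 3 * kb.length + 1) (by simp)
  have e₃ := (exec_readRows (s := Function.update (Function.update (fun _ => [])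
      Reg.inp (encodeWords rows)) Reg.out (kb.map Γ'.bit).reverse) (rows := rows) (by simp)
      (by simp) (by simp) (by simp) (by simp)).congr
      (s₂ := readState rows (kb.map Γ'.bit).reverse) (by
      funext k
      cases k <;> simp [readState]) le_rfl
  refine e₁.seq ((Exec.readShort_of_le (l := w) (l' := []) (by decide) (by simp) (by simp) hw
    ((e₂.seq (e₃.seq h)).start ?_)).mono (by simp))
  funext k
  cases k <;> simp

/-- A bound for the running time of `reductionProg`. -/
def reductionTime (b Q β M B N₀ D n : ℕ) : ℕ :=
  3 * n + 1 + (6 * B + 1 + (3 * n + 1 + (15 * n + 2 +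
    (6 * N₀ + 1 + reduceTime b Q β M n + 15 * (2 * (n + N₀ + B) + 1) + D + 2))))

theorem exec_reductionProg_const {b : ℕ} {blocks : List (List Bool)} {β M : ℕ}
    {table : List Γ' → List Γ'} {y : List Γ'} {B N₀ D : ℕ} {kb : List Bool}
    {rows : List (List Bool)} (hw : B ≤ (kb.map Γ'.bit ++ encodeWords rows).length)
    (hN : (usedBits rows).length < N₀) (hD : y.length ≤ D)
    (hrows : rows.length ≤ (encodeWords rows).length) :
    Exec (reductionProg b blocks table y B N₀)
      (Function.update (fun _ => []) Reg.aux (kb.map Γ'.bit ++ encodeWords rows).reverse)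
      (Function.update (fun _ => []) Reg.fin y)
      (reductionTime b blocks.length β M B N₀ D (kb.map Γ'.bit ++ encodeWords rows).length) := by
  refine (exec_reductionProg_prefix hw (Exec.readShort_of_lt (l := (usedBits rows).map Γ'.bit)
    (by decide) (by simp [readState]) (by simpa using hN) (exec_outputConst
      (B := (kb.map Γ'.bit ++ encodeWords rows).length + N₀) y ?_ (by simp [readState])))).mono ?_
  · intro X
    cases X <;> simp [readState] <;> omega
  · simp only [reductionTime, List.length_append, List.length_map]
    omega

theorem exec_reductionProg {b : ℕ} {blocks : List (List Bool)} {β M N : ℕ}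
    {table : List Γ' → List Γ'} {y : List Γ'} {B N₀ D : ℕ} {kb : List Bool}
    {rows : List (List Bool)} (hw : B ≤ (kb.map Γ'.bit ++ encodeWords rows).length)
    (hN₀ : N₀ ≤ N) (hblocks : ∀ c ∈ blocks, c.length = β) (hpos : 0 < blocks.length)
    (hrows : rows ≠ []) (hN : ∀ v ∈ rows, v.length = N)
    (hM : blocks.length ^ Nat.size rows.length ≤ M) :
    Exec (reductionProg b blocks table y B N₀)
      (Function.update (fun _ => []) Reg.aux (kb.map Γ'.bit ++ encodeWords rows).reverse)
      (Function.update (fun _ => []) Reg.fin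
        (kb.map Γ'.bit ++ encodeWords (outRows b blocks rows)))
      (reductionTime b blocks.length β M B N₀ D (kb.map Γ'.bit ++ encodeWords rows).length) := by
  have hlen := length_encodeWords hN
  have hlen' : 1 ≤ rows.length := List.length_pos_iff.2 hrows
  have h₁ : rows.length ≤ (encodeWords rows).length := by
    rw [hlen]; exact Nat.le_mul_of_pos_right _ (by omega)
  have h₂ : N ≤ (encodeWords rows).length := by
    rw [hlen]; exact (Nat.le_succ N).trans (Nat.le_mul_of_pos_left _ hlen')
  have e := exec_reduceRows (b := b) (o := (kb.map Γ'.bit).reverse)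
    (n := (kb.map Γ'.bit ++ encodeWords rows).length) hblocks hpos hrows hN
    (by rw [List.length_append]; omega) (by rw [List.length_append]; omega) (by simp) hM
  rw [List.reverse_reverse] at e
  refine (exec_reductionProg_prefix hw (Exec.readShort_of_le (l := (usedBits rows).map Γ'.bit)
    (l' := []) (by decide) (by simp [readState]) (by simp [readState])
    (by simpa [length_usedBits hN hrows] using hN₀) (e.start ?_))).mono ?_
  · funext k
    cases k <;> simp [readState]
  · simp only [reductionTime, List.length_append, List.length_map, List.length_nil]
    omega

/-! ### Points built from code words with small intersections -/

section geometry

variable {N D : ℕ}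

/-- The point with support `A`. -/
noncomputable def supportPoint (A : Finset (Fin D)) : EuclideanSpace ℝ (Fin D) :=
  boolPoint fun j => decide (j ∈ A)

theorem norm_supportPoint_sub_sq (A B : Finset (Fin D)) :
    ‖supportPoint A - supportPoint B‖ ^ 2 = ((A \ B).card : ℝ) + ((B \ A).card : ℝ) := by
  rw [EuclideanSpace.norm_sq_eq, Finset.card_eq_sum_ones, Finset.card_eq_sum_ones]
  push_cast
  rw [← Finset.sum_filter_add_sum_filter_not Finset.univ (fun j => j ∈ A \ B),
    ← Finset.sum_filter_add_sum_filter_not (Finset.univ.filter fun j => ¬ j ∈ A \ B)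
      (fun j => j ∈ B \ A)]
  have h₁ : Finset.univ.filter (fun j => j ∈ A \ B) = A \ B := by ext; simp
  have h₂ : (Finset.univ.filter fun j => ¬ j ∈ A \ B).filter (fun j => j ∈ B \ A) = B \ A := by
    ext j; simp; tauto
  rw [h₁, h₂, ← add_assoc]
  have h₃ : ∀ j ∈ A \ B, ‖(supportPoint A - supportPoint B) j‖ ^ 2 = 1 := by
    intro j hj
    rw [Finset.mem_sdiff] at hj
    simp [supportPoint, boolPoint, hj.1, hj.2]
  have h₄ : ∀ j ∈ B \ A, ‖(supportPoint A - supportPoint B) j‖ ^ 2 = 1 := by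
    intro j hj
    rw [Finset.mem_sdiff] at hj
    simp [supportPoint, boolPoint, hj.1, hj.2]
  rw [Finset.sum_congr rfl h₃, Finset.sum_congr rfl h₄]
  convert add_zero _
  refine Finset.sum_eq_zero fun j hj => ?_
  simp only [Finset.mem_filter, Finset.mem_sdiff, Finset.mem_univ, true_and] at hj
  by_cases hA : j ∈ A
  · have hB : j ∈ B := by tauto
    simp [supportPoint, boolPoint, hA, hB]
  · have hB : j ∉ B := by tauto
    simp [supportPoint, boolPoint, hA, hB]

theorem norm_supportPoint_sub_sq' (A B : Finset (Fin D)) :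
    ‖supportPoint A - supportPoint B‖ ^ 2 =
      (A.card : ℝ) + (B.card : ℝ) - 2 * ((A ∩ B).card : ℝ) := by
  rw [norm_supportPoint_sub_sq]
  have h₁ : ((A \ B).card : ℝ) + ((A ∩ B).card : ℝ) = A.card := by
    exact_mod_cast Finset.card_sdiff_add_card_inter A B
  have h₂ : ((B \ A).card : ℝ) + ((A ∩ B).card : ℝ) = B.card := by
    rw [Finset.inter_comm]
    exact_mod_cast Finset.card_sdiff_add_card_inter B A
  linarith

/-- Code words for the elements of `X`: subsets of size `n`, any two of which meet in at most
`n / b` elements. -/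
structure IsCode (φ : Fin N → Finset (Fin D)) (X : Finset (Fin N)) (n b : ℕ) : Prop where
  card_eq : ∀ u ∈ X, (φ u).card = n
  card_inter : ∀ u ∈ X, ∀ v ∈ X, u ≠ v → b * (φ u ∩ φ v).card ≤ n

variable {φ : Fin N → Finset (Fin D)} {X : Finset (Fin N)} {n b : ℕ}

/-- A word added to `T` overlaps the union so far in at most `|T| n / b` positions; over all
additions the loss is at most `n |T|² / b`. -/
theorem IsCode.le_card_biUnion (h : IsCode φ X n b) {T : Finset (Fin N)} (hT : T ⊆ X) :
    b * n * T.card ≤ b * (T.biUnion φ).card + n * T.card ^ 2 := by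
  induction T using Finset.induction_on with
  | empty => simp
  | insert a T ha ih =>
    have ih := ih ((Finset.subset_insert a T).trans hT)
    rw [Finset.biUnion_insert, Finset.card_insert_of_notMem ha]
    have haX : a ∈ X := hT (Finset.mem_insert_self a T)
    have h₁ := Finset.card_union_add_card_inter (φ a) (T.biUnion φ)
    rw [h.card_eq a haX] at h₁
    have h₂ : b * (φ a ∩ T.biUnion φ).card ≤ T.card * n := by
      rw [Finset.inter_biUnion]
      calc b * (T.biUnion fun u => φ a ∩ φ u).card
          ≤ b * ∑ u ∈ T, (φ a ∩ φ u).card := Nat.mul_le_mul_left _ Finset.card_biUnion_le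
        _ = ∑ u ∈ T, b * (φ a ∩ φ u).card := Finset.mul_sum _ _ _
        _ ≤ ∑ u ∈ T, n := Finset.sum_le_sum fun u hu => h.card_inter a haX u
            (hT (Finset.mem_insert_of_mem hu)) (by rintro rfl; exact ha hu)
        _ = T.card * n := by simp
    have h₃ : b * (φ a ∪ T.biUnion φ).card + b * (φ a ∩ T.biUnion φ).card =
        b * n + b * (T.biUnion φ).card := by
      rw [← Nat.mul_add, h₁, Nat.mul_add]
    nlinarith [h₂, h₃, ih, Nat.zero_le n, Nat.zero_le T.card]

/-- The intersection is covered by the sets `φ u ∩ φ v` with `u ∈ T`, `v ∈ T'`: a common element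
contributes a full word, every other pair at most `n / b`. -/
theorem IsCode.card_inter_biUnion_le (h : IsCode φ X n b) {T T' : Finset (Fin N)} (hT : T ⊆ X)
    (hT' : T' ⊆ X) :
    b * (T.biUnion φ ∩ T'.biUnion φ).card ≤ b * n * (T ∩ T').card + n * (T.card * T'.card) := by
  have h₁ : T.biUnion φ ∩ T'.biUnion φ ⊆ (T ×ˢ T').biUnion fun p => φ p.1 ∩ φ p.2 := by
    intro j hj
    simp only [Finset.mem_inter, Finset.mem_biUnion, Finset.mem_product] at hj ⊢
    obtain ⟨⟨u, hu, hju⟩, v, hv, hjv⟩ := hj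
    exact ⟨(u, v), ⟨hu, hv⟩, hju, hjv⟩
  have h₂ : ∀ p ∈ T ×ˢ T', b * (φ p.1 ∩ φ p.2).card ≤ (if p.1 = p.2 then b * n else 0) + n := by
    intro p hp
    rw [Finset.mem_product] at hp
    split_ifs with hpp
    · rw [hpp, Finset.inter_self, h.card_eq _ (hT' hp.2)]
      exact Nat.le_add_right _ _
    · simpa using h.card_inter _ (hT hp.1) _ (hT' hp.2) hpp
  calc b * (T.biUnion φ ∩ T'.biUnion φ).card
      ≤ b * ∑ p ∈ T ×ˢ T', (φ p.1 ∩ φ p.2).card :=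
        Nat.mul_le_mul_left _ ((Finset.card_le_card h₁).trans Finset.card_biUnion_le)
    _ = ∑ p ∈ T ×ˢ T', b * (φ p.1 ∩ φ p.2).card := Finset.mul_sum _ _ _
    _ ≤ ∑ p ∈ T ×ˢ T', ((if p.1 = p.2 then b * n else 0) + n) := Finset.sum_le_sum h₂
    _ = b * n * (T ∩ T').card + n * (T.card * T'.card) := by
      rw [Finset.sum_add_distrib, ← Finset.sum_filter, Finset.sum_const, Finset.sum_const,
        Finset.card_product, smul_eq_mul, smul_eq_mul]
      have : ((T ×ˢ T').filter fun p => p.1 = p.2).card = (T ∩ T').card := by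
        refine Finset.card_bij (fun p _ => p.1) ?_ ?_ ?_
        · intro p hp
          simp only [Finset.mem_filter, Finset.mem_product] at hp
          exact Finset.mem_inter.2 ⟨hp.1.1, hp.2 ▸ hp.1.2⟩
        · intro p hp q hq hpq
          simp only [Finset.mem_filter, Finset.mem_product] at hp hq
          exact Prod.ext hpq (hp.2.symm.trans (hpq.trans hq.2))
        · intro u hu
          rw [Finset.mem_inter] at hu
          exact ⟨(u, u), by simp [hu.1, hu.2], rfl⟩
      rw [this]
      ring

/-- The sizes of the two unions lose at most `n z² / b` each, and twice the size of their
intersection gains at most `2n z² / b`; together this is the error `4n z² / b`. -/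
theorem IsCode.le_dist_sq (h : IsCode φ X n b) (hb : 0 < b) {z : ℕ} {T T' : Finset (Fin N)}
    (hT : T ⊆ X) (hT' : T' ⊆ X) (hz : T.card = z) (hz' : T'.card = z) :
    2 * (n : ℝ) * (z - (T ∩ T').card - 2 * z ^ 2 / b) ≤
      ‖supportPoint (T.biUnion φ) - supportPoint (T'.biUnion φ)‖ ^ 2 := by
  have h₁ := h.le_card_biUnion hT
  have h₂ := h.le_card_biUnion hT'
  have h₃ := h.card_inter_biUnion_le hT hT'
  rw [hz] at h₁ h₃
  rw [hz'] at h₂ h₃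
  have h₁' : (b : ℝ) * n * z ≤ b * (T.biUnion φ).card + n * z ^ 2 := by exact_mod_cast h₁
  have h₂' : (b : ℝ) * n * z ≤ b * (T'.biUnion φ).card + n * z ^ 2 := by exact_mod_cast h₂
  have h₃' : (b : ℝ) * (T.biUnion φ ∩ T'.biUnion φ).card ≤
    b * n * (T ∩ T').card + n * (z * z) := by exact_mod_cast h₃
  rw [norm_supportPoint_sub_sq']
  have hb' : (0 : ℝ) < b := by exact_mod_cast hb
  refine le_of_mul_le_mul_left ?_ hb'
  have e : (b : ℝ) * (2 * (n : ℝ) * (z - (T ∩ T').card - 2 * z ^ 2 / b)) =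
      2 * b * n * z - 2 * b * n * (T ∩ T').card - 4 * n * z ^ 2 := by
    field_simp
    ring
  rw [e]
  nlinarith

/-- The support for `S` lies inside that for `T`, and the difference is covered by the `z - y` words
of `T \ S`. -/
theorem IsCode.dist_sq_le (h : IsCode φ X n b) {z y : ℕ} {S T : Finset (Fin N)} (hT : T ⊆ X)
    (hST : S ⊆ T) (hz : T.card = z) (hy : S.card = y) :
    ‖supportPoint (T.biUnion φ) - supportPoint (S.biUnion φ)‖ ^ 2 ≤ ((z : ℝ) - y) * n := by
  rw [norm_supportPoint_sub_sq]
  have h₁ : S.biUnion φ \ T.biUnion φ = ∅ :=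
    Finset.sdiff_eq_empty_iff_subset.2 (Finset.biUnion_subset_biUnion_of_subset_left φ hST)
  have h₂ : T.biUnion φ \ S.biUnion φ ⊆ (T \ S).biUnion φ := by
    intro j hj
    simp only [Finset.mem_sdiff, Finset.mem_biUnion] at hj ⊢
    obtain ⟨⟨u, hu, hj⟩, hn⟩ := hj
    exact ⟨u, ⟨hu, fun hS => hn ⟨u, hS, hj⟩⟩, hj⟩
  have h₃ : (T.biUnion φ \ S.biUnion φ).card ≤ (z - y) * n := by
    refine (Finset.card_le_card h₂).trans (Finset.card_biUnion_le.trans ?_)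
    rw [Finset.sum_congr rfl fun u hu => h.card_eq u (hT (Finset.sdiff_subset hu))]
    rw [Finset.sum_const, smul_eq_mul, Finset.card_sdiff_of_subset hST, hz, hy]
  have hyz : y ≤ z := hz ▸ hy ▸ Finset.card_le_card hST
  rw [h₁, Finset.card_empty, Nat.cast_zero, add_zero, ← Nat.cast_sub hyz]
  exact_mod_cast h₃

end geometry

/-! ### Clusters -/

/-- The right side exceeds the left by `2‖∑ (x i - c)‖²`. It bounds the cost of a cluster from below
for an arbitrary center. -/
theorem sum_sum_norm_sub_sq_le {ι V : Type*} [NormedAddCommGroup V] [InnerProductSpace ℝ V]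
    (s : Finset ι) (x : ι → V) (c : V) :
    ∑ i ∈ s, ∑ j ∈ s, ‖x i - x j‖ ^ 2 ≤ 2 * (s.card : ℝ) * ∑ i ∈ s, ‖x i - c‖ ^ 2 := by
  have h : ∀ i j, ‖x i - x j‖ ^ 2 =
      ‖x i - c‖ ^ 2 + ‖x j - c‖ ^ 2 - 2 * inner ℝ (x i - c) (x j - c) := by
    intro i j
    have : x i - x j = (x i - c) - (x j - c) := by abel
    rw [this, norm_sub_sq_real]
    ring
  have h' : ∑ i ∈ s, ∑ j ∈ s, inner ℝ (x i - c) (x j - c) =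
      ‖∑ i ∈ s, (x i - c)‖ ^ 2 := by
    rw [← real_inner_self_eq_norm_sq, sum_inner]
    simp_rw [inner_sum]
  simp_rw [h, Finset.sum_sub_distrib, Finset.sum_add_distrib, ← Finset.mul_sum]
  rw [h']
  simp only [Finset.sum_const, nsmul_eq_mul, ← Finset.mul_sum]
  nlinarith [sq_nonneg ‖∑ i ∈ s, (x i - c)‖]

section clusters

variable {N : ℕ}

/-- A set `T ⊇ R` is determined by `T \ R`, which has `z - m` elements. -/
theorem card_filter_superset_le {z m : ℕ} (C : Finset (Finset (Fin N)))
    (hC : ∀ T ∈ C, T.card = z) (R : Finset (Fin N)) (hR : R.card = m) :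
    (C.filter fun T => R ⊆ T).card ≤ N ^ (z - m) := by
  have h : (C.filter fun T => R ⊆ T).card ≤
      ((Finset.univ : Finset (Fin N)).powersetCard (z - m)).card := by
    refine Finset.card_le_card_of_injOn (fun T => T \ R) ?_ ?_
    · intro T hT
      have hT := Finset.mem_filter.1 (Finset.mem_coe.1 hT)
      refine Finset.mem_coe.2 (Finset.mem_powersetCard.2 ⟨Finset.subset_univ _, ?_⟩)
      rw [Finset.card_sdiff_of_subset hT.2, hC T hT.1, hR]
    · intro T hT T' hT' hTT'
      have hT := Finset.mem_filter.1 (Finset.mem_coe.1 hT)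
      have hT' := Finset.mem_filter.1 (Finset.mem_coe.1 hT')
      rw [← Finset.sdiff_union_of_subset hT.2, ← Finset.sdiff_union_of_subset hT'.2]
      exact congrArg (· ∪ R) hTT'
  refine h.trans ?_
  rw [Finset.card_powersetCard, Finset.card_univ, Fintype.card_fin]
  exact Nat.choose_le_pow N (z - m)

/-- In a family of sets of size `z`, some set of size `y` is contained in so many members that the
sum of the sizes of all pairwise intersections is as small as stated. -/
theorem exists_sum_card_inter_le {z y h : ℕ} (hy : 1 ≤ y) (hyN : y ≤ N) (hh : 0 < h)
    (C : Finset (Finset (Fin N))) (hC : ∀ T ∈ C, T.card = z) :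
    ∃ S : Finset (Fin N), S.card = y ∧
      (∑ T ∈ C, ∑ T' ∈ C, ((T ∩ T').card : ℝ)) ≤
        C.card * ((y - 1 + z / h) * C.card + ((C.filter fun T => S ⊆ T).card : ℝ) +
          z * 2 ^ (h * z) * (N : ℝ) ^ (z - y - 1)) := by
  obtain ⟨S₀, -, hS₀⟩ := Finset.exists_subset_card_eq
    (s := (Finset.univ : Finset (Fin N))) (n := y) (by simpa using hyN)
  -- The set `S` is a `y`-set contained in the largest number of members of `C`.
  obtain ⟨S, hS, hmax⟩ := Finset.exists_max_image
    ((Finset.univ : Finset (Fin N)).powersetCard y) (fun S => (C.filter fun T => S ⊆ T).card)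
    ⟨S₀, Finset.mem_powersetCard.2 ⟨Finset.subset_univ _, hS₀⟩⟩
  refine ⟨S, (Finset.mem_powersetCard.1 hS).2, ?_⟩
  set a := (C.filter fun T => S ⊆ T).card with ha
  have hmax' : ∀ R : Finset (Fin N), R.card = y → (C.filter fun T => R ⊆ T).card ≤ a :=
    fun R hR => hmax R (Finset.mem_powersetCard.2 ⟨Finset.subset_univ _, hR⟩)
  set s := C.card with hs
  let deg : Fin N → ℕ := fun u => (C.filter fun T => u ∈ T).card
  have hdeg : ∀ X : Finset (Fin N), ∑ u ∈ X, deg u = ∑ T ∈ C, (T ∩ X).card := by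
    intro X
    simp only [deg, Finset.card_filter]
    rw [Finset.sum_comm]
    refine Finset.sum_congr rfl fun T _ => ?_
    rw [Finset.inter_comm, ← Finset.filter_mem_eq_inter, Finset.card_filter]
  -- Double counting: an element of `X` is counted once for each ordered pair of members containing
  -- it. This allows heavy and light elements to be treated separately.
  have hdeg₂ : ∀ X : Finset (Fin N),
      ∑ T ∈ C, ∑ T' ∈ C, (T ∩ T' ∩ X).card = ∑ u ∈ X, deg u * deg u := by
    intro X
    have : ∀ T ∈ C, ∑ T' ∈ C, (T ∩ T' ∩ X).card = ∑ u ∈ T ∩ X, deg u := by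
      intro T _
      rw [hdeg]
      refine Finset.sum_congr rfl fun T' _ => ?_
      congr 1
      ext; simp; tauto
    rw [Finset.sum_congr rfl this]
    simp_rw [Finset.inter_comm _ X, ← Finset.filter_mem_eq_inter, Finset.sum_filter]
    rw [Finset.sum_comm]
    refine Finset.sum_congr rfl fun u _ => ?_
    rw [← Finset.sum_filter, Finset.sum_const, smul_eq_mul]
  -- The heavy elements lie in at least a `1/h` fraction of the members; the degrees sum to `z s`,
  -- so there are at most `h z` of them.
  let H : Finset (Fin N) := Finset.univ.filter fun u => s ≤ h * deg u
  have htot : ∑ u, deg u = z * s := by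
    rw [hdeg, Finset.sum_congr rfl fun T hT => by rw [Finset.inter_univ, hC T hT]]
    rw [Finset.sum_const, smul_eq_mul, mul_comm]
  rcases Nat.eq_zero_or_pos s with hs0 | hspos
  · have : C = ∅ := Finset.card_eq_zero.1 hs0
    simp [this, hs]
  have hH : H.card ≤ h * z := by
    have : H.card * s ≤ h * z * s := by
      calc H.card * s = ∑ u ∈ H, s := by simp
        _ ≤ ∑ u ∈ H, h * deg u := Finset.sum_le_sum fun u hu => (Finset.mem_filter.1 hu).2
        _ ≤ ∑ u, h * deg u := Finset.sum_le_sum_of_subset (Finset.subset_univ _)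
        _ = h * z * s := by rw [← Finset.mul_sum, htot, mul_assoc]
    exact Nat.le_of_mul_le_mul_right this hspos
  have hlight : h * ∑ u ∈ Hᶜ, deg u * deg u ≤ z * s * s := by
    rw [Finset.mul_sum]
    calc ∑ u ∈ Hᶜ, h * (deg u * deg u) ≤ ∑ u ∈ Hᶜ, s * deg u := by
          refine Finset.sum_le_sum fun u hu => ?_
          have hu' : ¬ s ≤ h * deg u := fun hc =>
            (Finset.mem_compl.1 hu) (Finset.mem_filter.2 ⟨Finset.mem_univ _, hc⟩)
          rw [← mul_assoc]
          exact Nat.mul_le_mul_right _ (not_le.1 hu').le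
      _ ≤ ∑ u, s * deg u := Finset.sum_le_sum_of_subset (Finset.subset_univ _)
      _ = z * s * s := by rw [← Finset.mul_sum, htot]; ring
  -- A bad member contains one of the at most `2 ^ (h * z)` sets of `y + 1` heavy elements, and each
  -- of these lies in at most `N ^ (z - y - 1)` members.
  let bad : Finset (Finset (Fin N)) := C.filter fun T => y + 1 ≤ (T ∩ H).card
  have hbad : bad.card ≤ 2 ^ (h * z) * N ^ (z - y - 1) := by
    have hsub : bad ⊆ (H.powersetCard (y + 1)).biUnion fun R => C.filter fun T => R ⊆ T := by
      intro T hT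
      have hT := Finset.mem_filter.1 hT
      obtain ⟨R, hR, hRc⟩ := Finset.exists_subset_card_eq hT.2
      refine Finset.mem_biUnion.2 ⟨R, Finset.mem_powersetCard.2
        ⟨hR.trans Finset.inter_subset_right, hRc⟩, Finset.mem_filter.2
        ⟨hT.1, hR.trans Finset.inter_subset_left⟩⟩
    calc bad.card ≤ ∑ R ∈ H.powersetCard (y + 1), (C.filter fun T => R ⊆ T).card :=
          (Finset.card_le_card hsub).trans Finset.card_biUnion_le
      _ ≤ ∑ R ∈ H.powersetCard (y + 1), N ^ (z - y - 1) := by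
          refine Finset.sum_le_sum fun R hR => ?_
          rw [Nat.sub_sub]
          exact card_filter_superset_le C hC R (Finset.mem_powersetCard.1 hR).2
      _ = (H.powersetCard (y + 1)).card * N ^ (z - y - 1) := by simp
      _ ≤ 2 ^ (h * z) * N ^ (z - y - 1) := by
          refine Nat.mul_le_mul_right _ ?_
          refine (Finset.card_le_card fun R hR =>
            Finset.mem_powerset.2 (Finset.mem_powersetCard.1 hR).1).trans ?_
          rw [Finset.card_powerset]
          exact Nat.pow_le_pow_right (by norm_num) hH
  have hheavy : ∀ T ∈ C, ∑ T' ∈ C, (T ∩ T' ∩ H).card ≤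
      (y - 1) * s + a + if T ∈ bad then z * s else 0 := by
    intro T hT
    split_ifs with hTb
    · refine le_trans ?_ (Nat.le_add_left _ _)
      calc ∑ T' ∈ C, (T ∩ T' ∩ H).card ≤ ∑ T' ∈ C, z := by
            refine Finset.sum_le_sum fun T' _ => ?_
            rw [← hC T hT]
            exact Finset.card_le_card (Finset.inter_subset_left.trans Finset.inter_subset_left)
        _ = z * s := by simp [hs, mul_comm]
    · have hTy : (T ∩ H).card ≤ y := by
        by_contra hc
        exact hTb (Finset.mem_filter.2 ⟨hT, not_le.1 hc⟩)
      have hle : ∀ T', (T ∩ T' ∩ H).card ≤ (T ∩ H).card := fun T' =>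
        Finset.card_le_card fun u => by simp; tauto
      rw [add_zero]
      -- With fewer than `y` heavy elements, at most `y - 1` are shared with any `T'`. With exactly
      -- `y`, all are shared only if `T ∩ H ⊆ T'`, which maximality of `S` allows for at most `a`
      -- sets.
      rcases Nat.lt_or_ge (T ∩ H).card y with hlt | hge
      · refine le_trans ?_ (Nat.le_add_right _ _)
        calc ∑ T' ∈ C, (T ∩ T' ∩ H).card ≤ ∑ T' ∈ C, (y - 1) :=
              Finset.sum_le_sum fun T' _ => (hle T').trans (by omega)
          _ = (y - 1) * s := by simp [hs, mul_comm]
      · have heq : (T ∩ H).card = y := le_antisymm hTy hge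
        calc ∑ T' ∈ C, (T ∩ T' ∩ H).card
            ≤ ∑ T' ∈ C, ((y - 1) + if T ∩ H ⊆ T' then 1 else 0) := by
              refine Finset.sum_le_sum fun T' _ => ?_
              split_ifs with hsub
              · have := hle T'; omega
              · have : T ∩ T' ∩ H ⊂ T ∩ H := by
                  refine Finset.ssubset_iff_subset_ne.2 ⟨fun u => by simp; tauto, fun he => hsub ?_⟩
                  rw [← he]
                  intro u; simp; tauto
                have := Finset.card_lt_card this
                omega
          _ = (y - 1) * s + (C.filter fun T' => T ∩ H ⊆ T').card := by
              rw [Finset.sum_add_distrib, Finset.sum_const, smul_eq_mul, Finset.card_filter,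
                mul_comm]
          _ ≤ (y - 1) * s + a := Nat.add_le_add_left (hmax' _ heq) _
  have hheavy₂ : ∑ u ∈ H, deg u * deg u ≤
      s * ((y - 1) * s + a + z * (2 ^ (h * z) * N ^ (z - y - 1))) := by
    rw [← hdeg₂]
    refine (Finset.sum_le_sum hheavy).trans ?_
    rw [Finset.sum_add_distrib, Finset.sum_const, smul_eq_mul, ← Finset.sum_filter,
      Finset.sum_const, smul_eq_mul]
    have h₁ : (C.filter fun T => T ∈ bad).card ≤ bad.card :=
      Finset.card_le_card fun T hT => (Finset.mem_filter.1 hT).2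
    have h₂ : (C.filter fun T => T ∈ bad).card * (z * s) ≤
      2 ^ (h * z) * N ^ (z - y - 1) * (z * s) := Nat.mul_le_mul_right _ (h₁.trans hbad)
    calc C.card * ((y - 1) * s + a) + (C.filter fun T => T ∈ bad).card * (z * s)
        ≤ s * ((y - 1) * s + a) + 2 ^ (h * z) * N ^ (z - y - 1) * (z * s) :=
          Nat.add_le_add_left h₂ _
      _ = s * ((y - 1) * s + a + z * (2 ^ (h * z) * N ^ (z - y - 1))) := by ring
  have hsum : ∑ T ∈ C, ∑ T' ∈ C, (T ∩ T').card =
      ∑ u ∈ H, deg u * deg u + ∑ u ∈ Hᶜ, deg u * deg u := by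
    rw [Finset.sum_add_sum_compl, ← hdeg₂]
    simp
  have hsum' : (∑ T ∈ C, ∑ T' ∈ C, ((T ∩ T').card : ℝ)) =
      ((∑ u ∈ H, deg u * deg u : ℕ) : ℝ) + ((∑ u ∈ Hᶜ, deg u * deg u : ℕ) : ℝ) := by
    exact_mod_cast hsum
  rw [hsum']
  have r₁ : ((∑ u ∈ H, deg u * deg u : ℕ) : ℝ) ≤
      s * ((y - 1) * s + a + z * (2 ^ (h * z) * (N : ℝ) ^ (z - y - 1))) := by
    have := (Nat.cast_le (α := ℝ)).2 hheavy₂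
    push_cast [Nat.cast_sub hy] at this ⊢
    exact this
  have r₂ : ((∑ u ∈ Hᶜ, deg u * deg u : ℕ) : ℝ) ≤ s * (z / h * s) := by
    have := (Nat.cast_le (α := ℝ)).2 hlight
    have hh' : (0 : ℝ) < h := by exact_mod_cast hh
    rw [Nat.cast_mul] at this
    rw [← mul_le_mul_iff_right₀ hh']
    refine this.trans (le_of_eq ?_)
    push_cast
    field_simp
  calc _ ≤ _ := add_le_add r₁ r₂
    _ = _ := by ring

end clusters

/-! ### Completeness and soundness -/

section gap

variable {z y n b D : ℕ} (I : JohnsonInstance z) (φ : Fin I.n → Finset (Fin D))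

/-- The set of points that belongs to a choice of code words for the elements of the universe. -/
def codePoints : Finset (Fin D → Bool) :=
  I.E.image fun T j => decide (j ∈ T.biUnion φ)

variable {I φ} {X : Finset (Fin I.n)}

/-- The centers are the points of the covering `y`-sets, and each hyperedge goes to one that it
contains. -/
theorem exists_kMeansCost_le (h : IsCode φ X n b) (hE : ∀ T ∈ I.E, T ⊆ X) (hI : I.Complete y) :
    ∃ (c : Fin I.k → EuclideanSpace ℝ (Fin D)) (σ : codePoints I φ → Fin I.k),
      kMeansCost (codePoints I φ) c σ ≤ ((z : ℝ) - y) * n * (codePoints I φ).card := by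
  obtain ⟨S, hS, hcov⟩ := hI
  have hex : ∀ a : codePoints I φ, ∃ i : Fin I.k,
      ‖boolPoint (a : Fin D → Bool) - supportPoint ((S i).biUnion φ)‖ ^ 2 ≤ ((z : ℝ) - y) * n := by
    intro a
    obtain ⟨T, hT, hTa⟩ := Finset.mem_image.1 a.2
    have hT' := hT
    rw [← hcov, JohnsonInstance.coverage, Finset.mem_biUnion] at hT'
    obtain ⟨i, -, hi⟩ := hT'
    refine ⟨i, ?_⟩
    rw [← hTa]
    exact h.dist_sq_le (hE T hT) (Finset.mem_filter.1 hi).2 (I.uniform T hT) (hS i)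
  choose σ hσ using hex
  refine ⟨fun i => supportPoint ((S i).biUnion φ), σ, ?_⟩
  refine (Finset.sum_le_sum fun a _ => hσ a).trans (le_of_eq ?_)
  rw [Finset.sum_const, Finset.card_univ, Fintype.card_coe, nsmul_eq_mul]
  ring

/-- For `b > 2z²` the distance bound is positive as soon as `|T ∩ T'| ≤ z - 1`. Hence distinct
hyperedges give distinct points and the number of points is `|E|`. -/
theorem IsCode.injOn_codePoint (h : IsCode φ X n b) (hE : ∀ T ∈ I.E, T ⊆ X) (hn : 0 < n)
    (hb : 2 * z ^ 2 < b) :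
    Set.InjOn (fun (T : Finset (Fin I.n)) (j : Fin D) => decide (j ∈ T.biUnion φ)) I.E := by
  intro T hT T' hT' hTT'
  have hT := Finset.mem_coe.1 hT
  have hT' := Finset.mem_coe.1 hT'
  have heq : T.biUnion φ = T'.biUnion φ := by
    ext j
    simpa using congrFun hTT' j
  have hb₀ : (0 : ℝ) < b := by exact_mod_cast (Nat.zero_le _).trans_lt hb
  have hd := h.le_dist_sq (by omega) (hE T hT) (hE T' hT') (I.uniform T hT) (I.uniform T' hT')
  rw [heq, sub_self, norm_zero, zero_pow two_ne_zero] at hd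
  have hn' : (0 : ℝ) < n := by exact_mod_cast hn
  have h₁ : (2 : ℝ) * z ^ 2 / b < 1 := by
    rw [div_lt_one hb₀]
    exact_mod_cast hb
  have h₂ : (z : ℝ) - (T ∩ T').card - 2 * z ^ 2 / b ≤ 0 := by
    by_contra hc
    have := mul_pos hn' (not_le.1 hc)
    linarith
  have h₃ : (z : ℝ) < ((T ∩ T').card + 1 : ℕ) := by
    push_cast
    linarith
  have h₄ : z ≤ (T ∩ T').card := Nat.lt_succ_iff.1 (by exact_mod_cast h₃)
  have e₁ : T ∩ T' = T :=
    Finset.eq_of_subset_of_card_le Finset.inter_subset_left (by rw [I.uniform T hT]; exact h₄)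
  have e₂ : T ∩ T' = T' :=
    Finset.eq_of_subset_of_card_le Finset.inter_subset_right (by rw [I.uniform T' hT']; exact h₄)
  exact e₁.symm.trans e₂

/-- The bound for a single cluster, with an arbitrary center: the distance estimate turns the bound
on intersections into one on pairwise distances, and dividing by `2|C|` gives the cost. -/
theorem le_sum_norm_sub_sq (h : IsCode φ X n b) (hb : 0 < b) (hE : ∀ T ∈ I.E, T ⊆ X) {g : ℕ}
    (hg : 0 < g) (hy : 1 ≤ y) (hyN : y ≤ I.n) (C : Finset (Finset (Fin I.n))) (hC : C ⊆ I.E)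
    (c : EuclideanSpace ℝ (Fin D)) :
    ∃ S : Finset (Fin I.n), S.card = y ∧
      (n : ℝ) * (((z : ℝ) - y + 1 - 2 * z ^ 2 / b - z / g) * C.card -
        ((C.filter fun T => S ⊆ T).card : ℝ) - z * 2 ^ (g * z) * (I.n : ℝ) ^ (z - y - 1)) ≤
      ∑ T ∈ C, ‖supportPoint (T.biUnion φ) - c‖ ^ 2 := by
  obtain ⟨S, hS, hsum⟩ := exists_sum_card_inter_le hy hyN hg C fun T hT => I.uniform T (hC hT)
  refine ⟨S, hS, ?_⟩
  set a : ℝ := ((C.filter fun T => S ⊆ T).card : ℝ)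
  set W : ℝ := z * 2 ^ (g * z) * (I.n : ℝ) ^ (z - y - 1) with hW
  have hW₀ : 0 ≤ W := by positivity
  have hn₀ : (0 : ℝ) ≤ n := Nat.cast_nonneg n
  rcases Finset.eq_empty_or_nonempty C with rfl | hne
  · simp only [Finset.card_empty, Nat.cast_zero, mul_zero, Finset.sum_empty]
    refine mul_nonpos_of_nonneg_of_nonpos hn₀ ?_
    have : 0 ≤ a := Nat.cast_nonneg _
    linarith
  have hs : (0 : ℝ) < C.card := by exact_mod_cast hne.card_pos
  have h₁ := sum_sum_norm_sub_sq_le C (fun T => supportPoint (T.biUnion φ)) c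
  have h₂ : ∑ T ∈ C, ∑ T' ∈ C, 2 * (n : ℝ) * (z - (T ∩ T').card - 2 * z ^ 2 / b) ≤
      ∑ T ∈ C, ∑ T' ∈ C, ‖supportPoint (T.biUnion φ) - supportPoint (T'.biUnion φ)‖ ^ 2 :=
    Finset.sum_le_sum fun T hT => Finset.sum_le_sum fun T' hT' =>
      h.le_dist_sq hb (hE T (hC hT)) (hE T' (hC hT')) (I.uniform T (hC hT)) (I.uniform T' (hC hT'))
  have h₃ : ∑ T ∈ C, ∑ T' ∈ C, 2 * (n : ℝ) * (z - (T ∩ T').card - 2 * z ^ 2 / b) =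
      2 * n * (((z : ℝ) - 2 * z ^ 2 / b) * C.card * C.card -
        ∑ T ∈ C, ∑ T' ∈ C, ((T ∩ T').card : ℝ)) := by
    simp only [← Finset.mul_sum, Finset.sum_sub_distrib, Finset.sum_const, nsmul_eq_mul]
    ring
  have h₄ := mul_le_mul_of_nonneg_left hsum (by positivity : (0 : ℝ) ≤ 2 * n)
  refine le_of_mul_le_mul_left ?_ (by positivity : (0 : ℝ) < 2 * C.card)
  refine le_trans ?_ h₁
  refine le_trans ?_ h₂
  rw [h₃]
  refine le_trans (le_of_eq ?_) (sub_le_sub_left h₄ _ |>.trans (le_of_eq ?_)) (b := 2 * n *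
    (((z : ℝ) - 2 * z ^ 2 / b) * C.card * C.card) - 2 * n * (C.card * ((y - 1 + z / g) * C.card +
      a + W)))
  · ring
  · ring

theorem le_kMeansCost (h : IsCode φ X n b) (hE : ∀ T ∈ I.E, T ⊆ X) (hn : 0 < n)
    (hb : 2 * z ^ 2 < b) {g : ℕ} (hg : 0 < g) (hy : 1 ≤ y) (hyz : y < z) (hne : I.E.Nonempty)
    {α : ℝ} (hI : I.Sound α y) (c : Fin I.k → EuclideanSpace ℝ (Fin D))
    (σ : codePoints I φ → Fin I.k) :
    (n : ℝ) * (((z : ℝ) - y + 1 - α - 2 * z ^ 2 / b - z / g) * I.E.card -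
      I.k * (z * 2 ^ (g * z) * (I.n : ℝ) ^ (z - y - 1))) ≤ kMeansCost (codePoints I φ) c σ := by
  have hyN : y ≤ I.n := by
    obtain ⟨T, hT⟩ := hne
    have := Finset.card_le_univ T
    rw [I.uniform T hT, Fintype.card_fin] at this
    omega
  set pt : Finset (Fin I.n) → Fin D → Bool := fun T j => decide (j ∈ T.biUnion φ) with hpt
  have hmem : ∀ T ∈ I.E, pt T ∈ codePoints I φ := fun T hT => Finset.mem_image_of_mem _ hT
  obtain ⟨T₀, hT₀⟩ := hne
  -- The assignment is extended to all vectors; its value off the code points is arbitrary and never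
  -- used.
  let τ' : (Fin D → Bool) → Fin I.k := fun a =>
    if ha : a ∈ codePoints I φ then σ ⟨a, ha⟩ else σ ⟨pt T₀, hmem T₀ hT₀⟩
  let τ : Finset (Fin I.n) → Fin I.k := fun T => τ' (pt T)
  have hcost : kMeansCost (codePoints I φ) c σ =
      ∑ i, ∑ T ∈ I.E.filter (fun T => τ T = i), ‖supportPoint (T.biUnion φ) - c i‖ ^ 2 := by
    have e₁ : kMeansCost (codePoints I φ) c σ =
        ∑ a : codePoints I φ, ‖boolPoint (a : Fin D → Bool) - c (τ' a)‖ ^ 2 := by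
      refine Finset.sum_congr rfl fun a _ => ?_
      have : τ' a = σ a := by simp [τ']
      rw [this]
    rw [e₁, Finset.sum_coe_sort (codePoints I φ) fun a => ‖boolPoint a - c (τ' a)‖ ^ 2,
      codePoints, Finset.sum_image (h.injOn_codePoint hE hn hb),
      ← Finset.sum_fiberwise I.E τ]
    refine Finset.sum_congr rfl fun i _ => Finset.sum_congr rfl fun T hT => ?_
    rw [← (Finset.mem_filter.1 hT).2]
    rfl
  have hcl := fun i => le_sum_norm_sub_sq (y := y) h (by omega) hE hg hy hyN
    (I.E.filter fun T => τ T = i) (Finset.filter_subset _ _) (c i)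
  choose S hS hle using hcl
  rw [hcost]
  refine le_trans ?_ (Finset.sum_le_sum fun i _ => hle i)
  rw [← Finset.mul_sum]
  refine mul_le_mul_of_nonneg_left ?_ (Nat.cast_nonneg n)
  rw [Finset.sum_sub_distrib, Finset.sum_sub_distrib, ← Finset.mul_sum, Finset.sum_const,
    Finset.card_univ, Fintype.card_fin, nsmul_eq_mul]
  have hE' : ∑ i, ((I.E.filter fun T => τ T = i).card : ℝ) = I.E.card := by
    rw [← Nat.cast_sum]
    congr 1
    exact (Finset.card_eq_sum_card_fiberwise fun T _ => Finset.mem_univ _).symm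
  -- The clusters are disjoint, so the hyperedges counted for the different `S i` are distinct, and
  -- all of them are covered by `S`; soundness bounds their number.
  have ha : ∑ i, (((I.E.filter fun T => τ T = i).filter fun T => S i ⊆ T).card : ℝ) ≤
      α * I.E.card := by
    refine le_trans ?_ (hI S hS)
    rw [← Nat.cast_sum, Nat.cast_le, ← Finset.card_biUnion]
    · refine Finset.card_le_card ?_
      intro T hT
      obtain ⟨i, -, hi⟩ := Finset.mem_biUnion.1 hT
      have hi := Finset.mem_filter.1 hi
      exact Finset.mem_biUnion.2 ⟨i, Finset.mem_univ _,
        Finset.mem_filter.2 ⟨(Finset.mem_filter.1 hi.1).1, hi.2⟩⟩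
    · intro i _ j _ hij
      refine Finset.disjoint_left.2 fun T hTi hTj => hij ?_
      rw [← (Finset.mem_filter.1 (Finset.mem_filter.1 hTi).1).2,
        (Finset.mem_filter.1 (Finset.mem_filter.1 hTj).1).2]
  rw [hE']
  linarith

end gap

/-! ### The size of the greedy code -/

/-- The words of length `Q` with a single one. -/
def oneHot (Q : ℕ) : List (List Bool) :=
  (List.range Q).map fun i => (List.range Q).map fun j => decide (i = j)

theorem length_oneHot (Q : ℕ) : (oneHot Q).length = Q := by simp [oneHot]

theorem length_of_mem_oneHot {Q : ℕ} : ∀ c ∈ oneHot Q, c.length = Q := by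
  intro c hc
  obtain ⟨i, -, rfl⟩ := List.mem_map.1 hc
  simp

theorem meet_comm (v w : List Bool) : meet v w = meet w v := by
  induction v generalizing w with
  | nil => cases w <;> rfl
  | cons a v ih =>
    cases w with
    | nil => rfl
    | cons b w => rw [meet, meet, ih, Bool.and_comm]

theorem meet_append {v v' : List Bool} (w w' : List Bool) (h : v.length = v'.length) :
    meet (v ++ w) (v' ++ w') = meet v v' + meet w w' := by
  induction v generalizing v' with
  | nil =>
    obtain rfl : v' = [] := List.length_eq_zero_iff.1 h.symm
    simp [meet]
  | cons a v ih =>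
    cases v' with
    | nil => simp at h
    | cons b v' =>
      rw [List.cons_append, List.cons_append, meet, meet, ih (by simpa using h), add_assoc]

theorem meet_map {ι : Type*} (l : List ι) (f g : ι → Bool) :
    meet (l.map f) (l.map g) = l.countP fun i => f i && g i := by
  induction l with
  | nil => rfl
  | cons a l ih =>
    rw [List.map_cons, List.map_cons, meet, ih, List.countP_cons, add_comm]
    cases f a && g a <;> rfl

theorem meet_oneHot {Q i i' : ℕ} (hi : i < Q) :
    meet ((List.range Q).map fun j => decide (i = j))
      ((List.range Q).map fun j => decide (i' = j)) =
      if i' = i then 1 else 0 := by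
  rw [meet_map]
  split_ifs with h
  · subst h
    have : (fun j => decide (i' = j) && decide (i' = j)) = fun j => j == i' := by
      funext j
      rw [Bool.and_self, Bool.beq_eq_decide_eq]
      exact decide_eq_decide.2 eq_comm
    rw [this]
    exact List.count_eq_one_of_mem List.nodup_range (List.mem_range.2 hi)
  · rw [List.countP_eq_zero]
    intro j _ hj
    simp only [Bool.and_eq_true, decide_eq_true_eq] at hj
    exact h (hj.2.trans hj.1.symm)

theorem meet_self_of_mem_wordsOf {Q n : ℕ} : ∀ w ∈ wordsOf (oneHot Q) n, meet w w = n := by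
  induction n with
  | zero => simp [wordsOf, meet]
  | succ n ih =>
    intro w hw
    simp only [wordsOf, List.mem_flatMap, List.mem_map] at hw
    obtain ⟨c, hc, w, hw, rfl⟩ := hw
    rw [meet_append _ _ rfl, ih w hw]
    obtain ⟨i, hi, rfl⟩ := List.mem_map.1 hc
    rw [meet_oneHot (List.mem_range.1 hi), if_pos rfl, add_comm]

/-- One block agrees with `c` and has weight `Q`; the other `Q - 1` have weight 1. -/
theorem sum_pow_meet_oneHot_le {Q : ℕ} {c : List Bool} (hc : c ∈ oneHot Q) :
    ((oneHot Q).map fun c' => Q ^ meet c c').sum ≤ 2 * Q := by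
  obtain ⟨i, hi, rfl⟩ := List.mem_map.1 hc
  have hi := List.mem_range.1 hi
  have h : ∀ i' ∈ List.range Q, Q ^ meet ((List.range Q).map fun j => decide (i = j))
      ((List.range Q).map fun j => decide (i' = j)) ≤ 1 + if i' = i then Q else 0 := by
    intro i' _
    rw [meet_oneHot hi]
    split_ifs <;> simp
  rw [oneHot, List.map_map]
  refine (List.sum_le_sum h).trans ?_
  change ∑ i' ∈ Finset.range Q, (1 + if i' = i then Q else 0) ≤ 2 * Q
  rw [Finset.sum_add_distrib, Finset.sum_ite_eq', if_pos (Finset.mem_range.2 hi)]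
  simp [two_mul]

/-- The weight `Q ^ meet` is multiplicative over blocks, so the sum factors into `n` sums over
single blocks. -/
theorem sum_pow_meet_le {Q n : ℕ} : ∀ g ∈ wordsOf (oneHot Q) n,
    ((wordsOf (oneHot Q) n).map fun w => Q ^ meet g w).sum ≤ (2 * Q) ^ n := by
  induction n with
  | zero => simp [wordsOf, meet]
  | succ n ih =>
    intro g hg
    simp only [wordsOf, List.mem_flatMap, List.mem_map] at hg
    obtain ⟨c, hc, g, hg, rfl⟩ := hg
    have h : ∀ (l : List (List Bool)), (∀ c' ∈ l, c'.length = Q) →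
        ((l.flatMap fun c' => (wordsOf (oneHot Q) n).map (c' ++ ·)).map
          fun w => Q ^ meet (c ++ g) w).sum =
        (l.map fun c' => Q ^ meet c c').sum *
          ((wordsOf (oneHot Q) n).map fun w => Q ^ meet g w).sum := by
      intro l hl
      induction l with
      | nil => simp
      | cons c' l ihl =>
        rw [List.flatMap_cons, List.map_append, List.sum_append,
          ihl fun c hc => hl c (List.mem_cons_of_mem _ hc), List.map_cons, List.sum_cons,
          Nat.add_mul, List.map_map]
        refine congrArg (· + _) ?_
        rw [← List.sum_map_mul_left]
        refine congrArg List.sum (List.map_congr_left fun w _ => ?_)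
        have hlen : c.length = c'.length :=
          (length_of_mem_oneHot c hc).trans (hl c' List.mem_cons_self).symm
        rw [Function.comp_apply, meet_append _ _ hlen, pow_add]
    rw [wordsOf, h _ length_of_mem_oneHot, pow_succ, mul_comm]
    exact Nat.mul_le_mul (ih g hg) (sum_pow_meet_oneHot_le hc)

theorem mem_foldl_addWord_of_mem {b n : ℕ} (W : List (List Bool)) {G : List (List Bool)}
    {w : List Bool} (h : w ∈ G) : w ∈ W.foldl (addWord b n) G := by
  induction W generalizing G with
  | nil => exact h
  | cons a W ih =>
    refine ih ?_
    rw [addWord]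
    split_ifs
    · exact h
    · exact List.mem_cons_of_mem _ h

/-- Maximality of the greedy code: a rejected word conflicts with a chosen one, and an accepted word
conflicts with itself. -/
theorem exists_mem_foldl_addWord {b n : ℕ} {W G : List (List Bool)}
    (hW : ∀ w ∈ W, n ≤ b * meet w w) :
    ∀ w ∈ W, ∃ g ∈ W.foldl (addWord b n) G, n ≤ b * meet g w := by
  induction W generalizing G with
  | nil => simp
  | cons a W ih =>
    intro w hw
    rcases List.mem_cons.1 hw with rfl | hw
    · by_cases h : G.any (fun g => decide (n ≤ b * meet g w)) = true
      · obtain ⟨g, hg, hgw⟩ := List.any_eq_true.1 h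
        refine ⟨g, ?_, of_decide_eq_true hgw⟩
        rw [List.foldl_cons, addWord, if_pos h]
        exact mem_foldl_addWord_of_mem W hg
      · refine ⟨w, ?_, hW w hw⟩
        rw [List.foldl_cons, addWord, if_neg h]
        exact mem_foldl_addWord_of_mem W List.mem_cons_self
    · exact ih (fun w hw => hW w (List.mem_cons_of_mem _ hw)) w hw

theorem pairwise_foldl_addWord {b n : ℕ} {W G : List (List Bool)}
    (hG : G.Pairwise fun v w => b * meet v w ≤ n) :
    (W.foldl (addWord b n) G).Pairwise fun v w => b * meet v w ≤ n := by
  induction W generalizing G with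
  | nil => exact hG
  | cons a W ih =>
    refine ih ?_
    rw [addWord]
    split_ifs with h
    · exact hG
    · refine List.pairwise_cons.2 ⟨fun g hg => ?_, hG⟩
      by_contra hc
      refine h (List.any_eq_true.2 ⟨g, hg, decide_eq_true ?_⟩)
      rw [meet_comm]
      exact (not_le.1 hc).le

/-- Double counting of `∑ Q ^ meet g w` over candidates `w` and chosen `g`. By maximality each `w`
contributes at least `(4z)^n`, and each `g` at most `(2Q)^n`; since there are `Q^n` candidates, the
code has at least `(2z)^n` words. -/
theorem mul_le_length_greedyCode {z b : ℕ} (hz : 0 < z) (hb : 0 < b) {e : ℕ} (he : 0 < e) :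
    z * e ≤ (greedyCode b (oneHot ((4 * z) ^ b)) (Nat.size e)).length := by
  set n := Nat.size e with hn
  set Q := (4 * z) ^ b with hQ
  set W := wordsOf (oneHot Q) n with hW
  set G := greedyCode b (oneHot Q) n with hG
  have hQ₀ : 0 < Q := by positivity
  have hGW : ∀ g ∈ G, g ∈ W := by
    intro g hg
    rcases mem_of_mem_foldl_addWord hg with h | h
    · exact h
    · simp at h
  have h₁ : ∀ w ∈ W, (4 * z) ^ n ≤ (G.map fun g => Q ^ meet g w).sum := by
    intro w hw
    obtain ⟨g, hg, hgw⟩ := exists_mem_foldl_addWord (b := b) (n := n) (G := []) (W := W)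
      (fun w hw => by
        rw [meet_self_of_mem_wordsOf w hw]
        exact Nat.le_mul_of_pos_left _ hb) w hw
    refine le_trans ?_ (List.single_le_sum (by simp) _ (List.mem_map_of_mem hg))
    -- The choice `Q = (4z)^b` turns the conflict `n ≤ b * meet g w` into weight at least `(4z)^n`.
    rw [hQ, ← pow_mul]
    exact Nat.pow_le_pow_right (by omega) hgw
  have h₂ : W.length * (4 * z) ^ n ≤ (W.map fun w => (G.map fun g => Q ^ meet g w).sum).sum := by
    have := List.card_nsmul_le_sum (W.map fun w => (G.map fun g => Q ^ meet g w).sum)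
      ((4 * z) ^ n) (by
        intro x hx
        obtain ⟨w, hw, rfl⟩ := List.mem_map.1 hx
        exact h₁ w hw)
    simpa using this
  have h₃ : (W.map fun w => (G.map fun g => Q ^ meet g w).sum).sum ≤ G.length * (2 * Q) ^ n := by
    have hcomm : (W.map fun w => (G.map fun g => Q ^ meet g w).sum).sum =
        (G.map fun g => (W.map fun w => Q ^ meet g w).sum).sum := by
      clear_value W
      clear h₁ h₂ hGW hW
      induction W with
      | nil => simp
      | cons a W ih => rw [List.map_cons, List.sum_cons, ih, ← List.sum_map_add]; simp
    rw [hcomm]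
    have := List.sum_le_card_nsmul (G.map fun g => (W.map fun w => Q ^ meet g w).sum)
      ((2 * Q) ^ n) (by
        intro x hx
        obtain ⟨g, hg, rfl⟩ := List.mem_map.1 hx
        exact sum_pow_meet_le g (hGW g hg))
    simpa using this
  have h₄ : W.length = Q ^ n := by rw [hW, length_wordsOf_eq, length_oneHot]
  have h₅ : (2 * z) ^ n ≤ G.length := by
    have := h₂.trans h₃
    rw [h₄] at this
    refine Nat.le_of_mul_le_mul_right (c := 2 ^ n * Q ^ n) ?_ (by positivity)
    calc (2 * z) ^ n * (2 ^ n * Q ^ n) = Q ^ n * (4 * z) ^ n := by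
          rw [show 4 * z = 2 * (2 * z) by ring, mul_pow 2 (2 * z)]; ring
      _ ≤ _ := this
      _ = _ := by rw [mul_pow]
  refine le_trans ?_ h₅
  -- Here `z^n ≥ z` because `n ≥ 1`, and `2^n > e` by the choice of `n` as the binary length of `e`.
  rw [mul_comm 2 z, mul_pow]
  have hn₁ : 1 ≤ n := Nat.size_pos.2 he
  exact Nat.mul_le_mul (Nat.le_self_pow (by omega) z) (Nat.lt_size_self e).le

/-! ### The points produced by the reduction -/

theorem getD_orWord (w u : List Bool) (j : ℕ) :
    (orWord w u).getD j false = (w.getD j false || u.getD j false) := by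
  induction w generalizing u j with
  | nil => simp [orWord]
  | cons a w ih =>
    rw [orWord]
    cases j with
    | zero => cases u <;> simp
    | succ j =>
      rw [List.getD_cons_succ, List.getD_cons_succ, ih]
      cases u <;> simp

theorem getD_selectOr {v : List Bool} {C : List (List Bool)} {u : List Bool} {j : ℕ} :
    (selectOr v C u).getD j false = true ↔ u.getD j false = true ∨
      ∃ i, v.getD i false = true ∧ (C.getD i []).getD j false = true := by
  induction v generalizing C u with
  | nil => simp [selectOr]
  | cons a v ih =>
    cases C with
    | nil => simp [selectOr]
    | cons c C =>
      rw [selectOr, ih]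
      have h : (if a = true then orWord c u else u).getD j false = true ↔
          u.getD j false = true ∨ (a = true ∧ c.getD j false = true) := by
        cases a
        · simp
        · rw [if_pos rfl, getD_orWord, Bool.or_eq_true]
          tauto
      rw [h, or_assoc]
      refine or_congr_right ?_
      constructor
      · rintro (h | ⟨i, h⟩)
        · exact ⟨0, by simpa using h⟩
        · exact ⟨i + 1, by simpa using h⟩
      · rintro ⟨i, h⟩
        cases i with
        | zero => exact Or.inl (by simpa using h)
        | succ i => exact Or.inr ⟨i, by simpa using h⟩

/-- Unused elements carry the empty word, so the result has full length only because some selected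
word has it; a nonempty hyperedge always provides one. -/
theorem length_selectOr {v : List Bool} {C : List (List Bool)} {u : List Bool} {L : ℕ}
    (hC : ∀ c ∈ C, c = [] ∨ c.length = L) (hu : u = [] ∨ u.length = L)
    (h : u.length = L ∨ ∃ i, v.getD i false = true ∧ (C.getD i []).length = L) :
    (selectOr v C u).length = L := by
  induction v generalizing C u with
  | nil => simpa [selectOr] using h
  | cons a v ih =>
    cases C with
    | nil =>
      rw [selectOr]
      · rcases h with h | ⟨i, -, h⟩
        · exact h
        · simp only [List.getD_nil, List.length_nil] at h
          rcases hu with hu | hu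
          · rw [hu]; exact h
          · exact hu
      · simp
    | cons c C =>
      rw [selectOr]
      have hc := hC c List.mem_cons_self
      have hor : orWord c u = [] ∨ (orWord c u).length = L := by
        rcases hc with rfl | hc
        · exact hu
        · refine Or.inr ((length_orWord c u ?_).trans hc)
          rcases hu with rfl | hu
          · simp
          · rw [hu, hc]
      refine ih (fun c hc => hC c (List.mem_cons_of_mem _ hc)) (by split_ifs <;> assumption) ?_
      rcases h with h | ⟨i, h, hi⟩
      · left
        split_ifs
        · rcases hc with rfl | hc
          · exact h
          · exact (length_orWord c u (by rw [h, hc])).trans hc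
        · exact h
      · cases i with
        | zero =>
          left
          rw [List.getD_cons_zero] at h hi
          rw [if_pos h]
          refine (length_orWord c u ?_).trans hi
          rcases hu with rfl | hu
          · simp
          · rw [hu, hi]
        | succ i => exact Or.inr ⟨i, by simpa using h, by simpa using hi⟩

theorem getD_usedBits {rows : List (List Bool)} {i : ℕ} :
    (usedBits rows).getD i false = true ↔ ∃ v ∈ rows, v.getD i false = true := by
  have h : ∀ (rows : List (List Bool)) (u : List Bool),
      (rows.foldl (fun u v => orWord v u) u).getD i false = true ↔
        u.getD i false = true ∨ ∃ v ∈ rows, v.getD i false = true := by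
    intro rows
    induction rows with
    | nil => simp
    | cons v rows ih =>
      intro u
      rw [List.foldl_cons, ih, getD_orWord, Bool.or_eq_true]
      simp only [List.mem_cons, exists_eq_or_imp]
      tauto
  rw [usedBits, h]
  simp

/-- A used element receives the code word whose index is the number of used elements before it. -/
theorem getD_assignWords (u : List Bool) (G : List (List Bool)) (i : ℕ) :
    (assignWords u G).getD i [] =
      if u.getD i false = true then G.getD ((u.take i).count true) [] else [] := by
  induction u generalizing G i with
  | nil => simp [assignWords]
  | cons a u ih =>
    cases a
    · cases i with
      | zero => simp [assignWords]
      | succ i =>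
        rw [assignWords, List.getD_cons_succ, ih]
        simp
    · cases i with
      | zero => cases G <;> simp [assignWords]
      | succ i =>
        rw [assignWords, List.getD_cons_succ, ih]
        cases G <;> simp

theorem card_filter_getD {D : ℕ} (v w : List Bool) (h : v.length ≤ D) :
    (Finset.univ.filter fun j : Fin D => v.getD j false = true ∧ w.getD j false = true).card =
      meet v w := by
  induction v generalizing w D with
  | nil => simp [meet]
  | cons a v ih =>
    obtain - | D := D
    · simp at h
    cases w with
    | nil => simp [meet]
    | cons b w =>
      rw [Fin.card_filter_univ_succ, meet, ← ih (D := D) w (by simpa using h)]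
      cases a <;> cases b <;> simp [add_comm]

theorem count_true_eq_meet (w : List Bool) : w.count true = meet w w := by
  induction w with
  | nil => rfl
  | cons a w ih =>
    rw [meet, ← ih]
    cases a <;> simp [add_comm]

/-- Hence different used elements receive words at different positions of the code, in increasing
order. -/
theorem count_take_lt {u : List Bool} {i i' : ℕ} (hi : u.getD i false = true) (h : i < i') :
    (u.take i).count true < (u.take i').count true := by
  have hlt : i < u.length := by
    by_contra hc
    rw [List.getD_eq_default _ _ (not_lt.1 hc)] at hi
    simp at hi
  rw [List.getD_eq_getElem _ _ hlt] at hi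
  have h₁ : (u.take (i + 1)).count true = (u.take i).count true + 1 := by
    rw [List.take_succ_eq_append_getElem hlt, List.count_append, hi]
    simp
  have h₂ : (u.take (i + 1)).count true ≤ (u.take i').count true := by
    refine List.Sublist.count_le _ ?_
    exact (List.take_prefix_take_left h).sublist
  omega

section points

variable {z b : ℕ}

/-- The incidence vector of a set. -/
def incidence {N : ℕ} (T : Finset (Fin N)) : Fin N → Bool := fun i => decide (i ∈ T)

theorem incidence_injective {N : ℕ} : Function.Injective (incidence (N := N)) := by
  intro T T' h
  ext i
  simpa [incidence] using congrFun h i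

/-- The link between the lists handled by the program and the geometric picture: the rows written
are exactly the code points, for a code on the set `X` of used elements. -/
theorem exists_isCode_outRows (hz : 0 < z) (hb : 2 * z ^ 2 < b) {I : JohnsonInstance z}
    (hne : I.E.Nonempty) {l : List (Fin I.n → Bool)} (hl : l.Nodup)
    (hlE : l.toFinset = I.E.image incidence) :
    ∃ (φ : Fin I.n → Finset (Fin (Nat.size I.E.card * (4 * z) ^ b))) (X : Finset (Fin I.n)),
      IsCode φ X (Nat.size I.E.card) b ∧ (∀ T ∈ I.E, T ⊆ X) ∧
      ∃ l' : List (Fin (Nat.size I.E.card * (4 * z) ^ b) → Bool), l'.Nodup ∧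
        l'.toFinset = codePoints I φ ∧
        outRows b (oneHot ((4 * z) ^ b)) (l.map fun v => List.ofFn v) =
          l'.map fun v => List.ofFn v := by
  set Q := (4 * z) ^ b with hQ
  set ℓ := Nat.size I.E.card with hℓ
  set rows := l.map fun v => List.ofFn v with hrows
  have hb₀ : 0 < b := by omega
  have hℓ₀ : 0 < ℓ := Nat.size_pos.2 hne.card_pos
  have hlen : rows.length = I.E.card := by
    rw [hrows, List.length_map, ← List.toFinset_card_of_nodup hl, hlE,
      Finset.card_image_of_injective _ incidence_injective]
  have hmem : ∀ v, v ∈ l ↔ ∃ T ∈ I.E, incidence T = v := by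
    intro v
    rw [← List.mem_toFinset, hlE, Finset.mem_image]
  set u := usedBits rows with hu
  set G := greedyCode b (oneHot Q) ℓ with hG
  set C := wordList b (oneHot Q) rows with hC
  have hC' : C = assignWords u G := by rw [hC, wordList, hlen]
  have hofFn : ∀ (v : Fin I.n → Bool) (i : ℕ), (List.ofFn v).getD i false = true ↔
      ∃ h : i < I.n, v ⟨i, h⟩ = true := by
    intro v i
    by_cases h : i < I.n
    · rw [List.getD_eq_getElem _ _ (by simpa using h)]
      simp [h]
    · rw [List.getD_eq_default _ _ (by simpa using h)]
      simp [h]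
  have hused : ∀ i, u.getD i false = true ↔ ∃ h : i < I.n, ∃ T ∈ I.E, (⟨i, h⟩ : Fin I.n) ∈ T := by
    intro i
    rw [hu, getD_usedBits]
    constructor
    · rintro ⟨v, hv, hi⟩
      obtain ⟨v', hv', rfl⟩ := List.mem_map.1 hv
      obtain ⟨T, hT, rfl⟩ := (hmem v').1 hv'
      obtain ⟨h, hi⟩ := (hofFn _ _).1 hi
      exact ⟨h, T, hT, of_decide_eq_true hi⟩
    · rintro ⟨h, T, hT, hi⟩
      exact ⟨_, List.mem_map_of_mem ((hmem _).2 ⟨T, hT, rfl⟩),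
        (hofFn _ _).2 ⟨h, decide_eq_true hi⟩⟩
  have hrowlen : ∀ v ∈ rows, v.length = I.n := by
    intro v hv
    obtain ⟨v, -, rfl⟩ := List.mem_map.1 hv
    simp
  have hrne : rows ≠ [] := by
    rw [← List.length_pos_iff, hlen]
    exact hne.card_pos
  have hulen : u.length = I.n := length_usedBits hrowlen hrne
  set X : Finset (Fin I.n) := Finset.univ.filter fun i => u.getD i false = true with hX
  have hEX : ∀ T ∈ I.E, T ⊆ X := fun T hT i hi =>
    Finset.mem_filter.2 ⟨Finset.mem_univ _, (hused i).2 ⟨i.2, T, hT, hi⟩⟩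
  -- At most `z |E|` elements occur in hyperedges, so the greedy code has a word for each. Unused
  -- elements need none, which keeps the dimension independent of the size of the universe.
  have hcount : u.count true ≤ G.length := by
    have h₁ : u.count true = X.card := by
      rw [count_true_eq_meet, ← card_filter_getD (D := I.n) u u hulen.le, hX]
      simp
    have h₂ : X ⊆ I.E.biUnion id := by
      intro i hi
      obtain ⟨_, T, hT, hiT⟩ := (hused i).1 (Finset.mem_filter.1 hi).2
      exact Finset.mem_biUnion.2 ⟨T, hT, hiT⟩
    have h₃ : (I.E.biUnion id).card ≤ I.E.card * z :=
      Finset.card_biUnion_le_card_mul _ _ _ fun T hT => (I.uniform T hT).le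
    have h₄ := mul_le_length_greedyCode hz hb₀ hne.card_pos
    rw [h₁]
    exact (Finset.card_le_card h₂).trans (h₃.trans ((mul_comm _ _).le.trans h₄))
  have hidx : ∀ i, u.getD i false = true → (u.take i).count true < G.length := by
    intro i hi
    refine lt_of_lt_of_le (count_take_lt hi (Nat.lt_succ_self i)) (le_trans ?_ hcount)
    exact List.Sublist.count_le _ (List.take_sublist _ _)
  have hGW : ∀ g ∈ G, g ∈ wordsOf (oneHot Q) ℓ := by
    intro g hg
    rcases mem_of_mem_foldl_addWord hg with h | h
    · exact h
    · simp at h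
  have hGlen : ∀ g ∈ G, g.length = ℓ * Q := fun g hg =>
    length_wordsOf length_of_mem_oneHot ℓ g (hGW g hg)
  have hpair : G.Pairwise fun v w => b * meet v w ≤ ℓ :=
    pairwise_foldl_addWord List.Pairwise.nil
  have hCget : ∀ i, (hi : u.getD i false = true) →
      C.getD i [] = G[(u.take i).count true]'(hidx i hi) := by
    intro i hi
    rw [hC', getD_assignWords, if_pos hi, List.getD_eq_getElem]
  let φ : Fin I.n → Finset (Fin (ℓ * Q)) := fun i =>
    Finset.univ.filter fun j => (C.getD i []).getD j false = true
  have hcode : IsCode φ X ℓ b := by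
    constructor
    · intro i hi
      have hi := (Finset.mem_filter.1 hi).2
      have hg := List.getElem_mem (hidx i hi)
      have := card_filter_getD (D := ℓ * Q) _ (G[(u.take i).count true]'(hidx i hi)) (hGlen _ hg).le
      rw [meet_self_of_mem_wordsOf _ (hGW _ hg)] at this
      simp only [φ]
      rw [hCget i hi]
      simpa only [and_self] using this
    · intro i hi i' hi' hne
      have hi := (Finset.mem_filter.1 hi).2
      have hi' := (Finset.mem_filter.1 hi').2
      have hg := List.getElem_mem (hidx i hi)
      have := card_filter_getD (D := ℓ * Q) _ (G[(u.take i').count true]'(hidx i' hi'))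
        (hGlen _ hg).le
      simp only [φ]
      rw [hCget i hi, hCget i' hi', ← Finset.filter_and, this]
      rcases lt_or_gt_of_ne (fun h => hne (Fin.ext h) : (i : ℕ) ≠ i') with h | h
      · exact List.pairwise_iff_getElem.1 hpair _ _ _ _ (count_take_lt hi h)
      · rw [meet_comm]
        exact List.pairwise_iff_getElem.1 hpair _ _ _ _ (count_take_lt hi' h)
  -- The row computed for `v`, read as a vector of the fixed length `ℓ * Q`; `hFlen` shows that no
  -- padding takes place.
  let F : (Fin I.n → Bool) → Fin (ℓ * Q) → Bool := fun v j =>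
    (selectOr (List.ofFn v) C []).getD j false
  have hF : ∀ T ∈ I.E, F (incidence T) = fun j => decide (j ∈ T.biUnion φ) := by
    intro T hT
    funext j
    rw [Bool.eq_iff_iff, decide_eq_true_iff, Finset.mem_biUnion]
    simp only [F]
    rw [getD_selectOr]
    simp only [List.getD_nil, Bool.false_eq_true, false_or]
    constructor
    · rintro ⟨i, hi, hj⟩
      obtain ⟨h, hi⟩ := (hofFn _ _).1 hi
      exact ⟨⟨i, h⟩, of_decide_eq_true hi, Finset.mem_filter.2 ⟨Finset.mem_univ _, hj⟩⟩
    · rintro ⟨i, hi, hj⟩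
      exact ⟨i, (hofFn _ _).2 ⟨i.2, decide_eq_true hi⟩, (Finset.mem_filter.1 hj).2⟩
  have hFlen : ∀ v ∈ l, (selectOr (List.ofFn v) C []).length = ℓ * Q := by
    intro v hv
    obtain ⟨T, hT, rfl⟩ := (hmem v).1 hv
    refine length_selectOr ?_ (Or.inl rfl) (Or.inr ?_)
    · intro c hc
      obtain ⟨i, hi, rfl⟩ := List.getElem_of_mem hc
      rw [← List.getD_eq_getElem C [] hi]
      by_cases h : u.getD i false = true
      · right
        rw [hCget i h]
        exact hGlen _ (List.getElem_mem _)
      · left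
        rw [hC', getD_assignWords, if_neg h]
    · obtain ⟨i, hi⟩ := Finset.card_pos.1 ((I.uniform T hT).symm ▸ hz : 0 < T.card)
      refine ⟨i, (hofFn _ _).2 ⟨i.2, decide_eq_true hi⟩, ?_⟩
      rw [hCget i ((hused i).2 ⟨i.2, T, hT, hi⟩)]
      exact hGlen _ (List.getElem_mem _)
  refine ⟨φ, X, hcode, hEX, l.map F, ?_, ?_, ?_⟩
  · refine (List.nodup_map_iff_inj_on hl).2 ?_
    intro v hv v' hv' h
    obtain ⟨T, hT, rfl⟩ := (hmem v).1 hv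
    obtain ⟨T', hT', rfl⟩ := (hmem v').1 hv'
    rw [hF T hT, hF T' hT'] at h
    exact congrArg incidence (hcode.injOn_codePoint hEX hℓ₀ hb hT hT' h)
  · ext p
    rw [List.mem_toFinset, List.mem_map, codePoints, Finset.mem_image]
    constructor
    · rintro ⟨v, hv, rfl⟩
      obtain ⟨T, hT, rfl⟩ := (hmem v).1 hv
      exact ⟨T, hT, (hF T hT).symm⟩
    · rintro ⟨T, hT, rfl⟩
      exact ⟨_, (hmem _).2 ⟨T, hT, rfl⟩, hF T hT⟩
  · rw [outRows, hrows, List.map_map, List.map_map]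
    refine List.map_congr_left fun v hv => ?_
    refine List.ext_getElem ?_ ?_
    · simpa using hFlen v hv
    · intro j h₁ h₂
      simp only [Function.comp_apply, List.getElem_ofFn, F]
      rw [List.getD_eq_getElem]

end points

/-! ### The reduction runs in polynomial time -/

/-- The functions given by polynomials. -/
def IsPoly (f : ℕ → ℕ) : Prop := ∃ p : Polynomial ℕ, ∀ n, p.eval n = f n

theorem IsPoly.const (c : ℕ) : IsPoly fun _ => c := ⟨Polynomial.C c, by simp⟩

theorem IsPoly.id : IsPoly fun n => n := ⟨Polynomial.X, by simp⟩

theorem IsPoly.add {f g : ℕ → ℕ} (hf : IsPoly f) (hg : IsPoly g) : IsPoly fun n => f n + g n := by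
  obtain ⟨p, hp⟩ := hf
  obtain ⟨q, hq⟩ := hg
  exact ⟨p + q, fun n => by rw [Polynomial.eval_add, hp, hq]⟩

theorem IsPoly.mul {f g : ℕ → ℕ} (hf : IsPoly f) (hg : IsPoly g) : IsPoly fun n => f n * g n := by
  obtain ⟨p, hp⟩ := hf
  obtain ⟨q, hq⟩ := hg
  exact ⟨p * q, fun n => by rw [Polynomial.eval_mul, hp, hq]⟩

theorem IsPoly.pow {f : ℕ → ℕ} (hf : IsPoly f) (k : ℕ) : IsPoly fun n => f n ^ k := by
  obtain ⟨p, hp⟩ := hf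
  exact ⟨p ^ k, fun n => by rw [Polynomial.eval_pow, hp]⟩

theorem isPoly_reductionTime (b Q β B N₀ D c : ℕ) :
    IsPoly fun n => reductionTime b Q β ((2 * n) ^ c) B N₀ D n := by
  unfold reductionTime reduceTime
  repeat' first
    | exact IsPoly.const _
    | exact IsPoly.id
    | refine IsPoly.add ?_ ?_
    | refine IsPoly.mul ?_ ?_
    | refine IsPoly.pow ?_ _

/-- Since `2 ^ Nat.size e ≤ 2e` and `Q ≤ 2^Q`, the number of candidate words is polynomial in the
input length, of degree `Q`. -/
theorem pow_size_le {Q e n : ℕ} (he : 0 < e) (hen : e ≤ n) : Q ^ Nat.size e ≤ (2 * n) ^ Q := by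
  have h₁ : 2 ^ Nat.size e ≤ 2 * n := by
    have hs : 1 ≤ Nat.size e := Nat.size_pos.2 he
    have : 2 ^ (Nat.size e - 1) ≤ e := Nat.lt_size.1 (by omega)
    calc 2 ^ Nat.size e = 2 * 2 ^ (Nat.size e - 1) := by rw [← pow_succ']; congr 1; omega
      _ ≤ 2 * n := Nat.mul_le_mul_left _ (this.trans hen)
  calc Q ^ Nat.size e ≤ (2 ^ Q) ^ Nat.size e := Nat.pow_le_pow_left Nat.lt_two_pow_self.le _
    _ = (2 ^ Nat.size e) ^ Q := by rw [← pow_mul, ← pow_mul, mul_comm]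
    _ ≤ (2 * n) ^ Q := Nat.pow_le_pow_left h₁ _

theorem polyTimeComputable_reduction {f h : List Bool → List Γ'} (hf : PolyTimeComputable f)
    (b : ℕ) {Q : ℕ} (hQ : 0 < Q) (table : List Γ' → List Γ') (y : List Γ') (B N₀ : ℕ)
    (H : ∀ x, ((f x).length < B ∧ h x = table (f x)) ∨ (B ≤ (f x).length ∧
      ∃ (kb : List Bool) (rows : List (List Bool)) (N : ℕ),
        f x = kb.map Γ'.bit ++ encodeWords rows ∧ rows ≠ [] ∧ (∀ v ∈ rows, v.length = N) ∧
        ((N < N₀ ∧ h x = y) ∨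
          (N₀ ≤ N ∧ h x = kb.map Γ'.bit ++ encodeWords (outRows b (oneHot Q) rows))))) :
    PolyTimeComputable h := by
  -- Only finitely many strings are shorter than `B`, so the table entries in use have bounded
  -- length.
  obtain ⟨D, hD⟩ : ∃ D, ∀ w : List Γ', w.length < B → (table w).length ≤ D := by
    obtain ⟨D, hD⟩ := ((List.finite_length_lt Γ' B).image fun w => (table w).length).bddAbove
    exact ⟨D, fun w hw => hD ⟨w, hw, rfl⟩⟩
  obtain ⟨p, hp⟩ := isPoly_reductionTime b Q Q B N₀ y.length Q
  refine polyTimeComputable_of_exec hf (reductionProg b (oneHot Q) table y B N₀) Reg.aux Reg.fin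
    (p + Polynomial.C (3 * B + 1 + (3 * B + (15 * (2 * B + 1) + 1 + (D + 1))))) fun x => ?_
  rw [Polynomial.eval_add, Polynomial.eval_C, hp]
  rcases H x with ⟨hx, hh⟩ | ⟨hx, kb, rows, N, hfx, hne, hN, hh⟩
  · rw [hh]
    refine (exec_reductionProg_table hx).mono ?_
    have := hD _ hx
    omega
  · have hlen := length_encodeWords hN
    have hpos : 0 < rows.length := List.length_pos_iff.2 hne
    have hle : rows.length ≤ (encodeWords rows).length := by
      rw [hlen]; exact Nat.le_mul_of_pos_right _ (by omega)
    rw [hfx] at hx ⊢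
    rcases hh with ⟨hN₀, hh⟩ | ⟨hN₀, hh⟩
    · rw [hh]
      have e := exec_reductionProg_const (b := b) (y := y) (blocks := oneHot Q)
        (table := table) (β := Q) (M := (2 * (kb.map Γ'.bit ++ encodeWords rows).length) ^ Q)
        (N₀ := N₀) hx
        (by rw [length_usedBits hN hne]; exact hN₀) le_rfl hle
      rw [length_oneHot] at e
      exact e.mono (Nat.le_add_right _ _)
    · rw [hh]
      have e := exec_reductionProg (b := b) (blocks := oneHot Q) (table := table) (β := Q) (y := y)
        (M := (2 * (kb.map Γ'.bit ++ encodeWords rows).length) ^ Q) (D := y.length) hx hN₀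
        length_of_mem_oneHot (by rwa [length_oneHot]) hne hN (by
          rw [length_oneHot]
          refine pow_size_le hpos ?_
          rw [List.length_append]
          omega)
      rw [length_oneHot] at e
      exact e.mono (Nat.le_add_right _ _)

/-! ### Encodings -/

theorem encodeInstance_eq (k : ℕ) (l : List (List Bool)) :
    encodeInstance k l = (encodeNat k).map Γ'.bit ++ encodeWords l := rfl

/-- A run of bits ends at the first symbol that is not a bit, so the decomposition is unique. -/
theorem map_bit_append_inj {v v' : List Bool} {r r' : List Γ'} (hr : r.head?.any isBit = false)
    (hr' : r'.head?.any isBit = false) (h : v.map Γ'.bit ++ r = v'.map Γ'.bit ++ r') :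
    v = v' ∧ r = r' := by
  induction v generalizing v' with
  | nil =>
    cases v' with
    | nil => exact ⟨rfl, h⟩
    | cons a v' =>
      rw [List.map_nil, List.nil_append] at h
      rw [h] at hr
      simp [isBit] at hr
  | cons a v ih =>
    cases v' with
    | nil =>
      rw [List.map_nil, List.nil_append] at h
      rw [← h] at hr'
      simp [isBit] at hr'
    | cons a' v' =>
      simp only [List.map_cons, List.cons_append, List.cons.injEq, Γ'.bit.injEq] at h
      obtain ⟨rfl, h⟩ := h
      obtain ⟨rfl, rfl⟩ := ih h
      exact ⟨rfl, rfl⟩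

theorem encodeWords_injective : Function.Injective encodeWords := by
  intro l
  induction l with
  | nil =>
    intro l' h
    cases l' with
    | nil => rfl
    | cons v' l' => simp [encodeWords_cons] at h
  | cons v l ih =>
    intro l' h
    cases l' with
    | nil => simp [encodeWords_cons] at h
    | cons v' l' =>
      rw [encodeWords_cons, encodeWords_cons, List.cons.injEq] at h
      obtain ⟨rfl, hl⟩ := map_bit_append_inj (head_encodeWords l) (head_encodeWords l') h.2
      rw [ih hl]

theorem encodeInstance_inj {k k' : ℕ} {l l' : List (List Bool)}
    (h : encodeInstance k l = encodeInstance k' l') : k = k' ∧ l = l' := by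
  obtain ⟨hk, hl⟩ := map_bit_append_inj (head_encodeWords l) (head_encodeWords l') h
  refine ⟨?_, encodeWords_injective hl⟩
  rw [← decode_encodeNat k, hk, decode_encodeNat]

/-- A hyperedge reveals the size of the universe as the length of its vector; without one the string
would not determine `n`. -/
theorem eq_of_encodedBy {z : ℕ} {I I' : JohnsonInstance z} {s : List Γ'}
    (hne : I.E.Nonempty) (h : I.EncodedBy s) (h' : I'.EncodedBy s) : I = I' := by
  obtain ⟨l, -, hlE, hs⟩ := h
  obtain ⟨l', -, hlE', hs'⟩ := h'
  obtain ⟨hk, hl⟩ := encodeInstance_inj (hs.symm.trans hs')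
  obtain ⟨n, E, k, hE⟩ := I
  obtain ⟨n', E', k', hE'⟩ := I'
  dsimp only at *
  obtain rfl := hk
  obtain ⟨T, hT⟩ := hne
  have hmem : incidence T ∈ l := List.mem_toFinset.1 (hlE ▸ Finset.mem_image_of_mem _ hT)
  obtain ⟨v, -, hv⟩ := List.mem_map.1 (hl ▸ List.mem_map_of_mem (f := fun v => List.ofFn v) hmem)
  obtain rfl : n' = n := by simpa using congrArg List.length hv
  obtain rfl : l = l' := List.map_injective_iff.2 List.ofFn_injective hl
  obtain rfl : E = E' := Finset.image_injective incidence_injective (hlE.symm.trans hlE')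
  rfl

/-- A crude bound, used to conclude that `k` is large when its code is long. -/
theorem length_encodeNat_le (k : ℕ) : (encodeNat k).length ≤ k := by
  have h : ∀ p : PosNum, (encodePosNum p).length ≤ (p : ℕ) := by
    intro p
    induction p with
    | one => simp [encodePosNum]
    | bit0 p ih =>
      have := p.cast_pos (α := ℕ)
      rw [encodePosNum, List.length_cons, PosNum.cast_bit0]
      omega
    | bit1 p ih =>
      rw [encodePosNum, List.length_cons, PosNum.cast_bit1]
      omega
  have h' : ∀ m : Num, (encodeNum m).length ≤ (m : ℕ) := by
    intro m
    cases m with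
    | zero => simp [encodeNum]
    | pos p => exact h p
  have := h' (k : Num)
  simpa [encodeNat] using this

/-! ### The gap -/

theorem size_mul_log_le {e : ℕ} (he : 0 < e) :
    (Nat.size e : ℝ) * Real.log 2 ≤ Real.log e + Real.log 2 := by
  have hs : 1 ≤ Nat.size e := Nat.size_pos.2 he
  have h₁ : 2 ^ (Nat.size e - 1) ≤ e := Nat.lt_size.1 (by omega)
  have h₂ : ((2 : ℝ)) ^ (Nat.size e - 1) ≤ e := by exact_mod_cast h₁
  have h₃ := Real.log_le_log (by positivity) h₂
  rw [Real.log_pow, Nat.cast_sub hs, Nat.cast_one] at h₃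
  linarith

theorem log_le_size_mul_log {e : ℕ} (he : 0 < e) :
    Real.log e ≤ (Nat.size e : ℝ) * Real.log 2 := by
  have h₂ : (e : ℝ) ≤ (2 : ℝ) ^ Nat.size e := by exact_mod_cast (Nat.lt_size_self e).le
  have h₃ := Real.log_le_log (by exact_mod_cast he) h₂
  rwa [Real.log_pow] at h₃

/-- The gap of the reduction, on all sufficiently dense instances. -/
theorem exists_gap_of_dense {α ε : ℝ} {z y : ℕ} (hy : 1 ≤ y) (hyz : y < z) (hα : α < 1)
    (hε : 0 < ε) :
    ∃ (b : ℕ) (A ρ K : ℝ), 0 < ρ ∧ 1 ≤ K * Real.log 2 ∧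
      ∀ (I : JohnsonInstance z), I.E.Nonempty → 1 ≤ I.k →
        A * (I.k : ℝ) * (I.n : ℝ) ^ (z - y - 1) ≤ I.E.card →
        ∀ l : List (Fin I.n → Bool), l.Nodup → l.toFinset = I.E.image incidence →
        (I.Complete y → encodeInstance I.k (outRows b (oneHot ((4 * z) ^ b))
            (l.map fun v => List.ofFn v)) ∈
          (kMeansGap (1 + (1 - α) / ((z : ℝ) - (y : ℝ)) - ε) ρ K).yes) ∧
        (I.Sound α y → encodeInstance I.k (outRows b (oneHot ((4 * z) ^ b))
            (l.map fun v => List.ofFn v)) ∈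
          (kMeansGap (1 + (1 - α) / ((z : ℝ) - (y : ℝ)) - ε) ρ K).no) := by
  set d : ℝ := (z : ℝ) - y with hd
  have hd₁ : 1 ≤ d := by
    have : ((y + 1 : ℕ) : ℝ) ≤ z := Nat.cast_le.2 hyz
    push_cast at this
    linarith
  set w : ℝ := d + 1 - α with hw
  have hw₀ : 1 < w := by linarith
  set η : ℝ := ε * d / (2 * w) with hη
  have hη₀ : 0 < η := by positivity
  set δ : ℝ := min (1 / 3) (ε * d / 6) with hδ
  have hδ₀ : 0 < δ := lt_min (by norm_num) (by positivity)
  have hδ₁ : δ ≤ 1 / 3 := min_le_left _ _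
  have hδ₂ : δ ≤ ε * d / 6 := min_le_right _ _
  have hηw : η * w = ε * d / 2 := by
    rw [hη]
    field_simp
  -- Out of the slack `ε d`, one half pays for `η w` and the other for `3δ`.
  have hmain : (1 + η) * (w - ε * d) ≤ w - 3 * δ := by
    have : 0 ≤ η * (ε * d) := by positivity
    nlinarith
  obtain ⟨b, hb⟩ := exists_nat_gt (max (2 * (z : ℝ) ^ 2) (2 * z ^ 2 / δ))
  obtain ⟨g, hg⟩ := exists_nat_gt (z / δ)
  have hz₀ : (0 : ℝ) < z := by exact_mod_cast (Nat.zero_le y).trans_lt hyz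
  have hb₁ : 2 * z ^ 2 < b := by exact_mod_cast (le_max_left _ _).trans_lt hb
  have hb₂ : (2 : ℝ) * z ^ 2 / b ≤ δ := by
    have h := (le_max_right _ _).trans_lt hb
    have hb₀ : (0 : ℝ) < b := lt_of_le_of_lt (by positivity) h
    rw [div_lt_iff₀ hδ₀] at h
    rw [div_le_iff₀ hb₀]
    linarith
  have hg₀ : (0 : ℝ) < g := lt_of_le_of_lt (by positivity) hg
  have hg₁ : (z : ℝ) / g ≤ δ := by
    rw [div_lt_iff₀ hδ₀] at hg
    rw [div_le_iff₀ hg₀]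
    linarith
  have hlog₂ : 0 < Real.log 2 := Real.log_pos one_lt_two
  -- The three entries make the density error at most `δ |E|`, ensure two points, and make `|E|`
  -- large enough for the rounding of the logarithm.
  set A : ℝ := max (z * 2 ^ (g * z) / δ) (max 2 (Real.exp (Real.log 2 / η))) with hA
  have hA₁ : z * 2 ^ (g * z) / δ ≤ A := le_max_left _ _
  have hA₂ : 2 ≤ A := (le_max_left _ _).trans (le_max_right _ _)
  have hA₃ : Real.exp (Real.log 2 / η) ≤ A := (le_max_right _ _).trans (le_max_right _ _)
  set Q : ℕ := (4 * z) ^ b with hQ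
  have hQ₁ : (1 : ℝ) ≤ Q := by
    have : 0 < Q := by
      have : 0 < z := by omega
      positivity
    exact_mod_cast this
  -- The threshold is the completeness cost `d ℓ |E|` and the dimension is `ℓ Q`, both with `ℓ ≤ (1
  -- + η) log |E| / log 2`.
  refine ⟨b, A, d * (1 + η) / Real.log 2, Q * (1 + η) / Real.log 2, by positivity, ?_, ?_⟩
  · rw [div_mul_cancel₀ _ hlog₂.ne']
    nlinarith
  intro I hne hk hdense l hl hlE
  have hex := exists_isCode_outRows (by omega) hb₁ hne hl hlE
  rw [← hQ] at hex
  set ℓ := Nat.size I.E.card with hℓ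
  obtain ⟨φ, X, hcode, hX, l', hl', hlP, hout⟩ := hex
  have hepos := hne.card_pos
  have hℓ₀ : 0 < ℓ := Nat.size_pos.2 hepos
  have hcard : (codePoints I φ).card = I.E.card :=
    Finset.card_image_of_injOn (hcode.injOn_codePoint hX hℓ₀ hb₁)
  have henc : Encodes (encodeInstance I.k (outRows b (oneHot Q) (l.map fun v => List.ofFn v)))
      I.k (codePoints I φ) := ⟨l', hl', hlP, by rw [hout]⟩
  have hk' : (1 : ℝ) ≤ I.k := by exact_mod_cast hk
  have hn₁ : (1 : ℝ) ≤ I.n := by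
    obtain ⟨T, hT⟩ := hne
    have := Finset.card_le_univ T
    rw [I.uniform T hT, Fintype.card_fin] at this
    exact_mod_cast (show 1 ≤ I.n by omega)
  have hkn : (1 : ℝ) ≤ I.k * (I.n : ℝ) ^ (z - y - 1) :=
    one_le_mul_of_one_le_of_one_le hk' (one_le_pow₀ hn₁)
  have hAe : A ≤ I.E.card := by
    refine le_trans ?_ hdense
    rw [mul_assoc]
    exact le_mul_of_one_le_right (by linarith) hkn
  have he₂ : (2 : ℝ) ≤ I.E.card := hA₂.trans hAe
  have hlog : 0 ≤ Real.log I.E.card := Real.log_nonneg (by linarith)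
  have hlogη : Real.log 2 ≤ η * Real.log I.E.card := by
    have h := Real.log_le_log (Real.exp_pos _) (hA₃.trans hAe)
    rw [Real.log_exp, div_le_iff₀ hη₀] at h
    linarith
  have hup : (ℓ : ℝ) ≤ (1 + η) / Real.log 2 * Real.log I.E.card := by
    have h := size_mul_log_le hepos
    rw [div_mul_eq_mul_div, le_div_iff₀ hlog₂]
    linarith
  have hlow : Real.log I.E.card / Real.log 2 ≤ ℓ := by
    rw [div_le_iff₀ hlog₂]
    exact log_le_size_mul_log hepos
  have hP₂ : 2 ≤ (codePoints I φ).card := by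
    rw [hcard]
    exact_mod_cast he₂
  have hdim : ((ℓ * Q : ℕ) : ℝ) ≤ Q * (1 + η) / Real.log 2 * Real.log (codePoints I φ).card := by
    rw [hcard, Nat.cast_mul]
    calc (ℓ : ℝ) * Q ≤ ((1 + η) / Real.log 2 * Real.log I.E.card) * Q :=
          mul_le_mul_of_nonneg_right hup (by positivity)
      _ = _ := by ring
  constructor
  · intro hI
    obtain ⟨c, σ, hc⟩ := exists_kMeansCost_le hcode hX hI
    refine ⟨ℓ * Q, I.k, codePoints I φ, henc, hk, hP₂, hdim, c, σ, hc.trans ?_⟩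
    rw [hcard, ← hd]
    calc d * ℓ * I.E.card ≤ d * ((1 + η) / Real.log 2 * Real.log I.E.card) * I.E.card := by
          gcongr
      _ = _ := by ring
  · intro hI
    refine ⟨ℓ * Q, I.k, codePoints I φ, henc, hk, hP₂, hdim, fun c σ => ?_⟩
    refine le_trans ?_ (le_kMeansCost hcode hX hℓ₀ hb₁ (by exact_mod_cast hg₀ : 0 < g) hy hyz hne
      hI c σ)
    have hZ : (I.k : ℝ) * (z * 2 ^ (g * z) * (I.n : ℝ) ^ (z - y - 1)) ≤ δ * I.E.card := by
      have h₁ := (mul_le_mul_of_nonneg_right hA₁ (by linarith :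
        (0 : ℝ) ≤ I.k * (I.n : ℝ) ^ (z - y - 1)))
      rw [← mul_assoc A] at h₁
      have h₂ := h₁.trans hdense
      rw [div_mul_eq_mul_div, div_le_iff₀ hδ₀] at h₂
      linarith
    have h₃ : (w - 3 * δ) * I.E.card ≤
        ((z : ℝ) - y + 1 - α - 2 * z ^ 2 / b - z / g) * I.E.card -
        I.k * (z * 2 ^ (g * z) * (I.n : ℝ) ^ (z - y - 1)) := by
      have : (w - 2 * δ) * I.E.card ≤
          ((z : ℝ) - y + 1 - α - 2 * z ^ 2 / b - z / g) * I.E.card :=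
        mul_le_mul_of_nonneg_right (by linarith) (by linarith)
      linarith
    have h₄ : (Real.log I.E.card / Real.log 2) * ((w - 3 * δ) * I.E.card) ≤
        (ℓ : ℝ) * ((w - 3 * δ) * I.E.card) :=
      mul_le_mul_of_nonneg_right hlow (mul_nonneg (by linarith) (by linarith))
    refine le_trans ?_ (h₄.trans (mul_le_mul_of_nonneg_left h₃ (Nat.cast_nonneg _)))
    rw [hcard]
    have h₅ : (1 + (1 - α) / d - ε) * d = w - ε * d := by
      field_simp
      ring
    calc (1 + (1 - α) / d - ε) * (d * (1 + η) / Real.log 2 * I.E.card * Real.log I.E.card)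
        = ((1 + (1 - α) / d - ε) * d) * (1 + η) *
            (I.E.card * (Real.log I.E.card / Real.log 2)) := by ring
      _ = (1 + η) * (w - ε * d) * (I.E.card * (Real.log I.E.card / Real.log 2)) := by
          rw [h₅]; ring
      _ ≤ (w - 3 * δ) * (I.E.card * (Real.log I.E.card / Real.log 2)) :=
          mul_le_mul_of_nonneg_right hmain (by positivity)
      _ = _ := by ring

/-! ### Fixed instances -/

theorem exists_encodes {m : ℕ} (k : ℕ) (P : Finset (Fin m → Bool)) : ∃ s, Encodes s k P :=
  ⟨_, P.toList, P.nodup_toList, P.toList_toFinset, rfl⟩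

theorem card_univ_bool : (Finset.univ : Finset (Fin 1 → Bool)).card = 2 := by simp

/-- The two points of `{0,1}` with two centers have cost zero; the assumption on `K` admits
dimension 1. -/
theorem exists_mem_yes {γ ρ K : ℝ} (hρ : 0 < ρ) (hK : 1 ≤ K * Real.log 2) :
    ∃ s, s ∈ (kMeansGap γ ρ K).yes := by
  obtain ⟨s, hs⟩ := exists_encodes 2 (Finset.univ : Finset (Fin 1 → Bool))
  have hlog₂ : 0 < Real.log 2 := Real.log_pos one_lt_two
  refine ⟨s, 1, 2, Finset.univ, hs, one_le_two, card_univ_bool.ge, ?_,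
    fun i => boolPoint fun _ => decide (i = 1), fun a => if a.1 0 then 1 else 0, ?_⟩
  · rw [card_univ_bool]
    simpa using hK
  · refine le_trans (le_of_eq ?_) (by rw [card_univ_bool]; positivity :
      (0 : ℝ) ≤ ρ * (Finset.univ : Finset (Fin 1 → Bool)).card *
        Real.log (Finset.univ : Finset (Fin 1 → Bool)).card)
    refine Finset.sum_eq_zero fun a _ => ?_
    have : (fun _ : Fin 1 => decide ((if a.1 0 then 1 else 0 : Fin 2) = 1)) = a.1 := by
      funext i
      rw [Subsingleton.elim i 0]
      cases a.1 0 <;> simp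
    dsimp only
    rw [this, sub_self]
    simp

/-- The two points of `{0,1}` with one center have optimal cost `1/2`, and `ρ` is chosen so that `ρ
n log n` equals this value. -/
theorem exists_mem_yes_and_no {γ : ℝ} (hγ : γ ≤ 1) :
    ∃ s, s ∈ (kMeansGap γ (1 / (4 * Real.log 2)) (1 / Real.log 2)).yes ∧
      s ∈ (kMeansGap γ (1 / (4 * Real.log 2)) (1 / Real.log 2)).no := by
  obtain ⟨s, hs⟩ := exists_encodes 1 (Finset.univ : Finset (Fin 1 → Bool))
  have hlog₂ : 0 < Real.log 2 := Real.log_pos one_lt_two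
  have hcard := card_univ_bool
  have hdim : ((1 : ℕ) : ℝ) ≤
      1 / Real.log 2 * Real.log (Finset.univ : Finset (Fin 1 → Bool)).card := by
    rw [hcard, Nat.cast_one, one_div]
    exact (inv_mul_cancel₀ hlog₂.ne').ge
  have hval : 1 / (4 * Real.log 2) * (Finset.univ : Finset (Fin 1 → Bool)).card *
      Real.log (Finset.univ : Finset (Fin 1 → Bool)).card = 1 / 2 := by
    rw [hcard]
    push_cast
    field_simp
    norm_num
  have hsum : ∀ (c : Fin 1 → EuclideanSpace ℝ (Fin 1)) 
      (σ : ↥(Finset.univ : Finset (Fin 1 → Bool)) → Fin 1), kMeansCost Finset.univ c σ =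
        ‖boolPoint (fun _ => true) - c 0‖ ^ 2 + ‖boolPoint (fun _ => false) - c 0‖ ^ 2 := by
    intro c σ
    have h₁ : kMeansCost Finset.univ c σ =
        ∑ a : (Finset.univ : Finset (Fin 1 → Bool)), ‖boolPoint (a : Fin 1 → Bool) - c 0‖ ^ 2 :=
      Finset.sum_congr rfl fun a _ => by rw [Subsingleton.elim (σ a) 0]
    have h₂ : (Finset.univ : Finset (Fin 1 → Bool)) = {fun _ => true, fun _ => false} := by decide
    rw [h₁, Finset.sum_coe_sort Finset.univ fun a => ‖boolPoint a - c 0‖ ^ 2, h₂,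
      Finset.sum_pair]
    exact fun h => Bool.noConfusion (congrFun h 0)
  refine ⟨s, ⟨1, 1, Finset.univ, hs, le_rfl, hcard.ge, hdim, fun _ => WithLp.toLp 2 fun _ => 1 / 2,
    fun _ => 0, ?_⟩, 1, 1, Finset.univ, hs, le_rfl, hcard.ge, hdim, fun c σ => ?_⟩
  · rw [hval, hsum, EuclideanSpace.norm_sq_eq, EuclideanSpace.norm_sq_eq]
    simp [boolPoint]
    norm_num
  · rw [hval, hsum, EuclideanSpace.norm_sq_eq, EuclideanSpace.norm_sq_eq]
    simp only [boolPoint, Fintype.sum_unique, PiLp.sub_apply, Real.norm_eq_abs, sq_abs]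
    simp only [if_true, Bool.false_eq_true, if_false]
    nlinarith [sq_nonneg ((c 0) default - 1 / 2)]

/-- Any machine at hand will do; the program runs after it and discards its output. -/
theorem polyTimeComputable_const {f : List Bool → List Γ'} (hf : PolyTimeComputable f)
    (w : List Γ') : PolyTimeComputable fun _ : List Bool => w := by
  refine polyTimeComputable_of_exec hf (outputConst w) Reg.aux Reg.fin
    (Polynomial.C 15 * (Polynomial.C 2 * Polynomial.X + Polynomial.C 1) +
      Polynomial.C (1 + (w.length + 1))) fun x => ?_
  refine (exec_outputConst (B := (f x).length) w ?_ (by simp)).mono ?_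
  · intro X
    cases X <;> simp
  · simp only [Polynomial.eval_add, Polynomial.eval_mul, Polynomial.eval_C, Polynomial.eval_X]
    omega

/-- The instance with all sets of size `z`, and `k = 1`. -/
def completeInstance (z N : ℕ) : JohnsonInstance z where
  n := N
  E := Finset.univ.powersetCard z
  k := 1
  uniform := fun _ hT => (Finset.mem_powersetCard.1 hT).2

/-- One `y`-set covers at most `N ^ (z - y) ≤ N ^ (z - 1)` hyperedges, whereas their number grows
like `N ^ z`. This provides a sound dense instance for any `α > 0`. -/
theorem exists_completeInstance {z y : ℕ} (hy : 1 ≤ y) (hyz : y < z) {α : ℝ} (hα : 0 < α) (A : ℝ) :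
    ∃ N, (completeInstance z N).E.Nonempty ∧
      A * ((completeInstance z N).k : ℝ) * ((completeInstance z N).n : ℝ) ^ (z - y - 1) ≤
        (completeInstance z N).E.card ∧ (completeInstance z N).Sound α y := by
  set W : ℝ := (z : ℝ) ^ z * z.factorial with hW
  obtain ⟨M, hM⟩ := exists_nat_gt (max (max 1 A) (1 / α) * W)
  set N := max M z with hN
  have hz : 0 < z := by omega
  have hzN : z ≤ N := le_max_right _ _
  have hz' : (0 : ℝ) < W := by positivity
  have hN₁ : (1 : ℝ) ≤ N := by exact_mod_cast (show 1 ≤ N by omega)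
  have hMN : (M : ℝ) ≤ N := by exact_mod_cast le_max_left M z
  have hcard : (completeInstance z N).E.card = N.choose z := by
    simp [completeInstance, Finset.card_powersetCard]
  have hchoose : (N : ℝ) ^ z / W ≤ N.choose z := by
    have h₁ : N ≤ z * (N + 1 - z) := by
      obtain ⟨m, hm⟩ := Nat.exists_eq_add_of_le hzN
      rw [hm, show z + m + 1 - z = m + 1 by omega]
      nlinarith
    have h₂ : (N : ℝ) ^ z ≤ (z : ℝ) ^ z * ((N + 1 - z : ℕ) : ℝ) ^ z := by
      rw [← mul_pow]
      exact pow_le_pow_left₀ (Nat.cast_nonneg _) (by exact_mod_cast h₁) z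
    refine le_trans ?_ (Nat.pow_le_choose z N)
    rw [hW, ← div_div]
    refine div_le_div_of_nonneg_right ?_ (Nat.cast_nonneg _)
    rw [div_le_iff₀ (by positivity)]
    linarith
  have hbig : max (max 1 A) (1 / α) * (N : ℝ) ^ (z - 1) ≤ N.choose z := by
    refine le_trans ?_ hchoose
    rw [le_div_iff₀ hz']
    calc max (max 1 A) (1 / α) * (N : ℝ) ^ (z - 1) * W
        = max (max 1 A) (1 / α) * W * (N : ℝ) ^ (z - 1) := by ring
      _ ≤ N * (N : ℝ) ^ (z - 1) := by
          gcongr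
          exact hM.le.trans hMN
      _ = (N : ℝ) ^ z := by rw [← pow_succ']; congr 1; omega
  refine ⟨N, ?_, ?_, ?_⟩
  · rw [← Finset.card_pos, hcard]
    exact Nat.choose_pos hzN
  · rw [hcard]
    refine le_trans ?_ hbig
    change A * ((1 : ℕ) : ℝ) * (N : ℝ) ^ (z - y - 1) ≤ _
    rw [Nat.cast_one, mul_one]
    exact mul_le_mul ((le_max_right _ _).trans (le_max_left _ _))
      (pow_le_pow_right₀ hN₁ (by omega)) (by positivity) (by positivity)
  · intro S hS
    have h₁ : ((completeInstance z N).coverage S).card ≤ N ^ (z - y) := by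
      refine Finset.card_biUnion_le.trans ?_
      change ∑ i : Fin 1, _ ≤ _
      rw [Fintype.sum_unique]
      exact card_filter_superset_le _ (completeInstance z N).uniform _ (hS _)
    have h₂ : (N : ℝ) ^ (z - y) ≤ (N : ℝ) ^ (z - 1) := pow_le_pow_right₀ hN₁ (by omega)
    have h₃ : 1 / α * (N : ℝ) ^ (z - 1) ≤ N.choose z :=
      (mul_le_mul_of_nonneg_right (le_max_right _ _) (by positivity)).trans hbig
    rw [hcard]
    have h₄ : (((completeInstance z N).coverage S).card : ℝ) ≤ (N : ℝ) ^ (z - y) := by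
      exact_mod_cast h₁
    rw [one_div, inv_mul_le_iff₀ hα] at h₃
    linarith

theorem exists_subset_of_mem {z y : ℕ} (hyz : y ≤ z) (I : JohnsonInstance z) :
    ∀ T : I.E, ∃ S : Finset (Fin I.n), S.card = y ∧ S ⊆ T := by
  intro T
  obtain ⟨S, hST, hS⟩ := Finset.exists_subset_card_eq (s := T.1) (n := y)
    (by rw [I.uniform T T.2]; exact hyz)
  exact ⟨S, hS, hST⟩

theorem coverage_subset {z : ℕ} (I : JohnsonInstance z) (S : Fin I.k → Finset (Fin I.n)) :
    I.coverage S ⊆ I.E := by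
  intro T hT
  obtain ⟨i, -, hi⟩ := Finset.mem_biUnion.1 hT
  exact (Finset.mem_filter.1 hi).1

/-- With `k ≥ |E|`, each hyperedge can have a `y`-subset of its own. -/
theorem complete_of_card_le {z y : ℕ} (hyz : y ≤ z) (I : JohnsonInstance z) (hne : I.E.Nonempty)
    (h : I.E.card ≤ I.k) : I.Complete y := by
  have : Nonempty I.E := hne.to_subtype
  choose S hS hST using exists_subset_of_mem hyz I
  obtain ⟨φ⟩ : Nonempty (I.E ↪ Fin I.k) :=
    Function.Embedding.nonempty_of_card_le (by simpa using h)
  have hsurj := Function.invFun_surjective φ.injective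
  refine ⟨fun i => S (Function.invFun φ i), fun i => hS _, ?_⟩
  refine Finset.Subset.antisymm (coverage_subset I _) fun T hT => ?_
  obtain ⟨i, hi⟩ := hsurj ⟨T, hT⟩
  refine Finset.mem_biUnion.2 ⟨i, Finset.mem_univ _, Finset.mem_filter.2 ⟨hT, ?_⟩⟩
  dsimp only
  rw [hi]
  exact hST ⟨T, hT⟩

theorem one_le_of_complete_of_sound {z y : ℕ} {α : ℝ} {I : JohnsonInstance z}
    (hne : I.E.Nonempty) (hc : I.Complete y) (hs : I.Sound α y) : 1 ≤ α := by
  obtain ⟨S, hS, hcov⟩ := hc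
  have h := hs S hS
  rw [hcov] at h
  have : (0 : ℝ) < I.E.card := by exact_mod_cast hne.card_pos
  nlinarith

theorem pos_of_sound {z y : ℕ} (hyz : y ≤ z) {α : ℝ} {I : JohnsonInstance z}
    (hne : I.E.Nonempty) (hk : 1 ≤ I.k) (hs : I.Sound α y) : 0 < α := by
  obtain ⟨T, hT⟩ := hne
  obtain ⟨S, hS, hST⟩ := exists_subset_of_mem hyz I ⟨T, hT⟩
  have h := hs (fun _ => S) fun _ => hS
  have h₁ : 0 < (I.coverage fun _ => S).card :=
    Finset.card_pos.2 ⟨T, Finset.mem_biUnion.2 ⟨⟨0, hk⟩, Finset.mem_univ _,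
      Finset.mem_filter.2 ⟨hT, hST⟩⟩⟩
  have h₁' : (0 : ℝ) < (I.coverage fun _ => S).card := by exact_mod_cast h₁
  have h₂ : (0 : ℝ) < I.E.card := by exact_mod_cast Finset.card_pos.2 ⟨T, hT⟩
  exact pos_of_mul_pos_left (h₁'.trans_le h) h₂.le

/-- The ratio is below 1, so a constant map onto a string that is both a yes- and a no-instance is a
reduction. The hypothesis only supplies some polynomial-time machine. -/
theorem kMeansGap_NPHard_of_one_le {α ε : ℝ} {z y : ℕ} (hyz : y < z) (hα : 1 ≤ α) (hε : 0 < ε)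
    (h : DenseJohnsonCoverageNPHard α z y) :
    (kMeansGap (1 + (1 - α) / ((z : ℝ) - (y : ℝ)) - ε) (1 / (4 * Real.log 2))
      (1 / Real.log 2)).NPHard := by
  have hd : (0 : ℝ) < (z : ℝ) - y := sub_pos.2 (Nat.cast_lt.2 hyz)
  have hγ : 1 + (1 - α) / ((z : ℝ) - (y : ℝ)) - ε ≤ 1 := by
    have := div_nonpos_of_nonpos_of_nonneg (by linarith : 1 - α ≤ 0) hd.le
    linarith
  obtain ⟨s, hyes, hno⟩ := exists_mem_yes_and_no hγ
  obtain ⟨g, -, hg⟩ := h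
  intro L hL
  obtain ⟨f, hf, -, -⟩ := hg L hL
  exact ⟨fun _ => s, polyTimeComputable_const hf s, fun _ _ => hyes, fun _ _ => hno⟩

/-- What the reduction does with an input that encodes a dense instance. -/
theorem exists_output {α : ℝ} {z y b N₀ : ℕ} {A : ℝ} {g : ℕ → ℝ} {Q : PromiseProblem Γ'}
    (hyz : y < z) (hα : α < 1) (hg : ∀ n, N₀ ≤ n → A ≤ g n)
    (hQ : ∀ (I : JohnsonInstance z), I.E.Nonempty → 1 ≤ I.k →
      A * (I.k : ℝ) * (I.n : ℝ) ^ (z - y - 1) ≤ I.E.card →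
      ∀ l : List (Fin I.n → Bool), l.Nodup → l.toFinset = I.E.image incidence →
      (I.Complete y → encodeInstance I.k (outRows b (oneHot ((4 * z) ^ b))
        (l.map fun v => List.ofFn v)) ∈ Q.yes) ∧
      (I.Sound α y → encodeInstance I.k (outRows b (oneHot ((4 * z) ^ b))
        (l.map fun v => List.ofFn v)) ∈ Q.no))
    {sy : List Γ'} (hsy : sy ∈ Q.yes) {B : ℕ} (hB : 2 ^ N₀ * (N₀ + 1) + 2 ^ N₀ ≤ B)
    {I : JohnsonInstance z} {s : List Γ'} (hs : I.EncodedBy s) (hI : I.Dense y g)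
    (hsB : B ≤ s.length) :
    ∃ o, (I.Complete y → o ∈ Q.yes) ∧ (I.Sound α y → o ∈ Q.no) ∧
      ∃ (kb : List Bool) (rows : List (List Bool)) (N : ℕ),
        s = kb.map Γ'.bit ++ encodeWords rows ∧ rows ≠ [] ∧ (∀ v ∈ rows, v.length = N) ∧
        ((N < N₀ ∧ o = sy) ∨ (N₀ ≤ N ∧
          o = kb.map Γ'.bit ++ encodeWords (outRows b (oneHot ((4 * z) ^ b)) rows))) := by
  obtain ⟨l, hl, hlE, hs⟩ := hs
  obtain ⟨hne, hk, hdense⟩ := hI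
  have hlen : l.length = I.E.card := by
    rw [← List.toFinset_card_of_nodup hl, hlE]
    exact Finset.card_image_of_injective _ incidence_injective
  have hrows : (l.map fun v => List.ofFn v) ≠ [] := by
    rw [← List.length_pos_iff, List.length_map, hlen]
    exact hne.card_pos
  have hN : ∀ v ∈ l.map (fun v => List.ofFn v), v.length = I.n := by
    intro v hv
    obtain ⟨v, -, rfl⟩ := List.mem_map.1 hv
    simp
  rcases Nat.lt_or_ge I.n N₀ with hn | hn
  -- On a small universe the rows take at most `2 ^ N₀ * (N₀ + 1)` symbols, so in a long input the
  -- code of `k` has at least `2 ^ N₀ ≥ |E|` symbols. Then `k ≥ |E|`, the instance is complete, and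
  -- by `α < 1` it is not sound.
  · have hcomplete : I.Complete y := by
      refine complete_of_card_le hyz.le I hne ?_
      have h₁ : I.E.card ≤ 2 ^ N₀ := by
        refine (Finset.card_le_univ _).trans ?_
        rw [Fintype.card_finset, Fintype.card_fin]
        exact Nat.pow_le_pow_right two_pos hn.le
      have h₂ := length_encodeNat_le I.k
      have h₃ : s.length = (encodeNat I.k).length + I.E.card * (I.n + 1) := by
        rw [hs, encodeInstance_eq, List.length_append, List.length_map, length_encodeWords hN,
          List.length_map, hlen]
      have h₄ : I.E.card * (I.n + 1) ≤ 2 ^ N₀ * (N₀ + 1) := Nat.mul_le_mul h₁ (by omega)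
      omega
    refine ⟨sy, fun _ => hsy, fun h => ?_, encodeNat I.k, _, I.n, hs, hrows, hN, Or.inl ⟨hn, rfl⟩⟩
    have := one_le_of_complete_of_sound hne hcomplete h
    linarith
  · have hdense' : A * (I.k : ℝ) * (I.n : ℝ) ^ (z - y - 1) ≤ I.E.card := by
      refine le_trans ?_ hdense
      gcongr
      exact hg _ hn
    obtain ⟨hyes, hno⟩ := hQ I hne hk hdense' l hl hlE
    exact ⟨_, hyes, hno, encodeNat I.k, _, I.n, hs, hrows, hN, Or.inr ⟨hn, rfl⟩⟩

theorem kMeansGap_NPHard_of_lt_one {α ε : ℝ} {z y : ℕ} (hy : 1 ≤ y) (hyz : y < z) (hα : α < 1)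
    (hε : 0 < ε) (h : DenseJohnsonCoverageNPHard α z y) :
    ∃ ρ : ℝ, 0 < ρ ∧ ∃ K : ℝ,
      (kMeansGap (1 + (1 - α) / ((z : ℝ) - (y : ℝ)) - ε) ρ K).NPHard := by
  classical
  obtain ⟨b, A, ρ, K, hρ, hK, hgap⟩ := exists_gap_of_dense hy hyz hα hε
  refine ⟨ρ, hρ, K, ?_⟩
  set Q := kMeansGap (1 + (1 - α) / ((z : ℝ) - (y : ℝ)) - ε) ρ K
  obtain ⟨g, hg, hhard⟩ := h
  obtain ⟨N₀, hN₀⟩ := Filter.eventually_atTop.1 (hg.eventually_ge_atTop A)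
  obtain ⟨sy, hsy⟩ : ∃ s, s ∈ Q.yes := exists_mem_yes hρ hK
  -- A no-string is needed only if sound instances exist, which forces `α > 0`; otherwise any string
  -- will do.
  obtain ⟨sn, hsn⟩ : ∃ s, 0 < α → s ∈ Q.no := by
    by_cases hα₀ : 0 < α
    · obtain ⟨N, hne, hdense, hsound⟩ := exists_completeInstance hy hyz hα₀ A
      obtain ⟨s, l, hl, hlE, -⟩ := exists_encodes 1 ((completeInstance z N).E.image incidence)
      exact ⟨_, fun _ => (hgap _ hne le_rfl hdense l hl hlE).2 hsound⟩
    · exact ⟨[], fun h => absurd h hα₀⟩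
  -- The table need not be computable: only finitely many short strings consult it, and their
  -- answers are built into the program.
  set table : List Γ' → List Γ' := fun w =>
    if w ∈ (denseJohnsonCoverage α z y g).yes then sy else sn with htable
  set B := 2 ^ N₀ * (N₀ + 1) + 2 ^ N₀ with hB
  intro L hL
  obtain ⟨f, hf, hfyes, hfno⟩ := hhard L hL
  have hex : ∀ x, ∃ o, (x ∈ L → o ∈ Q.yes) ∧ (x ∉ L → o ∈ Q.no) ∧
      (((f x).length < B ∧ o = table (f x)) ∨ (B ≤ (f x).length ∧
      ∃ (kb : List Bool) (rows : List (List Bool)) (N : ℕ),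
        f x = kb.map Γ'.bit ++ encodeWords rows ∧ rows ≠ [] ∧ (∀ v ∈ rows, v.length = N) ∧
        ((N < N₀ ∧ o = sy) ∨ (N₀ ≤ N ∧
          o = kb.map Γ'.bit ++ encodeWords (outRows b (oneHot ((4 * z) ^ b)) rows))))) := by
    intro x
    rcases Nat.lt_or_ge (f x).length B with hlt | hge
    · refine ⟨table (f x), fun hx => ?_, fun hx => ?_, Or.inl ⟨hlt, rfl⟩⟩
      · rw [htable]
        dsimp only
        rw [if_pos (hfyes x hx)]
        exact hsy
      · obtain ⟨I, hI, hD, hS⟩ := hfno x hx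
        rw [htable]
        dsimp only
        rw [if_neg]
        · exact hsn (pos_of_sound hyz.le hD.1 hD.2.1 hS)
        · rintro ⟨I', hI', hD', hC⟩
          -- A string encodes only one instance with hyperedges, so a no-string cannot also be a
          -- yes-string when `α < 1`.
          obtain rfl := eq_of_encodedBy hD.1 hI hI'
          have := one_le_of_complete_of_sound hD.1 hC hS
          linarith
    · by_cases hx : x ∈ L
      · obtain ⟨I, hI, hD, hC⟩ := hfyes x hx
        obtain ⟨o, ho, -, h⟩ := exists_output hyz hα hN₀ hgap hsy hB.ge hI hD hge
        exact ⟨o, fun _ => ho hC, fun h => absurd hx h, Or.inr ⟨hge, h⟩⟩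
      · obtain ⟨I, hI, hD, hS⟩ := hfno x hx
        obtain ⟨o, -, ho, h⟩ := exists_output hyz hα hN₀ hgap hsy hB.ge hI hD hge
        exact ⟨o, fun h => absurd h hx, fun _ => ho hS, Or.inr ⟨hge, h⟩⟩
  choose o hyes hno ho using hex
  have hz : 0 < (4 * z) ^ b := by
    have : 0 < z := by omega
    positivity
  exact ⟨o, polyTimeComputable_reduction hf b hz table sy B N₀ ho, hyes, hno⟩

theorem kMeansGap_NPHard {α ε : ℝ} {z y : ℕ} (hy : 1 ≤ y) (hyz : y < z) (hε : 0 < ε)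
    (h : DenseJohnsonCoverageNPHard α z y) :
    ∃ ρ : ℝ, 0 < ρ ∧ ∃ K : ℝ,
      (kMeansGap (1 + (1 - α) / ((z : ℝ) - (y : ℝ)) - ε) ρ K).NPHard := by
  rcases lt_or_ge α 1 with hα | hα
  · exact kMeansGap_NPHard_of_lt_one hy hyz hα hε h
  · exact ⟨_, by have := Real.log_pos one_lt_two; positivity, _,
      kMeansGap_NPHard_of_one_le hyz hα hε h⟩

end KMeansReduction

theorem mainTheorem5 :
    (∀ (α : ℝ) (z y : ℕ), 1 ≤ y → y < z → DenseJohnsonCoverageNPHard α z y →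
      ∀ ε : ℝ, 0 < ε → ∃ ρ : ℝ, 0 < ρ ∧ ∃ K : ℝ,
        (kMeansGap (1 + (1 - α) / ((z : ℝ) - (y : ℝ)) - ε) ρ K).NPHard) ∧
    (DenseJohnsonCoverageHypothesis →
      ∀ ε : ℝ, 0 < ε → ∃ ρ : ℝ, 0 < ρ ∧ ∃ K : ℝ,
        (kMeansGap (1 + 1 / Real.exp 1 - ε) ρ K).NPHard) := by
  refine ⟨fun α z y hy hyz h ε hε => KMeansReduction.kMeansGap_NPHard hy hyz hε h,
    fun h ε hε => ?_⟩
  -- Half of `ε` goes into the hypothesis and half into the gap; with `y = z - 1` the denominator is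
  -- 1.
  obtain ⟨z, hz, hzh⟩ := h (ε / 2) (half_pos hε)
  obtain ⟨ρ, hρ, K, hK⟩ := KMeansReduction.kMeansGap_NPHard (by omega : 1 ≤ z - 1)
    (by omega : z - 1 < z) (half_pos hε) hzh
  refine ⟨ρ, hρ, K, ?_⟩
  have e : (1 : ℝ) + (1 - (1 - 1 / Real.exp 1 + ε / 2)) / ((z : ℝ) - ((z - 1 : ℕ) : ℝ)) - ε / 2 =
      1 + 1 / Real.exp 1 - ε := by
    rw [Nat.cast_sub (by omega : 1 ≤ z), Nat.cast_one, sub_sub_cancel, div_one]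
    ring
  rwa [e] at hK
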